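/- Let $k$ be an algebraically closed field of arbitrary characteristic, let $m<N$ be non-negative integers, and let $X$ be a closed subscheme of $\mathbb{A}^N_k$ such that the ideal $I_X\subset k[x_1,\ldots,x_N]$ of global sections of its ideal sheaf is generated by $m$ polynomials. For $n\ge 0$ let $\mathcal{L}_n(X)$ be the scheme of $n$-jets of $X$, that is, the $k$-scheme representing the functor $T\mapsto \mathrm{Hom}_k\bigl(T\times_{\mathrm{Spec}\,k}\mathrm{Spec}\,k[t]/(t^{n+1}),\,X\bigr)$ on $k$-schemes, and let $[\mathcal{L}_n(X)]$ be the class of $\mathcal{L}_n(X)$, endowed with its reduced structure, in the Grothendieck ring of varieties $K_0(\mathrm{Var}_k)$. Here a variety is a reduced separated scheme of finite type over $k$, and $K_0(\mathrm{Var}_k)$ is the abelian group generated by the isomorphism classes $[V]$ of varieties modulo the relations $[V]=[V\setminus W]+[W]$ for $W$ closed in $V$, with product $[V]\cdot[W]=[V\times_k W]$; put $\mathbb{L}=[\mathbb{A}^1_k]$. Then, for every integer $n\ge 0$, $[\mathcal{L}_n(X)]$ is a multiple of $\mathbb{L}^{\lceil (N-m+1)(n/2)\rceil}$ in $K_0(\mathrm{Var}_k)$.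 -/

import Mathlib

open CategoryTheory AlgebraicGeometry Limits MonoidalCategory TensorProduct Opposite

universe u

namespace JetClass

/-! ### Varieties over an algebraically closed field -/

/-- `V` is an algebraic variety over `k`: a reduced separated scheme of finite type over `k`. -/
structure IsVar (k : Type u) [Field k] (V : Over (Spec (CommRingCat.of k))) : Prop where
  isReduced : IsReduced V.left
  isSeparated : IsSeparated V.hom
  locallyOfFiniteType : LocallyOfFiniteType V.hom
  quasiCompact : QuasiCompact V.hom

theorem isReduced_tensorProduct (k A B : Type u) [Field k] [IsAlgClosed k] [CommRing A] [Algebra k A]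
    [CommRing B] [Algebra k B] [Algebra.FiniteType k A] [_root_.IsReduced A] [_root_.IsReduced B] :
    _root_.IsReduced (A ⊗[k] B) := by
  have : IsJacobsonRing A := isJacobsonRing_of_finiteType (A := k)
  refine ⟨fun x hx => ?_⟩
  let b := Module.Free.chooseBasis k B
  let c := Algebra.TensorProduct.basis A b
  apply c.ext_elem
  intro i
  rw [map_zero]
  have key : ∀ M : Ideal A, M.IsMaximal → c.repr x i ∈ M := by
    intro M hM
    let _ : Field (A ⧸ M) := Ideal.Quotient.field M
    have : Module.Finite k (A ⧸ M) := finite_of_finite_type_of_isJacobsonRing k (A ⧸ M)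
    have hbij : Function.Bijective (algebraMap k (A ⧸ M)) :=
      IsAlgClosed.algebraMap_bijective_of_isIntegral
    let e : (A ⧸ M) ≃ₐ[k] k := (AlgEquiv.ofBijective (Algebra.ofId k (A ⧸ M)) hbij).symm
    let φ : A →ₐ[k] k := e.toAlgHom.comp (Ideal.Quotient.mkₐ k M)
    let ψ : A ⊗[k] B →ₐ[k] B :=
      Algebra.TensorProduct.lift ((Algebra.ofId k B).comp φ) (AlgHom.id k B) (fun _ _ => .all _ _)
    have h0 : ψ x = 0 := (hx.map ψ).eq_zero
    have h1 : ∀ y : A ⊗[k] B, b.repr (ψ y) i = φ (c.repr y i) := by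
      intro y
      induction y with
      | zero => simp
      | add y z hy hz => simp [hy, hz]
      | tmul a b' =>
        simp [ψ, c, Algebra.ofId_apply, ← Algebra.smul_def]
    have h2 : φ (c.repr x i) = 0 := by rw [← h1, h0]; simp
    have h3 : Ideal.Quotient.mkₐ k M (c.repr x i) = 0 := e.injective (by simpa [φ] using h2)
    exact Ideal.Quotient.eq_zero_iff_mem.mp h3
  have h4 : c.repr x i ∈ (⊥ : Ideal A).jacobson := by
    rw [Ideal.jacobson, Ideal.mem_sInf]
    intro M hM
    exact key M hM.2
  rw [Ideal.jacobson_bot] at h4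
  have h5 : (⊥ : Ideal A).jacobson = ⊥ := by
    apply IsJacobsonRing.out'
    exact Ideal.isRadical_bot
  rw [Ideal.jacobson_bot] at h5
  rw [h5] at h4
  simpa using h4

theorem isReduced_prod (k : Type u) [Field k] [IsAlgClosed k] (V W : Over (Spec (CommRingCat.of k)))
    (hV : IsReduced V.left) (hV' : LocallyOfFiniteType V.hom) (hW : IsReduced W.left) :
    IsReduced (pullback V.hom W.hom) := by
  have aff : ∀ (A B : CommRingCat.{u}) (f : Spec A ⟶ Spec (CommRingCat.of k))
     (g : Spec B ⟶ Spec (CommRingCat.of k)), IsReduced (Spec A) → LocallyOfFiniteType f →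
      IsReduced (Spec B) → IsReduced (pullback f g) := by
    intro A B f g hA hf hB
    obtain ⟨f, rfl⟩ := Spec.map_surjective f
    obtain ⟨g, rfl⟩ := Spec.map_surjective g
    algebraize [f.hom, g.hom]
    have h1 : _root_.IsReduced A := (affine_isReduced_iff A).mp hA
    have h2 : _root_.IsReduced B := (affine_isReduced_iff B).mp hB
    have h3 : Algebra.FiniteType k A := by
      have := (HasRingHomProperty.Spec_iff (P := @LocallyOfFiniteType)).mp hf
      exact this
    have h4 := isReduced_tensorProduct k A B
    have h5 : IsReduced (Spec (.of (A ⊗[k] B))) := (affine_isReduced_iff _).mpr h4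
    exact isReduced_of_isOpenImmersion (pullbackSpecIso k A B).hom
  refine @IsReduced.of_openCover _ (Scheme.Pullback.openCoverOfLeftRight V.left.affineCover W.left.affineCover _ _) ?_
  intro i
  refine aff _ _ _ _ ?_ ?_ ?_
  · exact inferInstanceAs (IsReduced (V.left.affineCover.X i.1))
  · have : LocallyOfFiniteType (V.left.affineCover.f i.1) := inferInstance
    exact inferInstanceAs (LocallyOfFiniteType (V.left.affineCover.f i.1 ≫ V.hom))
  · exact inferInstanceAs (IsReduced (W.left.affineCover.X i.2))

/-- Being a variety, as a property of objects of the category of `k`-schemes. -/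
def isVariety (k : Type u) [Field k] : ObjectProperty (Over (Spec (CommRingCat.of k))) := IsVar k

/-- The fibre product over `k` of two varieties is a variety, and so is `Spec k`. -/
instance isVariety_isMonoidal (k : Type u) [Field k] [IsAlgClosed k] : (isVariety k).IsMonoidal where
  prop_unit := by
    refine ⟨?_, ?_, ?_, ?_⟩
    · dsimp; infer_instance
    all_goals dsimp; infer_instance
  prop_tensor V W hV hW := by
    obtain ⟨h1, h2, h3, h4⟩ := hV
    obtain ⟨h1', h2', h3', h4'⟩ := hW
    refine ⟨isReduced_prod k V W h1 h3 h1', ?_, ?_, ?_⟩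
    all_goals dsimp; infer_instance

/-- The category of varieties over `k`. -/
abbrev Variety (k : Type u) [Field k] := (isVariety k).FullSubcategory

/-! ### The Grothendieck ring of varieties -/

section Grothendieck

variable (k : Type u) [Field k] [IsAlgClosed k]

/-- The generator attached to `V` in the free abelian group on the set of isomorphism classes of
varieties (`Skeleton` is the type of isomorphism classes of objects). -/
noncomputable def isoClass (V : Variety k) : FreeAbelianGroup (Skeleton (Variety k)) :=
  FreeAbelianGroup.of (toSkeleton V)

/-- The elements `[V] - ([V \ Z] + [Z])`, for `Z` a closed subvariety of `V`: here `Z` is given by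
a closed immersion into `V` and `V \ Z` by an open immersion onto the complement. -/
def scissorRelations : Set (FreeAbelianGroup (Skeleton (Variety k))) :=
  {x | ∃ (V Z U : Variety k) (i : Z ⟶ V) (j : U ⟶ V), IsClosedImmersion i.hom.left ∧
    IsOpenImmersion j.hom.left ∧ Set.range j.hom.left = (Set.range i.hom.left)ᶜ ∧
    x = isoClass k V - (isoClass k U + isoClass k Z)}

/-- The product of the free abelian group on isomorphism classes is `[V] * [W] = [V × W]`. -/
theorem isoClass_mul (V W : Variety k) : isoClass k V * isoClass k W = isoClass k (V ⊗ W) := by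
  rw [isoClass, isoClass, isoClass, Skeleton.toSkeleton_tensorObj]
  exact (FreeAbelianGroup.of_mul_of _ _)

theorem mul_scissorRelations (W : Variety k) (x) (hx : x ∈ scissorRelations k) :
    isoClass k W * x ∈ scissorRelations k := by
  obtain ⟨V, Z, U, i, j, hi, hj, hij, rfl⟩ := hx
  have e : ∀ {S T : Over (Spec (CommRingCat.of k))} (f : S ⟶ T), (W.obj ◁ f).left =
    pullback.map _ _ _ _ (𝟙 _) f.left (𝟙 _) (by simp) (by simp) := fun f => rfl
  refine ⟨W ⊗ V, W ⊗ Z, W ⊗ U, W ◁ i, W ◁ j, ?_, ?_, ?_, ?_⟩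
  · change IsClosedImmersion (W.obj ◁ i.hom).left
    rw [e, pullback_map_eq_pullbackFstFstIso_inv]
    infer_instance
  · change IsOpenImmersion (W.obj ◁ j.hom).left
    rw [e, pullback_map_eq_pullbackFstFstIso_inv]
    infer_instance
  · change Set.range (W.obj ◁ j.hom).left = (Set.range (W.obj ◁ i.hom).left)ᶜ
    rw [e, e, Scheme.Pullback.range_map, Scheme.Pullback.range_map, hij]
    simp
  · rw [mul_sub, mul_add, isoClass_mul, isoClass_mul, isoClass_mul]

/-- The subgroup generated by the scissor relations. It is stable under multiplication by
isomorphism classes of varieties, hence an ideal. -/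
noncomputable def scissorIdeal : Ideal (FreeAbelianGroup (Skeleton (Variety k))) where
  __ := AddSubgroup.closure (scissorRelations k)
  smul_mem' c x hx := by
    change c * x ∈ AddSubgroup.closure (scissorRelations k)
    change x ∈ AddSubgroup.closure (scissorRelations k) at hx
    induction c using FreeAbelianGroup.induction_on with
    | zero => simp
    | of v =>
      obtain ⟨v, rfl⟩ := Quotient.mk_surjective v
      change isoClass k v * x ∈ _
      induction hx using AddSubgroup.closure_induction with
      | mem y hy => exact AddSubgroup.subset_closure (mul_scissorRelations k v y hy)
      | zero => simp
      | add y z _ _ hy hz => rw [mul_add]; exact add_mem hy hz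
      | neg y _ hy => rw [mul_neg]; exact neg_mem hy
    | neg v h => rw [neg_mul]; exact neg_mem h
    | add a b ha hb => rw [add_mul]; exact add_mem ha hb

/-- The Grothendieck ring of varieties over `k`. -/
abbrev GrothendieckRing := FreeAbelianGroup (Skeleton (Variety k)) ⧸ scissorIdeal k

/-- The class `[V]` of a variety. -/
noncomputable def cls (V : Variety k) : GrothendieckRing k :=
  Ideal.Quotient.mk (scissorIdeal k) (isoClass k V)

end Grothendieck

/-! ### Reduced structure -/

theorem isReduced_subscheme_nilradical (X : Scheme.{u}) : IsReduced X.nilradical.subscheme := by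
  refine @IsReduced.of_openCover _ X.nilradical.subschemeCover.openCover ?_
  intro U
  change IsReduced (Spec (X.nilradical.subschemeCover.X U))
  rw [affine_isReduced_iff]
  exact (Ideal.isRadical_iff_quotient_reduced _).mp (Ideal.radical_isRadical _)

/-- A separated scheme of finite type over `k`, endowed with its reduced structure. -/
noncomputable def reducedVariety (k : Type u) [Field k] (V : Over (Spec (CommRingCat.of k)))
    [IsSeparated V.hom] [LocallyOfFiniteType V.hom]
    [QuasiCompact V.hom] : Variety k :=
  ⟨Over.mk (V.left.nilradical.subschemeι ≫ V.hom), isReduced_subscheme_nilradical V.left,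
    by dsimp; infer_instance, by dsimp; infer_instance, by dsimp; infer_instance⟩

/-! ### Representability of `T ↦ Hom(T × Spec D, X)` for `X` affine and `D` finite over `k` -/

section Weil
variable {k : Type u} [Field k] {D : Type u} [CommRing D] [Algebra k D] {ι : Type}
  (b : Module.Basis ι k D) {N : ℕ}

theorem weil_repr_map {A A' : Type u} [CommRing A] [Algebra k A] [CommRing A'] [Algebra k A']
    (φ : A →ₐ[k] A') (x : A ⊗[k] D) (i : ι) :
    (Algebra.TensorProduct.basis A' b).repr (Algebra.TensorProduct.map φ (AlgHom.id k D) x) i =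
      φ ((Algebra.TensorProduct.basis A b).repr x i) := by
  induction x with
  | zero => simp
  | add y z hy hz => simp [hy, hz]
  | tmul a d => simp

variable [Fintype ι]

/-- The algebra map `x_s ↦ ∑ i, X (s, i) ⊗ b i` with indeterminate coordinates `X (s, i)`. -/
noncomputable def weilHom (N : ℕ) :
    MvPolynomial (Fin N) k →ₐ[k] MvPolynomial (Fin N × ι) k ⊗[k] D :=
  MvPolynomial.aeval fun s => ∑ i, (MvPolynomial.X (s, i) : MvPolynomial (Fin N × ι) k) ⊗ₜ[k] b i

/-- The ideal generated by the coordinates, in the basis `b`, of the images of elements of `I`. -/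
noncomputable def weilIdeal (I : Ideal (MvPolynomial (Fin N) k)) :
    Ideal (MvPolynomial (Fin N × ι) k) :=
  Ideal.span {r | ∃ f ∈ I, ∃ i,
    r = (Algebra.TensorProduct.basis (MvPolynomial (Fin N × ι) k) b).repr (weilHom b N f) i}

theorem weilHom_repr_X (s : Fin N) (i : ι) :
    (Algebra.TensorProduct.basis (MvPolynomial (Fin N × ι) k) b).repr (weilHom b N (.X s)) i =
      .X (s, i) := by
  classical
  simp [weilHom, Finsupp.single_apply]

/-- The universal point of the Weil restriction of `k[x_1, …, x_N] / I`. -/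
noncomputable def weilUniv (I : Ideal (MvPolynomial (Fin N) k)) :
    (MvPolynomial (Fin N) k ⧸ I) →ₐ[k] (MvPolynomial (Fin N × ι) k ⧸ weilIdeal b I) ⊗[k] D :=
  Ideal.Quotient.liftₐ I
    ((Algebra.TensorProduct.map (Ideal.Quotient.mkₐ k (weilIdeal b I)) (AlgHom.id k D)).comp
      (weilHom b N)) (by
    intro f hf
    apply (Algebra.TensorProduct.basis _ b).ext_elem
    intro i
    rw [map_zero, AlgHom.comp_apply, weil_repr_map]
    exact Ideal.Quotient.eq_zero_iff_mem.mpr (Ideal.subset_span ⟨f, hf, i, rfl⟩))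

theorem weilUniv_mk (I : Ideal (MvPolynomial (Fin N) k)) (f) :
    weilUniv b I (Ideal.Quotient.mk I f) =
      Algebra.TensorProduct.map (Ideal.Quotient.mkₐ k (weilIdeal b I)) (AlgHom.id k D)
        (weilHom b N f) := rfl

theorem weilUniv_bijective (I : Ideal (MvPolynomial (Fin N) k)) (A : Type u) [CommRing A]
    [Algebra k A] : Function.Bijective
      (fun φ : (MvPolynomial (Fin N × ι) k ⧸ weilIdeal b I) →ₐ[k] A =>
        (Algebra.TensorProduct.map φ (AlgHom.id k D)).comp (weilUniv b I)) := by
  constructor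
  · intro φ ψ h
    apply Ideal.Quotient.algHom_ext
    apply MvPolynomial.algHom_ext
    rintro ⟨s, i⟩
    have h1 := congrArg (fun t => (Algebra.TensorProduct.basis A b).repr
      (t (Ideal.Quotient.mk I (.X s))) i) h
    simp only [AlgHom.comp_apply, weilUniv_mk] at h1
    rw [weil_repr_map, weil_repr_map, weil_repr_map, weil_repr_map, weilHom_repr_X] at h1
    exact h1
  · intro ψ
    let φ₀ : MvPolynomial (Fin N × ι) k →ₐ[k] A := MvPolynomial.aeval fun p =>
      (Algebra.TensorProduct.basis A b).repr (ψ (Ideal.Quotient.mk I (.X p.1))) p.2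
    have h0 : (Algebra.TensorProduct.map φ₀ (AlgHom.id k D)).comp (weilHom b N) =
        ψ.comp (Ideal.Quotient.mkₐ k I) := by
      apply MvPolynomial.algHom_ext
      intro s
      apply (Algebra.TensorProduct.basis A b).ext_elem
      intro i
      rw [AlgHom.comp_apply, weil_repr_map, weilHom_repr_X]
      simp [φ₀]
    have h0' : ∀ f, Algebra.TensorProduct.map φ₀ (AlgHom.id k D) (weilHom b N f) =
        ψ (Ideal.Quotient.mk I f) := fun f => congrArg (fun t => t f) h0
    have hJ : weilIdeal b I ≤ RingHom.ker φ₀ := by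
      rw [weilIdeal, Ideal.span_le]
      rintro r ⟨f, hf, i, rfl⟩
      change φ₀ _ = 0
      rw [← weil_repr_map, h0', Ideal.Quotient.eq_zero_iff_mem.mpr hf]
      simp
    refine ⟨Ideal.Quotient.liftₐ _ φ₀ hJ, ?_⟩
    apply AlgHom.ext
    intro x
    obtain ⟨f, rfl⟩ := Ideal.Quotient.mk_surjective x
    rw [← h0' f]
    change Algebra.TensorProduct.map _ (AlgHom.id k D) (weilUniv b I (Ideal.Quotient.mk I f)) = _
    rw [weilUniv_mk, ← AlgHom.comp_apply, ← Algebra.TensorProduct.map_comp]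
    rfl
end Weil

theorem exists_weilRestriction (k : Type u) [Field k] (B D : Type u) [CommRing B] [Algebra k B]
    (hB : Algebra.FiniteType k B) [CommRing D] [Algebra k D] [Module.Finite k D] :
    ∃ (E : Type u) (_ : CommRing E) (_ : Algebra k E) (_ : Algebra.FiniteType k E)
      (w : B →ₐ[k] E ⊗[k] D),
      ∀ (A : Type u) [CommRing A] [Algebra k A], Function.Bijective
        (fun φ : E →ₐ[k] A => (Algebra.TensorProduct.map φ (AlgHom.id k D)).comp w) := by
  obtain ⟨N, π, hπ⟩ := Algebra.FiniteType.iff_quotient_mvPolynomial''.mp hB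
  let b := Module.finBasis k D
  let e : (MvPolynomial (Fin N) k ⧸ RingHom.ker π) ≃ₐ[k] B :=
    Ideal.quotientKerAlgEquivOfSurjective hπ
  refine ⟨_, inferInstance, inferInstance, inferInstance,
    (weilUniv b (RingHom.ker π)).comp e.symm.toAlgHom, fun A _ _ => ?_⟩
  have h := weilUniv_bijective b (RingHom.ker π) A
  constructor
  · intro φ ψ hφ
    apply h.1
    apply AlgHom.ext
    intro x
    have h1 := congrArg (fun t => t (e x)) hφ
    simpa using h1
  · intro ψ
    obtain ⟨φ, hφ⟩ := h.2 (ψ.comp e.toAlgHom)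
    refine ⟨φ, ?_⟩
    apply AlgHom.ext
    intro x
    have h1 := congrArg (fun t => t (e.symm x)) hφ
    simpa using h1


/-- `Spec A` as a `k`-scheme. -/
noncomputable def specOver (k : Type u) [Field k] (A : Type u) [CommRing A] [Algebra k A] :
    Over (Spec (CommRingCat.of k)) :=
  Over.mk (Spec.map (CommRingCat.ofHom (algebraMap k A)))

/-- The morphism of `k`-schemes attached to a map of `k`-algebras. -/
noncomputable def specOverMap (k : Type u) [Field k] {A B : Type u} [CommRing A] [Algebra k A] [CommRing B]
    [Algebra k B] (φ : B →ₐ[k] A) : specOver k A ⟶ specOver k B :=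
  Over.homMk (Spec.map (CommRingCat.ofHom φ.toRingHom)) (by
    simp only [specOver, Over.mk_hom]
    rw [← Spec.map_comp, ← CommRingCat.ofHom_comp]
    congr 2
    exact φ.comp_algebraMap)

theorem specOverMap_comp (k : Type u) [Field k] {A B C : Type u} [CommRing A] [Algebra k A] [CommRing B]
    [Algebra k B] [CommRing C] [Algebra k C] (φ : B →ₐ[k] A) (ψ : C →ₐ[k] B) :
    specOverMap k φ ≫ specOverMap k ψ = specOverMap k (φ.comp ψ) := by
  ext
  exact (Spec.map_comp _ _).symm

theorem specOverMap_bijective (k : Type u) [Field k] (A B : Type u) [CommRing A] [Algebra k A] [CommRing B]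
    [Algebra k B] : Function.Bijective (specOverMap k : (B →ₐ[k] A) → _) := by
  constructor
  · intro φ ψ h
    have h1 := congrArg (fun t => t.left) h
    have h2 := Spec.map_injective h1
    apply AlgHom.ext
    intro x
    exact congrArg (fun t => t.hom x) h2
  · intro f
    obtain ⟨g, hg⟩ := Spec.map_surjective (R := CommRingCat.of B) (S := CommRingCat.of A) f.left
    refine ⟨{ g.hom with commutes' := ?_ }, ?_⟩
    · have h1 : f.left ≫ Spec.map (CommRingCat.ofHom (algebraMap k B)) =
        Spec.map (CommRingCat.ofHom (algebraMap k A)) := Over.w f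
      rw [← hg] at h1
      have h2 := Spec.map_injective ((Spec.map_comp _ _).trans h1)
      intro r
      exact congrArg (fun t => t.hom r) h2
    · ext
      exact hg

theorem exists_iso_specOver (k : Type u) [Field k] (T : Over (Spec (CommRingCat.of k)))
    (hT : IsAffine T.left) : ∃ (A : Type u) (_ : CommRing A) (_ : Algebra k A),
      Nonempty (specOver k A ≅ T) := by
  obtain ⟨f, hf⟩ := Spec.map_surjective (T.left.isoSpec.inv ≫ T.hom)
  let _ : Algebra k Γ(T.left, ⊤) := f.hom.toAlgebra
  exact ⟨Γ(T.left, ⊤), inferInstance, inferInstance, ⟨Over.isoMk T.left.isoSpec.symm hf.symm⟩⟩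

/-- `Spec A × Spec B = Spec (A ⊗ B)` over `k`. -/
noncomputable def specOverProd (k : Type u) [Field k] (A B : Type u) [CommRing A] [Algebra k A] [CommRing B]
    [Algebra k B] : specOver k A ⊗ specOver k B ≅ specOver k (A ⊗[k] B) :=
  Over.isoMk (pullbackSpecIso k A B) (pullbackSpecIso_hom_base k A B)

theorem specOverProd_inv_fst (k : Type u) [Field k] (A B : Type u) [CommRing A] [Algebra k A]
    [CommRing B] [Algebra k B] : (specOverProd k A B).inv ≫ CartesianMonoidalCategory.fst _ _ =
      specOverMap k (Algebra.TensorProduct.includeLeft : A →ₐ[k] A ⊗[k] B) := by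
  apply Over.OverMorphism.ext
  exact pullbackSpecIso_inv_fst k A B

theorem specOverProd_inv_snd (k : Type u) [Field k] (A B : Type u) [CommRing A] [Algebra k A]
    [CommRing B] [Algebra k B] : (specOverProd k A B).inv ≫ CartesianMonoidalCategory.snd _ _ =
      specOverMap k (Algebra.TensorProduct.includeRight : B →ₐ[k] A ⊗[k] B) := by
  apply Over.OverMorphism.ext
  exact pullbackSpecIso_inv_snd k A B

theorem specOverMap_whiskerRight (k : Type u) [Field k] (A B D : Type u) [CommRing A] [Algebra k A]
    [CommRing B] [Algebra k B] [CommRing D] [Algebra k D] (φ : B →ₐ[k] A) :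
    (specOverProd k A D).hom ≫ specOverMap k (Algebra.TensorProduct.map φ (AlgHom.id k D)) =
      specOverMap k φ ▷ specOver k D ≫ (specOverProd k B D).hom := by
  have h1 : (specOverProd k A D).inv ≫ specOverMap k φ ▷ specOver k D =
      specOverMap k (Algebra.TensorProduct.map φ (AlgHom.id k D)) ≫ (specOverProd k B D).inv := by
    apply CartesianMonoidalCategory.hom_ext
    · rw [Category.assoc, CartesianMonoidalCategory.whiskerRight_fst, ← Category.assoc,
        specOverProd_inv_fst, Category.assoc, specOverProd_inv_fst, specOverMap_comp,
        specOverMap_comp]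
      congr 1
    · rw [Category.assoc, CartesianMonoidalCategory.whiskerRight_snd,
        specOverProd_inv_snd, Category.assoc, specOverProd_inv_snd, specOverMap_comp]
      congr 1
      ext x
      simp
  rw [← Iso.eq_inv_comp, ← Category.assoc, h1, Category.assoc, Iso.inv_hom_id, Category.comp_id]

theorem exists_weilRestriction_algSpec (k : Type u) [Field k] (X : Over (Spec (CommRingCat.of k)))
    (hX : IsAffine X.left) (hX' : LocallyOfFiniteType X.hom) (D : Type u) [CommRing D] [Algebra k D]
    [Module.Finite k D] :
    ∃ (E : Over (Spec (CommRingCat.of k))) (_ : IsAffine E.left) (_ : LocallyOfFiniteType E.hom)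
      (w : E ⊗ specOver k D ⟶ X), ∀ (T : Over (Spec (CommRingCat.of k))), IsAffine T.left →
      Function.Bijective (fun f : T ⟶ E => f ▷ specOver k D ≫ w) := by
  obtain ⟨B, _, _, ⟨eX⟩⟩ := exists_iso_specOver k X hX
  have hB : Algebra.FiniteType k B := by
    have h1 : LocallyOfFiniteType (specOver k B).hom := by
      have : IsIso eX.hom.left := inferInstanceAs (IsIso ((Over.forget _).map eX.hom))
      rw [← Over.w eX.hom]; infer_instance
    have := (HasRingHomProperty.Spec_iff (P := @LocallyOfFiniteType)).mp h1
    exact RingHom.finiteType_algebraMap.mp this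
  obtain ⟨E, _, _, hE, w, hw⟩ := exists_weilRestriction k B D hB
  refine ⟨specOver k E, inferInstanceAs (IsAffine (Spec _)), ?_,
    (specOverProd k E D).hom ≫ specOverMap k w ≫ eX.hom, ?_⟩
  · exact (HasRingHomProperty.Spec_iff (P := @LocallyOfFiniteType)).mpr
      (RingHom.finiteType_algebraMap.mpr hE)
  intro T hT
  obtain ⟨A, _, _, ⟨e⟩⟩ := exists_iso_specOver k T hT
  have key : ∀ φ : E →ₐ[k] A, specOverMap k φ ▷ specOver k D ≫
      (specOverProd k E D).hom ≫ specOverMap k w ≫ eX.hom = (specOverProd k A D).hom ≫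
        specOverMap k ((Algebra.TensorProduct.map φ (AlgHom.id k D)).comp w) ≫ eX.hom := by
    intro φ
    rw [← specOverMap_comp, ← Category.assoc, ← specOverMap_whiskerRight]
    simp only [Category.assoc]
  have h1 : Function.Bijective (fun f : specOver k A ⟶ specOver k E => f ▷ specOver k D ≫
      (specOverProd k E D).hom ≫ specOverMap k w ≫ eX.hom) := by
    rw [← Function.Bijective.of_comp_iff _ (specOverMap_bijective k A E)]
    have h2 : ((fun f : specOver k A ⟶ specOver k E => f ▷ specOver k D ≫
      (specOverProd k E D).hom ≫ specOverMap k w ≫ eX.hom) ∘ specOverMap k) =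
      (fun g : specOver k (A ⊗[k] D) ⟶ specOver k B => (specOverProd k A D).hom ≫ g ≫ eX.hom) ∘
        specOverMap k ∘ (fun φ : E →ₐ[k] A => (Algebra.TensorProduct.map φ (AlgHom.id k D)).comp w) := by
      funext φ
      exact key φ
    rw [h2]
    refine Function.Bijective.comp ⟨?_, ?_⟩ ((specOverMap_bijective k _ _).comp (hw A))
    · intro g g' h
      simpa using h
    · intro g
      exact ⟨(specOverProd k A D).inv ≫ g ≫ eX.inv, by simp⟩
  constructor
  · intro f g h
    have h3 : e.hom ≫ f = e.hom ≫ g := by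
      apply h1.1
      simp only [comp_whiskerRight, Category.assoc]
      exact congrArg (e.hom ▷ _ ≫ ·) h
    exact (cancel_epi e.hom).mp h3
  · intro g
    obtain ⟨f, hf⟩ := h1.2 (e.hom ▷ _ ≫ g)
    refine ⟨e.inv ≫ f, ?_⟩
    simp only [comp_whiskerRight, Category.assoc] at hf ⊢
    rw [hf, ← comp_whiskerRight_assoc]
    simp

theorem bijective_of_affine (k : Type u) [Field k] (X D E : Over (Spec (CommRingCat.of k)))
    (w : E ⊗ D ⟶ X) (h : ∀ (T : Over (Spec (CommRingCat.of k))), IsAffine T.left →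
      Function.Bijective (fun f : T ⟶ E => f ▷ D ≫ w)) (T : Over (Spec (CommRingCat.of k))) :
      Function.Bijective (fun f : T ⟶ E => f ▷ D ≫ w) := by
  have inj : ∀ (T : Over (Spec (CommRingCat.of k))),
      Function.Injective (fun f : T ⟶ E => f ▷ D ≫ w) := by
    intro T f g hfg
    ext
    refine Scheme.Cover.hom_ext T.left.affineCover _ _ fun i => ?_
    let U : Over (Spec (CommRingCat.of k)) := Over.mk (T.left.affineCover.f i ≫ T.hom)
    let j : U ⟶ T := Over.homMk (T.left.affineCover.f i) rfl
    have hU : IsAffine U.left := inferInstanceAs (IsAffine (T.left.affineCover.X i))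
    have : j ≫ f = j ≫ g := by
      apply (h U hU).1
      simp only [comp_whiskerRight, Category.assoc]
      exact congrArg (j ▷ D ≫ ·) hfg
    exact congrArg (fun t => t.left) this
  refine ⟨inj T, fun g => ?_⟩
  let 𝒰 := T.left.affineCover
  let U : 𝒰.I₀ → Over (Spec (CommRingCat.of k)) := fun i => Over.mk (𝒰.f i ≫ T.hom)
  let j : ∀ i, U i ⟶ T := fun i => Over.homMk (𝒰.f i) rfl
  have hU : ∀ i, IsAffine (U i).left := fun i => inferInstanceAs (IsAffine (T.left.affineCover.X i))
  choose a ha using fun i => (h (U i) (hU i)).2 (j i ▷ D ≫ g)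
  dsimp only at ha
  let f : T.left ⟶ E.left := 𝒰.glueMorphisms (fun i => (a i).left) (by
    intro x y
    let P : Over (Spec (CommRingCat.of k)) := Over.mk (pullback.fst (𝒰.f x) (𝒰.f y) ≫ (U x).hom)
    let p : P ⟶ U x := Over.homMk (pullback.fst _ _) rfl
    let q : P ⟶ U y := Over.homMk (pullback.snd _ _) (by
      simp only [U, P, Over.mk_hom]
      rw [← Category.assoc, ← Category.assoc, pullback.condition])
    have hpq : p ≫ j x = q ≫ j y := by
      ext
      exact pullback.condition
    have : p ≫ a x = q ≫ a y := by
      apply inj P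
      simp only [comp_whiskerRight, Category.assoc, ha]
      rw [← comp_whiskerRight_assoc, hpq, comp_whiskerRight_assoc]
    exact congrArg (fun t => t.left) this)
  have hf : ∀ i, 𝒰.f i ≫ f = (a i).left := fun i => 𝒰.ι_glueMorphisms _ _ i
  let F : T ⟶ E := Over.homMk f (by
    refine Scheme.Cover.hom_ext 𝒰 _ _ fun i => ?_
    rw [← Category.assoc, hf]
    exact Over.w (a i))
  have hF : ∀ i, j i ≫ F = a i := fun i => by ext; exact hf i
  refine ⟨F, ?_⟩
  ext
  refine Scheme.Cover.hom_ext (𝒰.pullback₁ (pullback.fst T.hom D.hom)) _ _ fun i => ?_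
  have h1 : ∀ i, j i ▷ D ≫ F ▷ D ≫ w = j i ▷ D ≫ g := fun i => by
    rw [← comp_whiskerRight_assoc, hF, ha]
  have h2 : (j i ▷ D).left ≫ (F ▷ D ≫ w).left = (j i ▷ D).left ≫ g.left :=
    congrArg (fun t => t.left) (h1 i)
  let l : pullback (pullback.fst T.hom D.hom) (𝒰.f i) ⟶ pullback (𝒰.f i ≫ T.hom) D.hom :=
    pullback.lift (pullback.snd _ _) (pullback.fst _ _ ≫ pullback.snd _ _) (by
      rw [← Category.assoc, ← pullback.condition, Category.assoc, Category.assoc,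
        pullback.condition])
  have h3 : pullback.fst (pullback.fst T.hom D.hom) (𝒰.f i) = l ≫ (j i ▷ D).left := by
    refine pullback.hom_ext ?_ ?_
    · erw [Category.assoc, Over.whiskerRight_left_fst]
      rw [pullback.condition]
      exact (pullback.lift_fst_assoc _ _ _ _).symm
    · erw [Category.assoc, Over.whiskerRight_left_snd]
      exact (pullback.lift_snd _ _ _).symm
  change pullback.fst (pullback.fst T.hom D.hom) (𝒰.f i) ≫ (F ▷ D ≫ w).left =
    pullback.fst (pullback.fst T.hom D.hom) (𝒰.f i) ≫ g.left
  rw [h3, Category.assoc, Category.assoc, h2]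

/-! ### Jet schemes -/

/-- The `k`-scheme `Spec k[t]/(t^(n+1))`. -/
noncomputable def truncDisk (k : Type u) [Field k] (n : ℕ) : Over (Spec (CommRingCat.of k)) :=
  specOver k (Polynomial k ⧸ Ideal.span {(Polynomial.X : Polynomial k) ^ (n + 1)})

/-- The functor `T ↦ Hom_k(T × Spec k[t]/(t^(n+1)), X)` on `k`-schemes. -/
noncomputable def jetFunctor (k : Type u) [Field k] (n : ℕ) (X : Over (Spec (CommRingCat.of k))) :
    (Over (Spec (CommRingCat.of k)))ᵒᵖ ⥤ Type u :=
  (tensorRight (truncDisk k n)).op ⋙ yoneda.obj X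

theorem exists_jetScheme (k : Type u) [Field k] (n : ℕ) (X : Over (Spec (CommRingCat.of k)))
    (hX : IsAffine X.left) (hX' : LocallyOfFiniteType X.hom) :
    ∃ (E : Over (Spec (CommRingCat.of k))), IsAffine E.left ∧ LocallyOfFiniteType E.hom ∧
      Nonempty ((jetFunctor k n X).RepresentableBy E) := by
  have hfin : Module.Finite k
      (Polynomial k ⧸ Ideal.span {(Polynomial.X : Polynomial k) ^ (n + 1)}) :=
    (Polynomial.monic_X_pow (n + 1)).finite_quotient
  obtain ⟨E, h1, h2, w, hw⟩ := exists_weilRestriction_algSpec k X hX hX'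
    (Polynomial k ⧸ Ideal.span {(Polynomial.X : Polynomial k) ^ (n + 1)})
  refine ⟨E, h1, h2, ⟨⟨fun {T} => Equiv.ofBijective _ (bijective_of_affine k X _ E w hw T), ?_⟩⟩⟩
  intro T T' f g
  change (f ≫ g) ▷ truncDisk k n ≫ w = f ▷ truncDisk k n ≫ g ▷ truncDisk k n ≫ w
  rw [comp_whiskerRight]
  exact Category.assoc _ _ _

instance jetFunctor_isRepresentable (k : Type u) [Field k] (n : ℕ)
    (X : Over (Spec (CommRingCat.of k))) [hX : IsAffine X.left] [hX' : LocallyOfFiniteType X.hom] :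
    (jetFunctor k n X).IsRepresentable := by
  obtain ⟨E, -, -, ⟨h⟩⟩ := exists_jetScheme k n X hX hX'
  exact h.isRepresentable

/-- The scheme of `n`-jets of `X`: the `k`-scheme representing
`T ↦ Hom_k(T × Spec k[t]/(t^(n+1)), X)`. -/
noncomputable def jetScheme (k : Type u) [Field k] (n : ℕ) (X : Over (Spec (CommRingCat.of k)))
    [(jetFunctor k n X).IsRepresentable] : Over (Spec (CommRingCat.of k)) :=
  (jetFunctor k n X).reprX

theorem isAffine_left_of_iso {k : Type u} [Field k] {E J : Over (Spec (CommRingCat.of k))}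
    (e : E ≅ J) (h : IsAffine E.left) : IsAffine J.left := by
  have i : E.left ≅ J.left := (Over.forget _).mapIso e
  exact IsAffine.of_isIso i.inv

instance jetScheme_isAffine (k : Type u) [Field k] (n : ℕ)
    (X : Over (Spec (CommRingCat.of k))) [hX : IsAffine X.left] [hX' : LocallyOfFiniteType X.hom] :
    IsAffine (jetScheme k n X).left := by
  obtain ⟨E, h1, h2, ⟨h⟩⟩ := exists_jetScheme k n X hX hX'
  exact isAffine_left_of_iso h.isoReprX h1

instance jetScheme_locallyOfFiniteType (k : Type u) [Field k] (n : ℕ)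
    (X : Over (Spec (CommRingCat.of k))) [hX : IsAffine X.left] [hX' : LocallyOfFiniteType X.hom] :
    LocallyOfFiniteType (jetScheme k n X).hom := by
  obtain ⟨E, h1, h2, ⟨h⟩⟩ := exists_jetScheme k n X hX hX'
  have : IsIso h.isoReprX.inv.left := inferInstanceAs (IsIso ((Over.forget _).map h.isoReprX.inv))
  have h3 : LocallyOfFiniteType (h.isoReprX.inv.left ≫ E.hom) := inferInstance
  rwa [Over.w] at h3

instance isAffineHom_hom (k : Type u) [Field k] (X : Over (Spec (CommRingCat.of k)))
    [IsAffine X.left] : IsAffineHom X.hom :=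
  have : IsAffine ((Functor.fromPUnit (Spec (CommRingCat.of k))).obj X.right) :=
    inferInstanceAs (IsAffine (Spec (CommRingCat.of k)))
  inferInstance

/-! ### Affine space and its closed subschemes -/

/-- Affine space `𝔸^N = Spec k[x_1, …, x_N]` over `k`. -/
noncomputable def affineSpace (k : Type u) [Field k] (N : ℕ) : Over (Spec (CommRingCat.of k)) :=
  Over.mk (Spec.map (CommRingCat.ofHom (algebraMap k (MvPolynomial (Fin N) k))))

theorem affineSpace_isVar (k : Type u) [Field k] (N : ℕ) : IsVar k (affineSpace k N) where
  isReduced := inferInstanceAs (IsReduced (Spec (CommRingCat.of (MvPolynomial (Fin N) k))))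
  isSeparated := inferInstanceAs (IsSeparated (Spec.map _))
  locallyOfFiniteType := (HasRingHomProperty.Spec_iff (P := @LocallyOfFiniteType)).mpr
    (RingHom.finiteType_algebraMap.mpr inferInstance)
  quasiCompact := inferInstanceAs (QuasiCompact (Spec.map _))

/-- The class `𝕃` of the affine line in the Grothendieck ring of varieties. -/
noncomputable def lefschetz (k : Type u) [Field k] [IsAlgClosed k] : GrothendieckRing k :=
  cls k ⟨affineSpace k 1, affineSpace_isVar k 1⟩

/-- A closed subscheme of `𝔸^N`, given by its (quasi-coherent) ideal sheaf. -/
abbrev ClosedSubscheme (k : Type u) [Field k] (N : ℕ) : Type u :=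
  (affineSpace k N).left.IdealSheafData

/-- The `k`-scheme underlying a closed subscheme of `𝔸^N`. -/
noncomputable def ClosedSubscheme.toOver {k : Type u} [Field k] {N : ℕ}
    (X : ClosedSubscheme k N) : Over (Spec (CommRingCat.of k)) :=
  Over.mk (X.subschemeι ≫ (affineSpace k N).hom)

/-- The ideal of `k[x_1, …, x_N]` consisting of the global sections of the ideal sheaf of `X`. -/
noncomputable def ClosedSubscheme.definingIdeal {k : Type u} [Field k] {N : ℕ}
    (X : ClosedSubscheme k N) : Ideal (MvPolynomial (Fin N) k) :=
  (X.ideal ⟨⊤, isAffineOpen_top (Spec (CommRingCat.of (MvPolynomial (Fin N) k)))⟩).comap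
    (Scheme.ΓSpecIso (CommRingCat.of (MvPolynomial (Fin N) k))).inv.hom

theorem isAffine_subscheme {Y : Scheme.{u}} [IsAffine Y] (I : Y.IdealSheafData) :
    IsAffine I.subscheme :=
  isAffine_of_isAffineHom I.subschemeι

instance ClosedSubscheme.toOver_isAffine {k : Type u} [Field k] {N : ℕ}
    (X : ClosedSubscheme k N) : IsAffine X.toOver.left :=
  have : IsAffine (affineSpace k N).left :=
    inferInstanceAs (IsAffine (Spec (CommRingCat.of (MvPolynomial (Fin N) k))))
  isAffine_subscheme X

instance ClosedSubscheme.toOver_locallyOfFiniteType {k : Type u} [Field k] {N : ℕ}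
    (X : ClosedSubscheme k N) : LocallyOfFiniteType X.toOver.hom :=
  have : LocallyOfFiniteType (affineSpace k N).hom := (affineSpace_isVar k N).locallyOfFiniteType
  inferInstanceAs (LocallyOfFiniteType (X.subschemeι ≫ (affineSpace k N).hom))

end JetClass

/-!
Jets of `X = V(f₁, …, f_m)` are solutions `x(t)` of `f(x(t)) = 0` modulo `t ^ (n + 1)`. The class of
the jet scheme is the class of the spectrum of the algebra `SolAlg` representing these solutions
(`cls_jetScheme_eq_specClass_solAlg`), so everything takes place in families of such systems over
`k`-algebras `A` of finite type. Write `𝕃 ^ d` for the power in question.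

Put `x(t) = a + t ^ s * y(t)` with `s = e + 1`. Taylor expansion gives
`f(x) = f(a) + t ^ s * T y + t ^ (2 s) * Q(y)`, where `T` is the Jacobian matrix at `a`, with entries in
`A[t]`. If `T * W = t ^ e` for some matrix `W`, then
`f(x) = f(a) + t ^ s * T (y + t * W Q(y))`, and the substitution `w = y + t * W Q(y)` is bijective because
`t` is nilpotent (`perturb_bijective`). So the system becomes linear in the coefficients of `w`
(`isJetSol_iff_linear`). Where its rank `r` is constant, its solutions are an affine space of dimension
`N (n - e) - r` over a closed subscheme of the base (`lefschetzDvd_solAlg_of_linear`). If `2 s > n`, the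
quadratic term vanishes and `W` is not needed.

Over a field, `T * W = t ^ e` is solvable modulo `t ^ (e + 1)`, hence modulo every power of `t`, unless
the rows of `T` satisfy a relation modulo `t ^ (e + 1)` with some coefficient not divisible by `t`
(`exists_inverse_or_hasRelation`). In the second case `s` is increased by one, the next coefficient of
`x(t)` becoming part of the base, and the relation is kept. Hence at stage `e` there is a relation
modulo `t ^ e`, which makes `e` of the `m (n - e)` linear equations redundant
(`rank_toeplitz_add_le`), and the dimension above is at least `(N - m) (n - e) + e`. Since `e ≤ n / 2`
throughout, this is at least `(N - m + 1) n / 2`.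

Both alternatives, and the constancy of the rank, hold over a nonempty open subset of every integral
base (`exists_away_lefschetzDvd`). Divisibility can be tested on the pieces of a stratification,
and Noetherian induction on the base provides one (`LefschetzDvd.of_generic`).
-/

namespace JetClass

/-! ### Classes of affine schemes of finite type -/

section SpecClass

variable (k : Type u) [Field k]

theorem specOver_isVar (B : Type u) [CommRing B] [Algebra k B] [Algebra.FiniteType k B]
    [_root_.IsReduced B] : IsVar k (specOver k B) where
  isReduced := (affine_isReduced_iff (CommRingCat.of B)).mpr ‹_›
  isSeparated := inferInstanceAs (IsSeparated (Spec.map _))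
  locallyOfFiniteType := (HasRingHomProperty.Spec_iff (P := @LocallyOfFiniteType)).mpr
    (RingHom.finiteType_algebraMap.mpr inferInstance)
  quasiCompact := inferInstanceAs (QuasiCompact (Spec.map _))

/-- The variety `Spec B`. -/
noncomputable def specVar (B : Type u) [CommRing B] [Algebra k B] [Algebra.FiniteType k B]
    [_root_.IsReduced B] : Variety k :=
  ⟨specOver k B, specOver_isVar k B⟩

instance isReduced_quotient_nilradical (B : Type u) [CommRing B] :
    _root_.IsReduced (B ⧸ nilradical B) :=
  (Ideal.isRadical_iff_quotient_reduced _).mp (Ideal.radical_isRadical _)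

theorem finiteType_tensorProduct (B C : Type u) [CommRing B] [Algebra k B]
    [Algebra.FiniteType k B] [CommRing C] [Algebra k C] [Algebra.FiniteType k C] :
    Algebra.FiniteType k (B ⊗[k] C) :=
  Algebra.FiniteType.trans (S := B) inferInstance inferInstance

variable [IsAlgClosed k]

theorem cls_eq_of_iso {V W : Variety k} (e : V ≅ W) : cls k V = cls k W := by
  rw [cls, cls, isoClass, isoClass, toSkeleton_eq_toSkeleton_iff.mpr ⟨e⟩]

theorem cls_eq_of_iso_obj {V W : Variety k} (e : V.obj ≅ W.obj) : cls k V = cls k W :=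
  cls_eq_of_iso k ((isVariety k).fullyFaithfulι.preimageIso e)

/-- Isomorphic algebras have isomorphic spectra. -/
noncomputable def specOverIso {A B : Type u} [CommRing A] [Algebra k A] [CommRing B]
    [Algebra k B] (e : A ≃ₐ[k] B) : specOver k A ≅ specOver k B where
  hom := specOverMap k e.symm.toAlgHom
  inv := specOverMap k e.toAlgHom
  hom_inv_id := by
    rw [specOverMap_comp]
    have : e.symm.toAlgHom.comp e.toAlgHom = AlgHom.id k A := by ext; simp
    rw [this]; ext; exact Spec.map_id _
  inv_hom_id := by
    rw [specOverMap_comp]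
    have : e.toAlgHom.comp e.symm.toAlgHom = AlgHom.id k B := by ext; simp
    rw [this]; ext; exact Spec.map_id _

theorem cls_add (V U Z : Variety k) (i : Z ⟶ V) (j : U ⟶ V) (hi : IsClosedImmersion i.hom.left)
    (hj : IsOpenImmersion j.hom.left)
    (h : Set.range j.hom.left = (Set.range i.hom.left)ᶜ) : cls k V = cls k U + cls k Z := by
  rw [cls, cls, cls, ← map_add, ← sub_eq_zero, ← map_sub, Ideal.Quotient.eq_zero_iff_mem]
  exact AddSubgroup.subset_closure ⟨V, Z, U, i, j, hi, hj, h, rfl⟩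

theorem cls_mul (V W : Variety k) : cls k V * cls k W = cls k (V ⊗ W) := by
  rw [cls, cls, cls, ← map_mul, isoClass_mul]

/-- The class of `Spec B`, endowed with its reduced structure. -/
noncomputable def specClass (B : Type u) [CommRing B] [Algebra k B] [Algebra.FiniteType k B] :
    GrothendieckRing k :=
  cls k (specVar k (B ⧸ nilradical B))

theorem specClass_eq_cls_of_surjective {B C : Type u} [CommRing B] [Algebra k B]
    [Algebra.FiniteType k B] [CommRing C] [Algebra k C] [Algebra.FiniteType k C]
    [_root_.IsReduced C] (π : B →ₐ[k] C) (hπ : Function.Surjective π)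
    (hker : ∀ x, π x = 0 → IsNilpotent x) : specClass k B = cls k (specVar k C) := by
  have h : RingHom.ker π = nilradical B := by
    ext x
    rw [RingHom.mem_ker, mem_nilradical]
    exact ⟨hker x, fun hx => (hx.map π).eq_zero⟩
  exact cls_eq_of_iso_obj k (specOverIso k
    ((Ideal.quotientEquivAlgOfEq k h.symm).trans (Ideal.quotientKerAlgEquivOfSurjective hπ)))

theorem specClass_congr {B C : Type u} [CommRing B] [Algebra k B]
    [Algebra.FiniteType k B] [CommRing C] [Algebra k C] [Algebra.FiniteType k C]
    (e : B ≃ₐ[k] C) : specClass k B = specClass k C := by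
  refine specClass_eq_cls_of_surjective k ((Ideal.Quotient.mkₐ k (nilradical C)).comp e.toAlgHom)
    ((Ideal.Quotient.mkₐ_surjective k _).comp e.surjective) fun x hx => ?_
  have h1 : IsNilpotent (e x) := mem_nilradical.mp (Ideal.Quotient.eq_zero_iff_mem.mp hx)
  simpa using h1.map e.symm

/-- Cutting `Spec B` along the zero locus of `g`. -/
theorem specClass_eq_add {B B₁ B₂ : Type u} [CommRing B] [Algebra k B] [Algebra.FiniteType k B]
    [CommRing B₁] [Algebra k B₁] [Algebra.FiniteType k B₁]
    [CommRing B₂] [Algebra k B₂] [Algebra.FiniteType k B₂] (g : B)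
    [Algebra B B₁] [IsScalarTower k B B₁] [IsLocalization.Away g B₁]
    (π : B →ₐ[k] B₂) (hπ : Function.Surjective π) (hker : RingHom.ker π = Ideal.span {g}) :
    specClass k B = specClass k B₁ + specClass k B₂ := by
  have hnil : nilradical B ≤ (nilradical B₂).comap (π : B →+* B₂) :=
    fun x hx => mem_nilradical.mpr ((mem_nilradical.mp hx).map π)
  let i' : (B ⧸ nilradical B) →ₐ[k] (B₂ ⧸ nilradical B₂) := Ideal.quotientMapₐ _ π hnil
  let j' : (B ⧸ nilradical B) →ₐ[k] (B₁ ⧸ nilradical B₁) :=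
    Ideal.quotientMapₐ _ (IsScalarTower.toAlgHom k B B₁)
      fun x hx => mem_nilradical.mpr ((mem_nilradical.mp hx).map _)
  have hi' : Function.Surjective i' := Ideal.quotientMap_surjective (H := hnil) hπ
  let _ : Algebra (B ⧸ nilradical B) (B₁ ⧸ nilradical B₁) := j'.toAlgebra
  have hmk (x : B) : algebraMap (B ⧸ nilradical B) (B₁ ⧸ nilradical B₁)
      (Ideal.Quotient.mk _ x) = Ideal.Quotient.mk _ (algebraMap B B₁ x) := rfl
  have hloc : IsLocalization.Away (Ideal.Quotient.mk (nilradical B) g) (B₁ ⧸ nilradical B₁) := by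
    refine IsLocalization.Away.mk _ ?_ ?_ ?_
    · rw [hmk]; exact (IsLocalization.Away.algebraMap_isUnit g).map _
    · intro z
      obtain ⟨z, rfl⟩ := Ideal.Quotient.mk_surjective z
      obtain ⟨n, a, h⟩ := IsLocalization.Away.surj g z
      refine ⟨n, Ideal.Quotient.mk _ a, ?_⟩
      rw [hmk, hmk, ← h]; simp
    · intro a b hab
      obtain ⟨a, rfl⟩ := Ideal.Quotient.mk_surjective a
      obtain ⟨b, rfl⟩ := Ideal.Quotient.mk_surjective b
      rw [hmk, hmk, Ideal.Quotient.eq, ← map_sub, mem_nilradical] at hab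
      obtain ⟨n, hn⟩ := hab
      rw [← map_pow] at hn
      obtain ⟨c, hc⟩ := IsLocalization.Away.exists_of_eq g (hn.trans (map_zero _).symm)
      refine ⟨c, ?_⟩
      rw [← map_pow, ← map_mul, ← map_mul, Ideal.Quotient.eq, mem_nilradical, ← mul_sub]
      refine ⟨n + 1, ?_⟩
      rw [mul_pow, pow_succ (a - b), pow_succ (g ^ c)]
      linear_combination (g ^ c) ^ n * (a - b) * hc
  refine cls_add k (specVar k (B ⧸ nilradical B)) (specVar k (B₁ ⧸ nilradical B₁))
    (specVar k (B₂ ⧸ nilradical B₂)) ⟨specOverMap k i'⟩ ⟨specOverMap k j'⟩ ?_ ?_ ?_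
  · exact IsClosedImmersion.spec_of_surjective _ hi'
  · exact IsOpenImmersion.of_isLocalization (S := B₁ ⧸ nilradical B₁)
      (Ideal.Quotient.mk (nilradical B) g)
  · have h1 : Set.range (PrimeSpectrum.comap (j' : (B ⧸ nilradical B) →+* (B₁ ⧸ nilradical B₁))) =
      _ := PrimeSpectrum.localization_away_comap_range _ (Ideal.Quotient.mk (nilradical B) g)
    have h2 := range_comap_of_surjective (B₂ ⧸ nilradical B₂)
      (i' : (B ⧸ nilradical B) →+* (B₂ ⧸ nilradical B₂)) hi'
    refine h1.trans (Eq.trans ?_ (congrArg compl h2).symm)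
    ext x
    simp only [SetLike.mem_coe, PrimeSpectrum.mem_basicOpen]
    refine not_congr ⟨fun h y hy => ?_, fun h => h ?_⟩
    · obtain ⟨y, rfl⟩ := Ideal.Quotient.mk_surjective y
      have hy : Ideal.Quotient.mk (nilradical B₂) (π y) = 0 := hy
      obtain ⟨n, hn⟩ := mem_nilradical.mp (Ideal.Quotient.eq_zero_iff_mem.mp hy)
      rw [← map_pow] at hn
      have h3 : y ^ n ∈ Ideal.span {g} := hker ▸ hn
      obtain ⟨c, hc⟩ := Ideal.mem_span_singleton.mp h3
      refine x.isPrime.mem_of_pow_mem n ?_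
      rw [← map_pow, hc, map_mul]
      exact Ideal.mul_mem_right _ _ h
    · change Ideal.Quotient.mk (nilradical B₂) (π g) = 0
      have h3 : g ∈ RingHom.ker π := hker ▸ Ideal.mem_span_singleton_self g
      rw [(RingHom.mem_ker).mp h3, map_zero]

theorem specClass_tensorProduct (B C : Type u) [CommRing B] [Algebra k B]
    [Algebra.FiniteType k B] [CommRing C] [Algebra k C] [Algebra.FiniteType k C]
    [_root_.IsReduced C] [Algebra.FiniteType k (B ⊗[k] C)] :
    specClass k (B ⊗[k] C) = specClass k B * cls k (specVar k C) := by
  have := isReduced_tensorProduct k (B ⧸ nilradical B) C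
  have := finiteType_tensorProduct k (B ⧸ nilradical B) C
  rw [specClass_eq_cls_of_surjective k
    (Algebra.TensorProduct.map (Ideal.Quotient.mkₐ k (nilradical B)) (AlgHom.id k C)),
    specClass, cls_mul]
  · exact cls_eq_of_iso_obj k (specOverProd k _ _).symm
  · exact TensorProduct.map_surjective (Ideal.Quotient.mkₐ_surjective k _) Function.surjective_id
  · intro x hx
    have h1 : x ∈ RingHom.ker (Algebra.TensorProduct.map (Ideal.Quotient.mkₐ k (nilradical B))
      (AlgHom.id k C)) := hx
    rw [Algebra.TensorProduct.rTensor_ker _ (Ideal.Quotient.mkₐ_surjective k _)] at h1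
    rw [← mem_nilradical]
    refine Ideal.map_le_iff_le_comap.mpr (fun y hy => ?_) h1
    have hy : Ideal.Quotient.mk (nilradical B) y = 0 := hy
    exact mem_nilradical.mpr ((mem_nilradical.mp (Ideal.Quotient.eq_zero_iff_mem.mp hy)).map _)

theorem specClass_mvPolynomial (C : Type u) [CommRing C] [Algebra k C] [Algebra.FiniteType k C]
    (r : ℕ) (h : Algebra.FiniteType k (MvPolynomial (Fin r) C)) :
    specClass k (MvPolynomial (Fin r) C) = lefschetz k ^ r * specClass k C := by
  induction r with
  | zero =>
    rw [pow_zero, one_mul]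
    exact specClass_congr k ((MvPolynomial.isEmptyAlgEquiv C (Fin 0)).restrictScalars k)
  | succ r ih =>
    have h1 : Algebra.FiniteType k (MvPolynomial (Fin r) C) :=
      Algebra.FiniteType.trans (S := C) inferInstance inferInstance
    have h2 := finiteType_tensorProduct k (MvPolynomial (Fin r) C) (MvPolynomial (Fin 1) k)
    let e : MvPolynomial (Fin (r + 1)) C ≃ₐ[k]
        MvPolynomial (Fin r) C ⊗[k] MvPolynomial (Fin 1) k :=
      (((MvPolynomial.renameEquiv C (finSumFinEquiv.symm.trans (Equiv.sumComm _ _))).trans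
        (MvPolynomial.sumAlgEquiv C (Fin 1) (Fin r))).restrictScalars k).trans
        ((MvPolynomial.algebraTensorAlgEquiv k (MvPolynomial (Fin r) C)).symm.restrictScalars k)
    rw [specClass_congr k e, specClass_tensorProduct, ih h1, pow_succ']
    rw [mul_comm, mul_assoc]
    rfl

/-- `B` is of finite type over `k` and the class of its spectrum is a multiple of `𝕃 ^ d`. -/
def LefschetzDvd (d : ℕ) (B : Type u) [CommRing B] [Algebra k B] : Prop :=
  ∃ _ : Algebra.FiniteType k B, lefschetz k ^ d ∣ specClass k B

variable {k} {d : ℕ}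

theorem LefschetzDvd.of_algEquiv {B C : Type u} [CommRing B] [Algebra k B] [CommRing C]
    [Algebra k C] (e : B ≃ₐ[k] C) (h : LefschetzDvd k d B) : LefschetzDvd k d C := by
  obtain ⟨h1, h2⟩ := h
  exact ⟨h1.equiv e, by have := h1.equiv e; rwa [← specClass_congr k e]⟩

/-- Divisibility may be checked on the open set `g ≠ 0` and on the closed set `g = 0`. -/
theorem LefschetzDvd.of_cut {B B₁ B₂ : Type u} [CommRing B] [Algebra k B]
    [hB : Algebra.FiniteType k B] [CommRing B₁] [Algebra k B₁] [CommRing B₂] [Algebra k B₂] (g : B)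
    [Algebra B B₁] [IsScalarTower k B B₁] [IsLocalization.Away g B₁]
    (π : B →ₐ[k] B₂) (hπ : Function.Surjective π) (hker : RingHom.ker π = Ideal.span {g})
    (h₁ : LefschetzDvd k d B₁) (h₂ : LefschetzDvd k d B₂) : LefschetzDvd k d B := by
  obtain ⟨_, h₁⟩ := h₁
  obtain ⟨_, h₂⟩ := h₂
  refine ⟨hB, ?_⟩
  rw [specClass_eq_add k g π hπ hker (B₁ := B₁)]
  exact dvd_add h₁ h₂

theorem lefschetzDvd_mvPolynomial (C : Type u) [CommRing C] [Algebra k C] [Algebra.FiniteType k C]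
    (σ : Type) [Fintype σ] (hd : d ≤ Fintype.card σ) : LefschetzDvd k d (MvPolynomial σ C) := by
  have h : Algebra.FiniteType k (MvPolynomial (Fin (Fintype.card σ)) C) :=
    Algebra.FiniteType.trans (S := C) inferInstance inferInstance
  refine LefschetzDvd.of_algEquiv ((MvPolynomial.renameEquiv C
    (Fintype.equivFin σ).symm).restrictScalars k) ⟨h, ?_⟩
  rw [specClass_mvPolynomial k C _ h]
  exact (pow_dvd_pow _ hd).mul_right _

/-- The zero ring is a polynomial ring over itself. -/
theorem lefschetzDvd_of_subsingleton (C : Type u) [CommRing C] [Algebra k C] [Subsingleton C] :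
    LefschetzDvd k d C := by
  have : Algebra.FiniteType k C := ⟨⟨∅, Subsingleton.elim _ _⟩⟩
  have : Subsingleton (MvPolynomial (Fin d) C) :=
    subsingleton_of_zero_eq_one (by
      rw [← MvPolynomial.C_0, ← MvPolynomial.C_1, Subsingleton.elim (0 : C) 1])
  have e : MvPolynomial (Fin d) C ≃ₐ[k] C :=
    AlgEquiv.ofBijective
      ((MvPolynomial.aeval (fun _ => (0 : C))).restrictScalars k : MvPolynomial (Fin d) C →ₐ[k] C)
      ⟨fun _ _ _ => Subsingleton.elim _ _, fun x => ⟨0, Subsingleton.elim _ _⟩⟩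
  exact (lefschetzDvd_mvPolynomial C (Fin d) (by simp)).of_algEquiv e

end SpecClass

/-! ### The class of a jet scheme -/

/-- Yoneda's lemma for algebras. -/
theorem nonempty_algEquiv_of_natural {A : Type u} [CommRing A] {B C : Type u} [CommRing B]
    [Algebra A B] [CommRing C] [Algebra A C]
    (F : ∀ (R : Type u) [CommRing R] [Algebra A R], (B →ₐ[A] R) ≃ (C →ₐ[A] R))
    (hF : ∀ (R S : Type u) [CommRing R] [Algebra A R] [CommRing S] [Algebra A S] (g : R →ₐ[A] S)
      (φ : B →ₐ[A] R), F S (g.comp φ) = g.comp (F R φ)) : Nonempty (B ≃ₐ[A] C) := by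
  refine ⟨AlgEquiv.ofAlgHom ((F C).symm (AlgHom.id A C)) (F B (AlgHom.id A B)) ?_ ?_⟩
  · rw [← hF, AlgHom.comp_id, Equiv.apply_symm_apply]
  · apply (F B).injective
    rw [hF, Equiv.apply_symm_apply, AlgHom.comp_id]

section SchemeLemmas

theorem isClosedImmersion_conj {X Y Z W : Scheme.{u}} (a : X ⟶ Y) (ι : Y ⟶ Z) (b : Z ⟶ W)
    (ha : IsIso a) (hι : IsClosedImmersion ι) (hb : IsIso b) :
    IsClosedImmersion (a ≫ ι ≫ b) := inferInstance

theorem surjective_conj {X Y Z W : Scheme.{u}} (a : X ⟶ Y) (ι : Y ⟶ Z) (b : Z ⟶ W)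
    (ha : IsIso a) (hι : Function.Surjective ι) (hb : IsIso b) :
    Function.Surjective (a ≫ ι ≫ b) :=
  ((Scheme.Hom.surjective b).comp hι).comp (Scheme.Hom.surjective a)

theorem surjective_of_isClosedImmersion_specMap {R S : CommRingCat.{u}} (φ : R ⟶ S)
    (h : IsClosedImmersion (Spec.map φ)) : Function.Surjective φ := by
  obtain ⟨-, h⟩ := IsClosedImmersion.isAffine_surjective_of_isAffine (Spec.map φ)
  have h4 := Scheme.ΓSpecIso_inv_naturality φ
  intro y
  obtain ⟨z, hz⟩ := h ((Scheme.ΓSpecIso S).inv y)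
  obtain ⟨x, hx⟩ := (ConcreteCategory.bijective_of_isIso (Scheme.ΓSpecIso R).inv).2 z
  refine ⟨x, (ConcreteCategory.bijective_of_isIso (Scheme.ΓSpecIso S).inv).1 ?_⟩
  rw [← hz, ← hx]
  exact ConcreteCategory.congr_hom h4 x

theorem appTop_injective_of_isIso {X Y : Scheme.{u}} (f : X ⟶ Y) (h : IsIso f) :
    Function.Injective f.appTop :=
  have : IsIso f.appTop := inferInstanceAs (IsIso (f.app ⊤))
  (ConcreteCategory.bijective_of_isIso f.appTop).1

theorem appTop_eq_zero_iff_mem {X : Scheme.{u}} {R : CommRingCat.{u}} (ι : X ⟶ Spec R)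
    (I : Ideal R) (e : X ≅ Spec (CommRingCat.of (R ⧸ I)))
    (he : ι = e.hom ≫ Spec.map (CommRingCat.ofHom (Ideal.Quotient.mk I))) (p : R) :
    ι.appTop ((Scheme.ΓSpecIso R).inv p) = 0 ↔ p ∈ I := by
  have h2 : (Spec.map (CommRingCat.ofHom (Ideal.Quotient.mk I))).appTop
      ((Scheme.ΓSpecIso R).inv p) = (Scheme.ΓSpecIso (CommRingCat.of (R ⧸ I))).inv
        (Ideal.Quotient.mk I p) := (ConcreteCategory.congr_hom (Scheme.ΓSpecIso_inv_naturality
      (CommRingCat.ofHom (Ideal.Quotient.mk I))) p).symm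
  have h3 := appTop_injective_of_isIso e.hom inferInstance
  have h4 := (ConcreteCategory.bijective_of_isIso
    (Scheme.ΓSpecIso (CommRingCat.of (R ⧸ I))).inv).1
  rw [he, Scheme.Hom.comp_appTop, ← Ideal.Quotient.eq_zero_iff_mem]
  rw [CommRingCat.comp_apply, h2, map_eq_zero_iff _ h3, map_eq_zero_iff _ h4]

theorem appTop_subschemeι_eq_zero_iff {Y : Scheme.{u}} (X : Y.IdealSheafData)
    (hY : IsAffineOpen (⊤ : Y.Opens)) (x : Γ(Y, ⊤)) :
    X.subschemeι.appTop x = 0 ↔ x ∈ X.ideal ⟨⊤, hY⟩ := by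
  rw [← Scheme.IdealSheafData.ker_subschemeι_app X ⟨⊤, hY⟩]
  rfl

end SchemeLemmas

section

variable {k : Type u} [Field k]

/-- A reduced closed subscheme of `Spec B` with the same points is the spectrum of `B` modulo its
nilradical. -/
theorem cls_eq_specClass_of_isClosedImmersion [IsAlgClosed k] (Z : Variety k)
    (V : Over (Spec (CommRingCat.of k))) (ι : Z.obj ⟶ V) (hι : IsClosedImmersion ι.left)
    (hι' : Function.Surjective ι.left)
    (B : Type u) [CommRing B] [Algebra k B] [Algebra.FiniteType k B] (e : specOver k B ≅ V) :
    cls k Z = specClass k B := by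
  obtain ⟨Z, hZ⟩ := Z
  have hV : IsAffine V.left := isAffine_left_of_iso e (inferInstanceAs (IsAffine (Spec _)))
  have hZ' : IsAffine Z.left := isAffine_of_isAffineHom ι.left
  obtain ⟨C, _, _, ⟨eC⟩⟩ := exists_iso_specOver k Z hZ'
  obtain ⟨φ, hφ⟩ := (specOverMap_bijective k C B).2 (eC.hom ≫ ι ≫ e.inv)
  have h2 : IsIso eC.hom.left := inferInstanceAs (IsIso ((Over.forget _).map eC.hom))
  have h3 : IsIso e.inv.left := inferInstanceAs (IsIso ((Over.forget _).map e.inv))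
  have hφ' : Spec.map (CommRingCat.ofHom φ.toRingHom) =
      eC.hom.left ≫ ι.left ≫ e.inv.left := congrArg (fun t => t.left) hφ
  have hred : _root_.IsReduced C := by
    have h1 : IsReduced Z.left := hZ.isReduced
    have : IsReduced (specOver k C).left := isReduced_of_isOpenImmersion eC.hom.left
    exact (affine_isReduced_iff _).mp this
  have hφs : Function.Surjective φ := surjective_of_isClosedImmersion_specMap
    (CommRingCat.ofHom φ.toRingHom) (hφ' ▸ isClosedImmersion_conj _ _ _ h2 hι h3)
  have hsurj : Function.Surjective (Spec.map (CommRingCat.ofHom φ.toRingHom)) :=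
    hφ' ▸ surjective_conj _ _ _ h2 hι' h3
  have hft : Algebra.FiniteType k C := Algebra.FiniteType.of_surjective φ hφs
  rw [specClass_eq_cls_of_surjective k φ hφs]
  · exact (cls_eq_of_iso_obj k (V := specVar k C) (W := ⟨Z, hZ⟩) eC).symm
  · intro x hx
    rw [← mem_nilradical, nilradical_eq_sInf, Ideal.mem_sInf]
    intro p hp
    obtain ⟨q, hq⟩ := hsurj ⟨p, hp⟩
    have h1 : p = q.asIdeal.comap φ.toRingHom := (congrArg PrimeSpectrum.asIdeal hq).symm
    rw [h1]
    change φ x ∈ q.asIdeal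
    rw [hx]; exact zero_mem _

/-- The class of `Spec B` with its reduced structure does not depend on the way the reduction is
constructed. -/
theorem cls_reducedVariety [IsAlgClosed k] (V : Over (Spec (CommRingCat.of k)))
    [IsSeparated V.hom] [LocallyOfFiniteType V.hom] [QuasiCompact V.hom]
    (B : Type u) [CommRing B] [Algebra k B] [Algebra.FiniteType k B] (e : specOver k B ≅ V) :
    cls k (reducedVariety k V) = specClass k B := by
  refine cls_eq_specClass_of_isClosedImmersion _ V
    (Over.homMk V.left.nilradical.subschemeι rfl)
    (inferInstanceAs (IsClosedImmersion V.left.nilradical.subschemeι)) ?_ B e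
  change Function.Surjective V.left.nilradical.subschemeι
  rw [← Set.range_eq_univ, Scheme.IdealSheafData.range_subschemeι]
  rfl

theorem nonempty_iso_toOver {N : ℕ} (X : ClosedSubscheme k N) :
    Nonempty (specOver k (MvPolynomial (Fin N) k ⧸ X.definingIdeal) ≅ X.toOver) := by
  let ι : X.subscheme ⟶ Spec (CommRingCat.of (MvPolynomial (Fin N) k)) := X.subschemeι
  have hι : IsClosedImmersion ι := inferInstanceAs (IsClosedImmersion X.subschemeι)
  obtain ⟨I, e, he⟩ := IsClosedImmersion.Spec_iff.mp hι
  have hI : I = X.definingIdeal := by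
    ext p
    rw [← appTop_eq_zero_iff_mem ι I e he]
    exact appTop_subschemeι_eq_zero_iff X _ _
  subst hI
  refine ⟨(Over.isoMk (f := X.toOver)
    (g := specOver k (MvPolynomial (Fin N) k ⧸ X.definingIdeal)) e ?_).symm⟩
  change e.hom ≫ Spec.map _ = ι ≫ Spec.map _
  rw [he, Category.assoc, ← Spec.map_comp]
  rfl

/-- The naturality square in the proof of `cls_jetScheme`, for abstract morphisms: stated for the
morphisms of schemes themselves, the rewriting steps are obstructed by definitional unfolding. -/
theorem eq_of_comp_conj {C : Type*} [Category* C] {P P' Q Q' S T : C} {i : P ⟶ Q} {i' : P' ⟶ Q'}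
    {a : Q ⟶ Q'} {m : P ⟶ P'} {b : Q' ⟶ S} {c : S ⟶ T} {s t : P ⟶ T} {r : P' ⟶ T} {v : Q ⟶ S}
    (h : m ≫ i' = i ≫ a) (hs : s = i ≫ v ≫ c) (hv : v = a ≫ b) (hr : r = i' ≫ b ≫ c)
    (ht : m ≫ r = t) : s = t := by
  rw [hs, hv, ← ht, hr, ← Category.assoc m, h]
  simp only [Category.assoc]

/-- By Yoneda's lemma, the jet scheme of `X` is the spectrum of any algebra `C` which represents the
points of `X` with values in `R ⊗ k[t]/(t^(n+1))`. -/
theorem cls_jetScheme [IsAlgClosed k] {N : ℕ} (X : ClosedSubscheme k N) (n : ℕ) (C : Type u)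
    [CommRing C] [Algebra k C] [Algebra.FiniteType k C]
    (F : ∀ (R : Type u) [CommRing R] [Algebra k R], (C →ₐ[k] R) ≃
      ((MvPolynomial (Fin N) k ⧸ X.definingIdeal) →ₐ[k]
        R ⊗[k] (Polynomial k ⧸ Ideal.span {(Polynomial.X : Polynomial k) ^ (n + 1)})))
    (hF : ∀ (R S : Type u) [CommRing R] [Algebra k R] [CommRing S] [Algebra k S] (g : R →ₐ[k] S)
      (φ : C →ₐ[k] R), F S (g.comp φ) =
        (Algebra.TensorProduct.map g (AlgHom.id k _)).comp (F R φ)) :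
    cls k (reducedVariety k (jetScheme k n X.toOver)) = specClass k C := by
  obtain ⟨eX⟩ := nonempty_iso_toOver X
  set D := Polynomial k ⧸ Ideal.span {(Polynomial.X : Polynomial k) ^ (n + 1)}
  set B := MvPolynomial (Fin N) k ⧸ X.definingIdeal
  obtain ⟨E, _, _, ⟨eE⟩⟩ := exists_iso_specOver k (jetScheme k n X.toOver) inferInstance
  let rep : (jetFunctor k n X.toOver).RepresentableBy (jetScheme k n X.toOver) :=
    (jetFunctor k n X.toOver).representableBy
  let G : ∀ (R : Type u) [CommRing R] [Algebra k R], (E →ₐ[k] R) ≃ (B →ₐ[k] R ⊗[k] D) :=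
    fun R _ _ => (Equiv.ofBijective _ (specOverMap_bijective k R E)).trans <|
      (eE.homToEquiv (Z := specOver k R)).trans <| rep.homEquiv.trans <|
      ((specOverProd k R D).homFromEquiv).trans <| (eX.homToEquiv.symm).trans
      (Equiv.ofBijective _ (specOverMap_bijective k (R ⊗[k] D) B)).symm
  have hG : ∀ (R S : Type u) [CommRing R] [Algebra k R] [CommRing S] [Algebra k S] (g : R →ₐ[k] S)
      (φ : E →ₐ[k] R), G S (g.comp φ) =
        (Algebra.TensorProduct.map g (AlgHom.id k _)).comp (G R φ) := by
    intro R S _ _ _ _ g φ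
    have h1 (R : Type u) [CommRing R] [Algebra k R] (φ : E →ₐ[k] R) : specOverMap k (G R φ) =
        (specOverProd k R D).inv ≫ rep.homEquiv (specOverMap k φ ≫ eE.hom) ≫ eX.inv :=
      (Equiv.ofBijective _ (specOverMap_bijective k (R ⊗[k] D) B)).apply_symm_apply _
    have h2 (S T : Over (Spec (CommRingCat.of k))) (a : S ⟶ T)
        (b : T ⟶ jetScheme k n X.toOver) :
        rep.homEquiv (a ≫ b) = a ▷ truncDisk k n ≫ rep.homEquiv b := rep.homEquiv_comp a b
    refine (specOverMap_bijective k (S ⊗[k] D) B).1 ?_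
    have h3 : specOverMap k (g.comp φ) ≫ eE.hom = specOverMap k g ≫ specOverMap k φ ≫ eE.hom := by
      rw [← specOverMap_comp, Category.assoc]
    have h4 : specOverMap k (Algebra.TensorProduct.map g (AlgHom.id k D)) ≫
        (specOverProd k R D).inv = (specOverProd k S D).inv ≫ specOverMap k g ▷ specOver k D := by
      rw [Iso.comp_inv_eq, Category.assoc, ← specOverMap_whiskerRight, Iso.inv_hom_id_assoc]
    have h5 := (congrArg rep.homEquiv h3).trans (h2 _ _ (specOverMap k g) (specOverMap k φ ≫ eE.hom))
    exact eq_of_comp_conj h4 (h1 S (g.comp φ)) h5 (h1 R φ) (specOverMap_comp k _ _)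
  obtain ⟨e⟩ := nonempty_algEquiv_of_natural (A := k) (B := E) (C := C)
    (fun R _ _ => (G R).trans (F R).symm) (fun R S _ _ _ _ g φ => by
      apply (F S).injective
      simp only [Equiv.trans_apply, hF, hG, Equiv.apply_symm_apply]; rfl)
  exact cls_reducedVariety _ C (specOverIso k e.symm ≪≫ eE)

end

/-! ### Noetherian induction on the base of a family -/

section Noetherian

variable {A₀ : Type u} [CommRing A₀]

/-- There is at most one `A₀`-algebra map from `A` to any `A₀`-algebra `R`, and there is one precisely
when `c R` holds. Iterated quotients and localizations of `A₀` are of this kind, and are compared with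
each other by comparing these conditions. -/
def IsFactorAlg (A : Type u) [CommRing A] [Algebra A₀ A]
    (c : ∀ (R : Type u) [CommRing R] [Algebra A₀ R], Prop) : Prop :=
  ∀ (R : Type u) [CommRing R] [Algebra A₀ R], Subsingleton (A →ₐ[A₀] R) ∧
    (Nonempty (A →ₐ[A₀] R) ↔ c R)

theorem IsFactorAlg.hom_ext {A : Type u} [CommRing A] [Algebra A₀ A]
    {c : ∀ (R : Type u) [CommRing R] [Algebra A₀ R], Prop} (hA : IsFactorAlg A c) {R : Type u}
    [CommRing R] [Algebra A₀ R] (φ ψ : A →ₐ[A₀] R) : φ = ψ :=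
  (hA R).1.elim φ ψ

theorem IsFactorAlg.nonempty_iff {A : Type u} [CommRing A] [Algebra A₀ A]
    {c : ∀ (R : Type u) [CommRing R] [Algebra A₀ R], Prop} (hA : IsFactorAlg A c) (R : Type u)
    [CommRing R] [Algebra A₀ R] : Nonempty (A →ₐ[A₀] R) ↔ c R :=
  (hA R).2

theorem IsFactorAlg.nonempty_algEquiv {A B : Type u} [CommRing A] [Algebra A₀ A] [CommRing B]
    [Algebra A₀ B] {c c' : ∀ (R : Type u) [CommRing R] [Algebra A₀ R], Prop}
    (hA : IsFactorAlg A c) (hB : IsFactorAlg B c')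
    (h : ∀ (R : Type u) [CommRing R] [Algebra A₀ R], c R ↔ c' R) : Nonempty (A ≃ₐ[A₀] B) := by
  obtain ⟨f⟩ := (hA.nonempty_iff B).mpr ((h B).mpr ((hB.nonempty_iff B).mp ⟨AlgHom.id A₀ B⟩))
  obtain ⟨g⟩ := (hB.nonempty_iff A).mpr ((h A).mp ((hA.nonempty_iff A).mp ⟨AlgHom.id A₀ A⟩))
  exact ⟨AlgEquiv.ofAlgHom f g (hB.hom_ext _ _) (hA.hom_ext _ _)⟩

theorem IsFactorAlg.quotient {A : Type u} [CommRing A] [Algebra A₀ A]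
    {c : ∀ (R : Type u) [CommRing R] [Algebra A₀ R], Prop} (hA : IsFactorAlg A c) (I : Ideal A₀) :
    IsFactorAlg (A ⧸ I.map (algebraMap A₀ A))
      (fun (R : Type u) [CommRing R] [Algebra A₀ R] => c R ∧ ∀ x ∈ I, algebraMap A₀ R x = 0) := by
  intro R _ _
  refine ⟨⟨fun φ ψ => Ideal.Quotient.algHom_ext _ (hA.hom_ext _ _)⟩, ?_, ?_⟩
  · rintro ⟨φ⟩
    refine ⟨(hA.nonempty_iff R).mp ⟨φ.comp (Ideal.Quotient.mkₐ A₀ _)⟩, fun x hx => ?_⟩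
    rw [← φ.commutes, IsScalarTower.algebraMap_apply A₀ A, Ideal.Quotient.algebraMap_eq,
      Ideal.Quotient.eq_zero_iff_mem.mpr (Ideal.mem_map_of_mem _ hx), map_zero]
  · rintro ⟨h1, h2⟩
    obtain ⟨φ⟩ := (hA.nonempty_iff R).mpr h1
    refine ⟨Ideal.Quotient.liftₐ _ φ fun a ha => ?_⟩
    refine (Ideal.map_le_iff_le_comap.mpr fun x hx => ?_ : _ ≤ RingHom.ker φ) ha
    change φ (algebraMap A₀ A x) = 0
    rw [φ.commutes, h2 x hx]

theorem IsFactorAlg.away {A : Type u} [CommRing A] [Algebra A₀ A]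
    {c : ∀ (R : Type u) [CommRing R] [Algebra A₀ R], Prop} (hA : IsFactorAlg A c) (g : A₀)
    (g' : A) (hg : algebraMap A₀ A g = g') :
    IsFactorAlg (Localization.Away g')
      (fun (R : Type u) [CommRing R] [Algebra A₀ R] => c R ∧ IsUnit (algebraMap A₀ R g)) := by
  subst hg
  intro R _ _
  refine ⟨⟨fun φ ψ => IsLocalization.algHom_ext (Submonoid.powers (algebraMap A₀ A g))
    (hA.hom_ext _ _)⟩, ?_, ?_⟩
  · rintro ⟨φ⟩
    refine ⟨(hA.nonempty_iff R).mp ⟨φ.comp (IsScalarTower.toAlgHom A₀ A _)⟩, ?_⟩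
    have h := (IsLocalization.Away.algebraMap_isUnit (S := Localization.Away (algebraMap A₀ A g))
      (algebraMap A₀ A g)).map φ
    rwa [← IsScalarTower.algebraMap_apply, φ.commutes] at h
  · rintro ⟨h1, h2⟩
    obtain ⟨φ⟩ := (hA.nonempty_iff R).mpr h1
    rw [← φ.commutes] at h2
    exact ⟨IsLocalization.Away.liftAlgHom (algebraMap A₀ A g) (f := φ) h2⟩

theorem isFactorAlg_self : IsFactorAlg A₀ (fun (R : Type u) [CommRing R] [Algebra A₀ R] => True) :=
  fun _ _ _ => ⟨inferInstance, by simpa using ⟨Algebra.ofId _ _⟩⟩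

theorem isFactorAlg_quotient (I : Ideal A₀) :
    IsFactorAlg (A₀ ⧸ I)
      (fun (R : Type u) [CommRing R] [Algebra A₀ R] => ∀ x ∈ I, algebraMap A₀ R x = 0) := by
  intro R _ _
  have h := isFactorAlg_self.quotient I
  rw [Algebra.algebraMap_self, Ideal.map_id] at h
  simpa using h R

/-- Noetherian induction for a property of `A₀`-algebras that can be checked after cutting along
an element, and that holds on a nonempty open subset of every integral algebra. -/
theorem noetherian_cut_induction [IsNoetherianRing A₀]
    (P : ∀ (A : Type u) [CommRing A] [Algebra A₀ A], Prop)
    (iso : ∀ (A B : Type u) [CommRing A] [Algebra A₀ A] [CommRing B] [Algebra A₀ B],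
      (A ≃ₐ[A₀] B) → P A → P B)
    (zero : ∀ (A : Type u) [CommRing A] [Algebra A₀ A], Subsingleton A → P A)
    (cut : ∀ (A : Type u) [CommRing A] [Algebra A₀ A] [Algebra.FiniteType A₀ A] (g : A),
      P (Localization.Away g) → P (A ⧸ Ideal.span {g}) → P A)
    (dom : ∀ (A : Type u) [CommRing A] [Algebra A₀ A] [Algebra.FiniteType A₀ A] [IsDomain A],
      ∃ h : A, h ≠ 0 ∧ P (Localization.Away h)) : P A₀ := by
  -- The induction is on the ideal; the element `g` keeps track of the open subsets passed to.
  suffices H : ∀ (I : Ideal A₀) (g : A₀), P (Localization.Away (Ideal.Quotient.mk I g)) by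
    obtain ⟨e⟩ := ((isFactorAlg_quotient (⊥ : Ideal A₀)).away 1 (Ideal.Quotient.mk ⊥ 1)
      rfl).nonempty_algEquiv isFactorAlg_self (fun R _ _ => by simp)
    exact iso _ _ e (H ⊥ 1)
  intro I
  induction I using IsNoetherian.induction with
  | hgt I ih =>
  intro g
  have hB := (isFactorAlg_quotient I).away g (Ideal.Quotient.mk I g) rfl
  -- A closed subset defined by an `x ∉ I` is covered by the induction hypothesis.
  have closedCase : ∀ x ∉ I, ∀ y : Localization.Away (Ideal.Quotient.mk I g),
      Ideal.span {y} = Ideal.span {algebraMap A₀ _ x} →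
      P (Localization.Away (Ideal.Quotient.mk I g) ⧸ Ideal.span {y}) := by
    intro x hx y hy
    have h1 := hB.quotient (Ideal.span {x})
    rw [Ideal.map_span, Set.image_singleton] at h1
    rw [hy]
    obtain ⟨e⟩ := ((isFactorAlg_quotient (I ⊔ Ideal.span {x})).away g _ rfl).nonempty_algEquiv h1
      (fun R _ _ => by
        constructor
        · rintro ⟨h1, h2⟩
          exact ⟨⟨fun z hz => h1 z (Ideal.mem_sup_left hz), h2⟩,
            fun z hz => h1 z (Ideal.mem_sup_right hz)⟩
        · rintro ⟨⟨h1, h2⟩, h3⟩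
          refine ⟨fun z hz => ?_, h2⟩
          obtain ⟨a, ha, b, hb, rfl⟩ := Submodule.mem_sup.mp hz
          rw [map_add, h1 a ha, h3 b hb, add_zero])
    exact iso _ _ e (ih _ (left_lt_sup.mpr fun h => hx (h (Ideal.mem_span_singleton_self x))) g)
  by_cases hp : Ideal.IsPrime I
  · by_cases hg : g ∈ I
    · apply zero
      rw [Ideal.Quotient.eq_zero_iff_mem.mpr hg]
      exact IsLocalization.subsingleton (M := Submonoid.powers (0 : A₀ ⧸ I)) ⟨1, by simp⟩
    · have hg' : Ideal.Quotient.mk I g ≠ 0 := by rwa [Ne, Ideal.Quotient.eq_zero_iff_mem]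
      have : IsDomain (Localization.Away (Ideal.Quotient.mk I g)) := Localization.Away.isDomain hg'
      have : Algebra.FiniteType A₀ (Localization.Away (Ideal.Quotient.mk I g)) :=
        Algebra.FiniteType.trans (S := A₀ ⧸ I) inferInstance
          (IsLocalization.finiteType_of_monoid_fg (Submonoid.powers (Ideal.Quotient.mk I g)) _)
      obtain ⟨h, h0, hP⟩ := dom (Localization.Away (Ideal.Quotient.mk I g))
      refine cut _ h hP ?_
      obtain ⟨n, a, ha⟩ := IsLocalization.Away.surj (Ideal.Quotient.mk I g) h
      obtain ⟨x, rfl⟩ := Ideal.Quotient.mk_surjective a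
      have hu := (IsLocalization.Away.algebraMap_isUnit
        (S := Localization.Away (Ideal.Quotient.mk I g)) (Ideal.Quotient.mk I g)).pow n
      refine closedCase x ?_ h ?_
      · intro hx
        rw [Ideal.Quotient.eq_zero_iff_mem.mpr hx, map_zero] at ha
        exact h0 ((hu.mul_left_eq_zero).mp ha)
      · rw [IsScalarTower.algebraMap_apply A₀ (A₀ ⧸ I), Ideal.Quotient.algebraMap_eq, ← ha]
        exact (Ideal.span_singleton_mul_right_unit hu h).symm
  · by_cases hI : I = ⊤
    · apply zero
      subst hI
      have : Ideal.Quotient.mk (⊤ : Ideal A₀) g = 0 := Ideal.Quotient.eq_zero_iff_mem.mpr trivial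
      rw [this]
      exact IsLocalization.subsingleton (M := Submonoid.powers (0 : A₀ ⧸ (⊤ : Ideal A₀))) ⟨1, by simp⟩
    · rw [Ideal.isPrime_iff] at hp
      push Not at hp
      obtain ⟨x, y, hxy, hx, hy⟩ := hp hI
      have : Algebra.FiniteType A₀ (Localization.Away (Ideal.Quotient.mk I g)) :=
        Algebra.FiniteType.trans (S := A₀ ⧸ I) inferInstance
          (IsLocalization.finiteType_of_monoid_fg (Submonoid.powers (Ideal.Quotient.mk I g)) _)
      -- If `x * y ∈ I`, then `y` vanishes where `x` does not.
      refine cut _ (algebraMap A₀ _ x) ?_ (closedCase x hx _ rfl)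
      obtain ⟨e⟩ := ((isFactorAlg_quotient (I ⊔ Ideal.span {y})).away (g * x) _
        rfl).nonempty_algEquiv (hB.away x _ rfl)
        (fun R _ _ => by
          rw [map_mul, IsUnit.mul_iff]
          constructor
          · rintro ⟨h1, h2, h3⟩
            exact ⟨⟨fun z hz => h1 z (Ideal.mem_sup_left hz), h2⟩, h3⟩
          · rintro ⟨⟨h1, h2⟩, h3⟩
            refine ⟨fun z hz => ?_, h2, h3⟩
            obtain ⟨a, ha, b, hb, rfl⟩ := Submodule.mem_sup.mp hz
            obtain ⟨c, rfl⟩ := Ideal.mem_span_singleton.mp hb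
            have h4 := h1 _ hxy
            rw [map_mul, h3.mul_right_eq_zero] at h4
            rw [map_add, map_mul, h1 a ha, h4, zero_mul, add_zero])
      exact iso _ _ e (ih _ (left_lt_sup.mpr fun h => hy (h (Ideal.mem_span_singleton_self y))) _)

end Noetherian

section Generic

variable {k : Type u} [Field k] [IsAlgClosed k] {d : ℕ}

attribute [local instance] Algebra.TensorProduct.rightAlgebra in
theorem isLocalization_tensorProduct_away {A₀ A B : Type u} [CommRing A₀] [CommRing A]
    [Algebra A₀ A] [CommRing B] [Algebra A₀ B] (g : A)
    [Algebra (A ⊗[A₀] B) (Localization.Away g ⊗[A₀] B)]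
    (h : algebraMap (A ⊗[A₀] B) (Localization.Away g ⊗[A₀] B) =
      (Algebra.TensorProduct.map (IsScalarTower.toAlgHom A₀ A (Localization.Away g))
        (AlgHom.id A₀ B)).toRingHom) :
    IsLocalization.Away (g ⊗ₜ[A₀] (1 : B)) (Localization.Away g ⊗[A₀] B) := by
  have : IsScalarTower A (A ⊗[A₀] B) (Localization.Away g ⊗[A₀] B) := by
    refine IsScalarTower.of_algebraMap_eq fun x => ?_
    rw [h]
    simp [Algebra.TensorProduct.algebraMap_apply]
  have h1 := IsLocalization.tensorProduct_tensorProduct A₀ B (Submonoid.powers g)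
    (Localization.Away g) (by rw [h]; ext; simp)
  rwa [Algebra.algebraMapSubmonoid_powers] at h1

/-- For a morphism `Spec B₀ → Spec A₀`, divisibility follows if it holds for the restriction of
every base change to an integral scheme to a nonempty open subset of the base. -/
theorem LefschetzDvd.of_generic {A₀ B₀ : Type u} [CommRing A₀] [Algebra k A₀]
    [Algebra.FiniteType k A₀] [CommRing B₀] [Algebra A₀ B₀] [Algebra.FiniteType A₀ B₀]
    [Algebra k B₀] [IsScalarTower k A₀ B₀]
    (H : ∀ (A : Type u) [CommRing A] [IsDomain A] [Algebra k A] [Algebra.FiniteType k A]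
      [Algebra A₀ A] [IsScalarTower k A₀ A], ∃ h : A, h ≠ 0 ∧
        LefschetzDvd k d (Localization.Away h ⊗[A₀] B₀)) : LefschetzDvd k d B₀ := by
  have : IsNoetherianRing A₀ := Algebra.FiniteType.isNoetherianRing k A₀
  have key := noetherian_cut_induction (A₀ := A₀) (fun A _ _ => ∀ [Algebra k A]
    [IsScalarTower k A₀ A], LefschetzDvd k d (A ⊗[A₀] B₀)) ?_ ?_ ?_ ?_
  · exact key.of_algEquiv ((Algebra.TensorProduct.lid A₀ B₀).restrictScalars k)
  · intro A B _ _ _ _ e hA _ _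
    let _ : Algebra k A := Algebra.compHom A (algebraMap k A₀)
    have : IsScalarTower k A₀ A := IsScalarTower.of_algebraMap_eq fun _ => rfl
    exact hA.of_algEquiv ((Algebra.TensorProduct.congr e AlgEquiv.refl).restrictScalars k)
  · intro A _ _ hA _ _
    have : Subsingleton (A ⊗[A₀] B₀) := subsingleton_of_zero_eq_one (by
      rw [Algebra.TensorProduct.one_def, Subsingleton.elim (1 : A) 0, TensorProduct.zero_tmul])
    exact lefschetzDvd_of_subsingleton _
  · intro A _ _ _ g h1 h2 _ _
    have : Algebra.FiniteType k A := Algebra.FiniteType.trans (S := A₀) inferInstance inferInstance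
    have : Algebra.FiniteType k (A ⊗[A₀] B₀) :=
      Algebra.FiniteType.trans (S := A) inferInstance inferInstance
    let ψ := Algebra.TensorProduct.map (IsScalarTower.toAlgHom A₀ A (Localization.Away g))
      (AlgHom.id A₀ B₀)
    let _ : Algebra (A ⊗[A₀] B₀) (Localization.Away g ⊗[A₀] B₀) := ψ.toAlgebra
    have := isLocalization_tensorProduct_away (A₀ := A₀) (B := B₀) g rfl
    have : IsScalarTower k (A ⊗[A₀] B₀) (Localization.Away g ⊗[A₀] B₀) :=
      IsScalarTower.of_algebraMap_eq fun x => by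
        change _ = ψ _
        rw [IsScalarTower.algebraMap_apply k A₀, IsScalarTower.algebraMap_apply k A₀ (A ⊗[A₀] B₀),
          ψ.commutes]
    let π : A ⊗[A₀] B₀ →ₐ[A₀] (A ⧸ Ideal.span {g}) ⊗[A₀] B₀ :=
      Algebra.TensorProduct.map (Ideal.Quotient.mkₐ A₀ (Ideal.span {g})) (AlgHom.id A₀ B₀)
    refine LefschetzDvd.of_cut (B₁ := Localization.Away g ⊗[A₀] B₀) (g ⊗ₜ[A₀] (1 : B₀))
      (π.restrictScalars k) ?_ ?_ h1 h2
    · exact TensorProduct.map_surjective (g := (Ideal.Quotient.mkₐ A₀ (Ideal.span {g})).toLinearMap)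
        Ideal.Quotient.mk_surjective (g' := LinearMap.id) Function.surjective_id
    · have h3 := Algebra.TensorProduct.rTensor_ker (R := A₀) (C := B₀)
        (Ideal.Quotient.mkₐ A₀ (Ideal.span {g})) Ideal.Quotient.mk_surjective
      have h4 : RingHom.ker (Ideal.Quotient.mkₐ A₀ (Ideal.span {g})) = Ideal.span {g} := Ideal.mk_ker
      rw [h4, Ideal.map_span, Set.image_singleton] at h3
      exact h3
  · intro A _ _ _ _
    let _ : Algebra k A := Algebra.compHom A (algebraMap k A₀)
    have : IsScalarTower k A₀ A := IsScalarTower.of_algebraMap_eq fun _ => rfl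
    have : Algebra.FiniteType k A := Algebra.FiniteType.trans (S := A₀) inferInstance inferInstance
    obtain ⟨h, h0, hh⟩ := H A
    refine ⟨h, h0, ?_⟩
    intro i₁ i₂
    obtain rfl : i₁ = OreLocalization.instAlgebra := by
      refine Algebra.algebra_ext _ _ fun r => ?_
      rw [IsScalarTower.algebraMap_apply k A₀]
      rfl
    exact hh

end Generic

/-! ### Systems of equations for truncated power series -/

open scoped Polynomial

section JetSystem

variable {A R S : Type u} [CommRing A] [CommRing R] [CommRing S] {m N l : ℕ}

/-- The vector of polynomials `∑ b, y (j, b) t ^ b` with coefficient family `y`. -/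
noncomputable def jetPoly (y : Fin N × Fin l → R) (j : Fin N) : R[X] :=
  ∑ b : Fin l, Polynomial.C (y (j, b)) * Polynomial.X ^ (b : ℕ)

/-- Base change of a system of polynomials with coefficients in `A[t]`. -/
noncomputable def baseChange (φ : A →+* R) (G : Fin m → MvPolynomial (Fin N) A[X]) :
    Fin m → MvPolynomial (Fin N) R[X] :=
  fun i => MvPolynomial.map (Polynomial.mapRingHom φ) (G i)

/-- The family `y` solves the system `G (t ^ s * y) = 0` modulo `t ^ (n + 1)`. -/
def IsJetSol (n s : ℕ) (G : Fin m → MvPolynomial (Fin N) R[X]) (y : Fin N × Fin l → R) : Prop :=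
  ∀ i, (Polynomial.X : R[X]) ^ (n + 1) ∣
    MvPolynomial.eval (fun j => Polynomial.X ^ s * jetPoly y j) (G i)

theorem map_jetPoly (φ : R →+* S) (y : Fin N × Fin l → R) (j : Fin N) :
    (jetPoly y j).map φ = jetPoly (fun p => φ (y p)) j := by
  simp [jetPoly, Polynomial.map_sum]

theorem coeff_jetPoly (y : Fin N × Fin l → R) (j : Fin N) (b : Fin l) :
    (jetPoly y j).coeff b = y (j, b) := by
  simp [jetPoly, Polynomial.coeff_X_pow, Fin.val_inj]

theorem coeff_jetPoly_of_le (y : Fin N × Fin l → R) (j : Fin N) {b : ℕ} (hb : l ≤ b) :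
    (jetPoly y j).coeff b = 0 := by
  simp only [jetPoly, Polynomial.finsetSum_coeff, Polynomial.coeff_C_mul, Polynomial.coeff_X_pow]
  refine Finset.sum_eq_zero fun c _ => ?_
  rw [if_neg (by have := c.2; omega), mul_zero]

theorem baseChange_comp (φ : A →+* R) (ψ : R →+* S) (G : Fin m → MvPolynomial (Fin N) A[X]) :
    baseChange ψ (baseChange φ G) = baseChange (ψ.comp φ) G := by
  funext i
  simp only [baseChange, MvPolynomial.map_map]
  rw [Polynomial.mapRingHom_comp]

theorem map_eval_baseChange (φ : R →+* S) (G : Fin m → MvPolynomial (Fin N) R[X])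
    (w : Fin N → R[X]) (i : Fin m) : (MvPolynomial.eval w (G i)).map φ =
      MvPolynomial.eval (fun j => (w j).map φ) (baseChange φ G i) := by
  rw [baseChange, MvPolynomial.eval_map, ← Polynomial.coe_mapRingHom, MvPolynomial.eval,
    MvPolynomial.coe_eval₂Hom, MvPolynomial.eval₂_comp_left]
  rfl

theorem map_eval_jetPoly (φ : R →+* S) (s : ℕ) (G : Fin m → MvPolynomial (Fin N) R[X])
    (y : Fin N × Fin l → R) (i : Fin m) :
    (MvPolynomial.eval (fun j => Polynomial.X ^ s * jetPoly y j) (G i)).map φ =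
      MvPolynomial.eval (fun j => Polynomial.X ^ s * jetPoly (fun p => φ (y p)) j)
        (baseChange φ G i) := by
  rw [map_eval_baseChange]
  simp [map_jetPoly]

theorem IsJetSol.map {n s : ℕ} {G : Fin m → MvPolynomial (Fin N) R[X]}
    {y : Fin N × Fin l → R} (h : IsJetSol n s G y) (φ : R →+* S) :
    IsJetSol n s (baseChange φ G) (fun p => φ (y p)) := by
  intro i
  have := map_dvd (Polynomial.mapRingHom φ) (h i)
  rw [Polynomial.coe_mapRingHom, map_eval_jetPoly φ] at this
  simpa using this

variable (A N l) in
/-- The generic coefficient family. -/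
noncomputable def genericCoeff (p : Fin N × Fin l) : MvPolynomial (Fin N × Fin l) A :=
  MvPolynomial.X p

/-- The ideal of relations between the coordinates of the generic solution. -/
noncomputable def solIdeal (n s l : ℕ) (G : Fin m → MvPolynomial (Fin N) A[X]) :
    Ideal (MvPolynomial (Fin N × Fin l) A) :=
  Ideal.span {x | ∃ i, ∃ c < n + 1, x = (MvPolynomial.eval (fun j => Polynomial.X ^ s *
    jetPoly (genericCoeff A N l) j) (baseChange MvPolynomial.C G i)).coeff c}

/-- The `A`-algebra representing the functor of solutions of `G (t ^ s * y) = 0` modulo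
`t ^ (n + 1)`, where `y` is a vector of polynomials of degree less than `l`. -/
def SolAlg (n s l : ℕ) (G : Fin m → MvPolynomial (Fin N) A[X]) : Type u :=
  MvPolynomial (Fin N × Fin l) A ⧸ solIdeal n s l G

noncomputable instance (n s l : ℕ) (G : Fin m → MvPolynomial (Fin N) A[X]) :
    CommRing (SolAlg n s l G) :=
  inferInstanceAs (CommRing (MvPolynomial (Fin N × Fin l) A ⧸ solIdeal n s l G))

noncomputable instance {k : Type*} [CommRing k] [Algebra k A] (n s l : ℕ)
    (G : Fin m → MvPolynomial (Fin N) A[X]) : Algebra k (SolAlg n s l G) :=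
  inferInstanceAs (Algebra k (MvPolynomial (Fin N × Fin l) A ⧸ solIdeal n s l G))

instance {k k' : Type*} [CommRing k] [CommRing k'] [Algebra k A] [Algebra k' A] [Algebra k k']
    [IsScalarTower k k' A] (n s l : ℕ) (G : Fin m → MvPolynomial (Fin N) A[X]) :
    IsScalarTower k k' (SolAlg n s l G) :=
  inferInstanceAs (IsScalarTower k k' (MvPolynomial (Fin N × Fin l) A ⧸ solIdeal n s l G))

instance (n s l : ℕ) (G : Fin m → MvPolynomial (Fin N) A[X]) :
    Algebra.FiniteType A (SolAlg n s l G) :=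
  inferInstanceAs (Algebra.FiniteType A (MvPolynomial (Fin N × Fin l) A ⧸ solIdeal n s l G))

variable {n s : ℕ} {G : Fin m → MvPolynomial (Fin N) A[X]}

theorem aeval_coeff_eval [Algebra A R] (y : Fin N × Fin l → R) (i : Fin m) (c : ℕ) :
    MvPolynomial.aeval y ((MvPolynomial.eval (fun j => Polynomial.X ^ s *
      jetPoly (genericCoeff A N l) j) (baseChange MvPolynomial.C G i)).coeff c) =
    (MvPolynomial.eval (fun j => Polynomial.X ^ s * jetPoly y j)
      (baseChange (algebraMap A R) G i)).coeff c := by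
  have h := map_eval_jetPoly (MvPolynomial.aeval y : MvPolynomial (Fin N × Fin l) A →ₐ[A] R).toRingHom
    s (baseChange MvPolynomial.C G) (genericCoeff A N l) i
  rw [baseChange_comp] at h
  have h1 : (MvPolynomial.aeval y : MvPolynomial (Fin N × Fin l) A →ₐ[A] R).toRingHom.comp
    MvPolynomial.C = algebraMap A R := by ext; simp
  rw [h1] at h
  have h2 := congrArg (fun p => p.coeff c) h
  simpa [Polynomial.coeff_map, genericCoeff] using h2

/-- The quotient map onto `SolAlg`. -/
noncomputable def solMk (n s l : ℕ) (G : Fin m → MvPolynomial (Fin N) A[X]) :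
    MvPolynomial (Fin N × Fin l) A →ₐ[A] SolAlg n s l G :=
  Ideal.Quotient.mkₐ A (solIdeal n s l G)

/-- The coordinates of the generic solution. -/
noncomputable def solPoint (n s l : ℕ) (G : Fin m → MvPolynomial (Fin N) A[X])
    (p : Fin N × Fin l) : SolAlg n s l G :=
  solMk n s l G (MvPolynomial.X p)

theorem solAlg_hom_ext [Algebra A R] {φ ψ : SolAlg n s l G →ₐ[A] R}
    (h : ∀ p, φ (solPoint n s l G p) = ψ (solPoint n s l G p)) : φ = ψ :=
  Ideal.Quotient.algHom_ext (I := solIdeal n s l G) A (MvPolynomial.algHom_ext h)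

theorem isJetSol_hom [Algebra A R] (φ : SolAlg n s l G →ₐ[A] R) :
    IsJetSol n s (baseChange (algebraMap A R) G) (fun p => φ (solPoint n s l G p)) := by
  intro i
  rw [Polynomial.X_pow_dvd_iff]
  intro c hc
  rw [← aeval_coeff_eval]
  have h1 : MvPolynomial.aeval (fun p => φ (solPoint n s l G p)) =
      φ.comp (solMk n s l G) := by
    apply MvPolynomial.algHom_ext
    intro p
    rw [MvPolynomial.aeval_X]
    rfl
  rw [h1, AlgHom.comp_apply]
  refine (congrArg φ ?_).trans (map_zero φ)
  exact (Ideal.Quotient.eq_zero_iff_mem (I := solIdeal n s l G)).mpr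
    (Ideal.subset_span ⟨i, c, hc, rfl⟩)

/-- The homomorphism classifying a solution. -/
noncomputable def solLift [Algebra A R] (y : Fin N × Fin l → R)
    (hy : IsJetSol n s (baseChange (algebraMap A R) G) y) : SolAlg n s l G →ₐ[A] R :=
  Ideal.Quotient.liftₐ (solIdeal n s l G) (MvPolynomial.aeval y) (by
    intro a ha
    refine (Ideal.span_le.mpr ?_ : solIdeal n s l G ≤ RingHom.ker (MvPolynomial.aeval y)) ha
    rintro _ ⟨i, c, hc, rfl⟩
    refine (aeval_coeff_eval y i c).trans ?_
    exact Polynomial.X_pow_dvd_iff.mp (hy i) c hc)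

theorem solLift_solPoint [Algebra A R] (y : Fin N × Fin l → R)
    (hy : IsJetSol n s (baseChange (algebraMap A R) G) y) (p) :
    solLift y hy (solPoint n s l G p) = y p :=
  MvPolynomial.aeval_X (R := A) y p

theorem isJetSol_solPoint : IsJetSol n s (baseChange (algebraMap A (SolAlg n s l G)) G)
    (solPoint n s l G) := isJetSol_hom (AlgHom.id A (SolAlg n s l G))

/-- The formation of `SolAlg` commutes with base change. -/
theorem nonempty_tensor_solAlg_equiv (n s l : ℕ) (G : Fin m → MvPolynomial (Fin N) A[X])
    [Algebra A R] : Nonempty (R ⊗[A] SolAlg n s l G ≃ₐ[R]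
      SolAlg n s l (baseChange (algebraMap A R) G)) := by
  let B := SolAlg n s l G
  let C := SolAlg n s l (baseChange (algebraMap A R) G)
  have h1 : IsJetSol n s (baseChange (algebraMap A C) G)
      (solPoint n s l (baseChange (algebraMap A R) G)) := by
    have := isJetSol_solPoint (n := n) (s := s) (l := l) (G := baseChange (algebraMap A R) G)
    rwa [baseChange_comp, ← IsScalarTower.algebraMap_eq] at this
  have h2 : IsJetSol n s (baseChange (algebraMap R (R ⊗[A] B)) (baseChange (algebraMap A R) G))
      (fun p => (1 : R) ⊗ₜ[A] solPoint n s l G p) := by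
    have := (isJetSol_solPoint (n := n) (s := s) (l := l) (G := G)).map
      (Algebra.TensorProduct.includeRight : B →ₐ[A] R ⊗[A] B).toRingHom
    rw [baseChange_comp] at this
    rw [baseChange_comp, ← IsScalarTower.algebraMap_eq]
    have h3 : (Algebra.TensorProduct.includeRight : B →ₐ[A] R ⊗[A] B).toRingHom.comp
        (algebraMap A B) = algebraMap A (R ⊗[A] B) :=
      (Algebra.TensorProduct.includeRight : B →ₐ[A] R ⊗[A] B).comp_algebraMap
    rwa [h3] at this
  let f : R ⊗[A] B →ₐ[R] C :=
    Algebra.TensorProduct.productLeftAlgHom (Algebra.ofId R C) (solLift _ h1)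
  let g : C →ₐ[R] R ⊗[A] B := solLift _ h2
  have hf : ∀ x : B, f ((1 : R) ⊗ₜ[A] x) = solLift _ h1 x := fun x => by
    simp [f, Algebra.TensorProduct.productLeftAlgHom]
  refine ⟨AlgEquiv.ofAlgHom f g ?_ ?_⟩
  · apply solAlg_hom_ext
    intro p
    have h3 : g (solPoint n s l _ p) = _ := solLift_solPoint _ h2 p
    rw [AlgHom.comp_apply, h3]
    rw [hf, solLift_solPoint]
    rfl
  · apply Algebra.TensorProduct.ext (by ext)
    apply solAlg_hom_ext
    intro p
    change g (f ((1 : R) ⊗ₜ[A] solPoint n s l G p)) = (1 : R) ⊗ₜ[A] solPoint n s l G p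
    have h3 : f ((1 : R) ⊗ₜ[A] solPoint n s l G p) = solPoint n s l _ p := by
      rw [hf, solLift_solPoint]
    rw [h3]
    exact solLift_solPoint _ h2 p

end JetSystem

section Step

variable {A R : Type u} [CommRing A] [CommRing R] {m N l : ℕ}

/-- The system `G (t ^ s * z + w)` with `z` a vector of new indeterminate constants. -/
noncomputable def shiftSystem (s : ℕ) (G : Fin m → MvPolynomial (Fin N) A[X]) :
    Fin m → MvPolynomial (Fin N) (MvPolynomial (Fin N) A)[X] := fun i =>
  MvPolynomial.eval₂ (MvPolynomial.C.comp (Polynomial.mapRingHom MvPolynomial.C))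
    (fun j => MvPolynomial.C (Polynomial.X ^ s * Polynomial.C (MvPolynomial.X j)) +
      MvPolynomial.X j) (G i)

theorem eval_baseChange_shiftSystem (s : ℕ) (G : Fin m → MvPolynomial (Fin N) A[X])
    (φ : MvPolynomial (Fin N) A →+* R) (w : Fin N → R[X]) (i : Fin m) :
    MvPolynomial.eval w (baseChange φ (shiftSystem s G) i) = MvPolynomial.eval
      (fun j => Polynomial.X ^ s * Polynomial.C (φ (MvPolynomial.X j)) + w j)
        (baseChange (φ.comp MvPolynomial.C) G i) := by
  simp only [baseChange, shiftSystem, MvPolynomial.eval_map]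
  generalize G i = g
  induction g using MvPolynomial.induction_on with
  | C a => simp [Polynomial.map_map]
  | add p q hp hq => simp only [MvPolynomial.eval₂_add, hp, hq]
  | mul_X p j hp =>
    simp only [MvPolynomial.eval₂_mul, hp]
    simp

/-- Putting `z` in front of the coefficients `y`. -/
def consCoeff (z : Fin N → R) (y : Fin N × Fin l → R) (p : Fin N × Fin (l + 1)) : R :=
  Fin.cons (α := fun _ => R) (z p.1) (fun b => y (p.1, b)) p.2

theorem jetPoly_consCoeff (z : Fin N → R) (y : Fin N × Fin l → R) (j : Fin N) :
    jetPoly (consCoeff z y) j = Polynomial.C (z j) + Polynomial.X * jetPoly y j := by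
  simp only [jetPoly, Fin.sum_univ_succ, consCoeff, Fin.cons_zero, Fin.cons_succ, Finset.mul_sum]
  simp only [Fin.val_zero, pow_zero, mul_one, Fin.val_succ]
  congr 1
  refine Finset.sum_congr rfl fun b _ => ?_
  ring

theorem isJetSol_shiftSystem_iff {n s : ℕ} (G : Fin m → MvPolynomial (Fin N) A[X])
    (φ : MvPolynomial (Fin N) A →+* R) (y : Fin N × Fin l → R) :
    IsJetSol n (s + 1) (baseChange φ (shiftSystem s G)) y ↔
      IsJetSol n s (baseChange (φ.comp MvPolynomial.C) G)
        (consCoeff (fun j => φ (MvPolynomial.X j)) y) := by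
  refine forall_congr' fun i => ?_
  rw [eval_baseChange_shiftSystem]
  have h : ∀ j, Polynomial.X ^ s * jetPoly (consCoeff (fun j => φ (MvPolynomial.X j)) y) j =
    Polynomial.X ^ s * Polynomial.C (φ (MvPolynomial.X j)) + Polynomial.X ^ (s + 1) * jetPoly y j :=
    fun j => by rw [jetPoly_consCoeff]; ring
  simp only [h]

/-- Splitting off the lowest coefficients of the unknowns does not change the solution functor. -/
theorem nonempty_solAlg_shiftSystem_equiv (n s l : ℕ) (G : Fin m → MvPolynomial (Fin N) A[X]) :
    Nonempty (SolAlg n (s + 1) l (shiftSystem s G) ≃ₐ[A] SolAlg n s (l + 1) G) := by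
  let B := SolAlg n s (l + 1) G
  let C := SolAlg n (s + 1) l (shiftSystem s G)
  let θ : MvPolynomial (Fin N) A →ₐ[A] B := MvPolynomial.aeval fun j => solPoint n s (l + 1) G (j, 0)
  let _ : Algebra (MvPolynomial (Fin N) A) B := θ.toAlgebra
  have hθ : IsScalarTower A (MvPolynomial (Fin N) A) B :=
    IsScalarTower.of_algebraMap_eq fun x => (θ.commutes x).symm
  have h1 : IsJetSol n s (baseChange (algebraMap A C) G)
      (consCoeff (fun j => algebraMap _ C (MvPolynomial.X j))
        (solPoint n (s + 1) l (shiftSystem s G))) :=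
    (isJetSol_shiftSystem_iff G (algebraMap _ C) _).mp isJetSol_solPoint
  have hX : ∀ j, algebraMap (MvPolynomial (Fin N) A) B (MvPolynomial.X j) =
    solPoint n s (l + 1) G (j, 0) := fun j => by
      change θ _ = _
      simp [θ]
  have hcons : consCoeff (fun j => algebraMap (MvPolynomial (Fin N) A) B (MvPolynomial.X j))
      (fun p : Fin N × Fin l => solPoint n s (l + 1) G (p.1, p.2.succ)) = solPoint n s (l + 1) G := by
    funext ⟨j, b⟩
    refine Fin.cases ?_ (fun b => ?_) b
    · simp [consCoeff, hX]
    · simp [consCoeff]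
  have h2 : IsJetSol n (s + 1) (baseChange (algebraMap (MvPolynomial (Fin N) A) B) (shiftSystem s G))
      (fun p => solPoint n s (l + 1) G (p.1, p.2.succ)) := by
    rw [isJetSol_shiftSystem_iff, hcons]
    have : (algebraMap (MvPolynomial (Fin N) A) B).comp MvPolynomial.C = algebraMap A B :=
      (IsScalarTower.algebraMap_eq A (MvPolynomial (Fin N) A) B).symm
    rw [this]
    exact isJetSol_solPoint
  let f : B →ₐ[A] C := solLift _ h1
  let g : C →ₐ[MvPolynomial (Fin N) A] B := solLift _ h2
  have hf : ∀ p, f (solPoint n s (l + 1) G p) = _ := solLift_solPoint _ _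
  have hg : ∀ p, g (solPoint n (s + 1) l (shiftSystem s G) p) = _ := solLift_solPoint _ _
  refine ⟨AlgEquiv.ofAlgHom (g.restrictScalars A) f ?_ ?_⟩
  · apply solAlg_hom_ext
    rintro ⟨j, b⟩
    rw [AlgHom.comp_apply, hf]
    refine Fin.cases ?_ (fun b => ?_) b
    · change g (algebraMap _ C (MvPolynomial.X j)) = _
      rw [g.commutes, hX]
      rfl
    · exact hg (j, b)
  · have h3 : (f.comp (g.restrictScalars A)).comp (IsScalarTower.toAlgHom A (MvPolynomial (Fin N) A) C)
        = IsScalarTower.toAlgHom A (MvPolynomial (Fin N) A) C := by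
      apply MvPolynomial.algHom_ext
      intro j
      change f (g (algebraMap _ C (MvPolynomial.X j))) = algebraMap _ C (MvPolynomial.X j)
      rw [g.commutes, hX, hf]
      rfl
    let ψ : C →ₐ[MvPolynomial (Fin N) A] C :=
      { f.toRingHom.comp g.toRingHom with commutes' := fun x => DFunLike.congr_fun h3 x }
    have h4 : ψ = AlgHom.id _ C := by
      apply solAlg_hom_ext
      rintro ⟨j, b⟩
      change f (g (solPoint n (s + 1) l (shiftSystem s G) (j, b))) = _
      rw [hg, hf]
      rfl
    ext x
    exact DFunLike.congr_fun h4 x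

end Step

/-! ### Linearization -/

section Taylor

/-- Taylor expansion to second order, the remainder being divisible by `x ^ 2`. -/
theorem exists_taylor_aux {S : Type u} [CommRing S] {N : ℕ} (x : S) (g : MvPolynomial (Fin N) S) :
    ∃ Q : MvPolynomial (Fin N) S, MvPolynomial.aeval (fun j => MvPolynomial.C x * MvPolynomial.X j) g =
      MvPolynomial.C (g.coeff 0) + MvPolynomial.C x * ∑ j, MvPolynomial.C
        (g.coeff (Finsupp.single j 1)) * MvPolynomial.X j + MvPolynomial.C (x ^ 2) * Q := by
  induction g using MvPolynomial.induction_on with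
  | C a =>
    refine ⟨0, ?_⟩
    have : ∀ j : Fin N, (MvPolynomial.C a : MvPolynomial (Fin N) S).coeff (Finsupp.single j 1) = 0 :=
      fun j => by
        rw [MvPolynomial.coeff_C, if_neg]
        exact fun h => by simpa using h.symm
    simp [this]
  | add p q hp hq =>
    obtain ⟨P, hP⟩ := hp
    obtain ⟨Q, hQ⟩ := hq
    refine ⟨P + Q, ?_⟩
    rw [map_add, hP, hQ]
    simp only [MvPolynomial.coeff_add, map_add, add_mul, Finset.sum_add_distrib]
    ring
  | mul_X p i hp =>
    obtain ⟨P, hP⟩ := hp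
    refine ⟨(∑ j, MvPolynomial.C (p.coeff (Finsupp.single j 1)) * MvPolynomial.X j) *
      MvPolynomial.X i + MvPolynomial.C x * P * MvPolynomial.X i, ?_⟩
    have h0 : (p * MvPolynomial.X i).coeff 0 = 0 := by
      rw [MvPolynomial.coeff_mul_X']; simp
    have h1 : ∀ j : Fin N, (p * MvPolynomial.X i).coeff (Finsupp.single j 1) =
        if j = i then p.coeff 0 else 0 := by
      intro j
      rw [MvPolynomial.coeff_mul_X']
      by_cases h : j = i
      · subst h; simp
      · rw [if_neg h, if_neg]
        simpa using fun h' => h h'.symm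
    simp only [h0, h1, map_mul, hP, MvPolynomial.aeval_X, apply_ite MvPolynomial.C, map_zero,
      ite_mul, zero_mul, Finset.sum_ite_eq', Finset.mem_univ, if_true, map_pow]
    ring

variable {A : Type u} [CommRing A] {m N l : ℕ}

/-- The constant coefficients of a system. -/
noncomputable def constPart (G : Fin m → MvPolynomial (Fin N) A[X]) (i : Fin m) : A[X] :=
  (G i).coeff 0

/-- The Jacobian matrix at the origin of a system. -/
noncomputable def linearPart (G : Fin m → MvPolynomial (Fin N) A[X]) (i : Fin m) (j : Fin N) : A[X] :=
  (G i).coeff (Finsupp.single j 1)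

theorem constPart_baseChange {R : Type u} [CommRing R] (φ : A →+* R)
    (G : Fin m → MvPolynomial (Fin N) A[X]) (i : Fin m) :
    constPart (baseChange φ G) i = (constPart G i).map φ := by
  simp [constPart, baseChange, MvPolynomial.coeff_map]

theorem linearPart_baseChange {R : Type u} [CommRing R] (φ : A →+* R)
    (G : Fin m → MvPolynomial (Fin N) A[X]) (i : Fin m) (j : Fin N) :
    linearPart (baseChange φ G) i j = (linearPart G i j).map φ := by
  simp [linearPart, baseChange, MvPolynomial.coeff_map]

/-- Taylor expansion of a system to second order along `t ^ s`, compatible with base change. -/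
theorem exists_taylor (s : ℕ) (G : Fin m → MvPolynomial (Fin N) A[X]) :
    ∃ Q : Fin m → MvPolynomial (Fin N) A[X], ∀ (R : Type u) [CommRing R] (φ : A →+* R)
      (p : Fin N → R[X]) (i : Fin m),
      MvPolynomial.eval (fun j => Polynomial.X ^ s * p j) (baseChange φ G i) =
        constPart (baseChange φ G) i + Polynomial.X ^ s * ∑ j, linearPart (baseChange φ G) i j * p j +
          Polynomial.X ^ (2 * s) * MvPolynomial.eval p (baseChange φ Q i) := by
  choose Q hQ using fun i => exists_taylor_aux ((Polynomial.X : A[X]) ^ s) (G i)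
  refine ⟨Q, fun R _ φ p i => ?_⟩
  have h := congrArg (MvPolynomial.eval₂ (Polynomial.mapRingHom φ) p) (hQ i)
  simp only [constPart_baseChange, linearPart_baseChange]
  simp only [MvPolynomial.eval₂_add, MvPolynomial.eval₂_mul, MvPolynomial.eval₂_C,
    MvPolynomial.eval₂_sum, MvPolynomial.eval₂_X, Polynomial.coe_mapRingHom, Polynomial.map_pow,
    Polynomial.map_X, ← pow_mul, mul_comm s 2] at h
  rw [baseChange, baseChange, MvPolynomial.eval_map, MvPolynomial.eval_map]
  refine Eq.trans ?_ h
  generalize G i = g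
  induction g using MvPolynomial.induction_on with
  | C a => simp
  | add p q hp hq => simp only [MvPolynomial.eval₂_add, map_add, hp, hq]
  | mul_X p j hp =>
    simp only [MvPolynomial.eval₂_mul, map_mul, hp]
    simp

end Taylor

section Perturb

variable {R S : Type u} [CommRing R] [CommRing S] {N l : ℕ}

theorem dvd_eval_sub_eval {σ : Type*} (d : R) (g : MvPolynomial σ R) (p q : σ → R)
    (h : ∀ j, d ∣ p j - q j) : d ∣ MvPolynomial.eval p g - MvPolynomial.eval q g := by
  induction g using MvPolynomial.induction_on with
  | C a => simp
  | add a b ha hb =>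
    rw [map_add, map_add, add_sub_add_comm]
    exact dvd_add ha hb
  | mul_X a j ha =>
    rw [map_mul, map_mul, MvPolynomial.eval_X, MvPolynomial.eval_X]
    have : MvPolynomial.eval p a * p j - MvPolynomial.eval q a * q j =
      (MvPolynomial.eval p a - MvPolynomial.eval q a) * p j +
        MvPolynomial.eval q a * (p j - q j) := by ring
    rw [this]
    exact dvd_add (ha.mul_right _) ((h j).mul_left _)

/-- The map `y ↦ y + t * Ψ y` on vectors of polynomials modulo `t ^ l`. -/
noncomputable def perturb (Ψ : Fin N → MvPolynomial (Fin N) R[X]) (y : Fin N × Fin l → R)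
    (p : Fin N × Fin l) : R :=
  y p + (Polynomial.X * MvPolynomial.eval (jetPoly y) (Ψ p.1)).coeff p.2

theorem map_perturb (φ : R →+* S) (Ψ : Fin N → MvPolynomial (Fin N) R[X])
    (y : Fin N × Fin l → R) (p : Fin N × Fin l) :
    φ (perturb Ψ y p) = perturb (baseChange φ Ψ) (fun q => φ (y q)) p := by
  have h := map_eval_baseChange φ Ψ (jetPoly y) p.1
  simp only [map_jetPoly] at h
  rw [perturb, perturb, map_add, ← Polynomial.coeff_map, Polynomial.map_mul, Polynomial.map_X, h]

theorem X_pow_dvd_jetPoly_sub_iff (y y' : Fin N × Fin l → R) (c : ℕ) (j : Fin N) :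
    Polynomial.X ^ c ∣ jetPoly y j - jetPoly y' j ↔
      ∀ b : Fin l, (b : ℕ) < c → y (j, b) = y' (j, b) := by
  rw [Polynomial.X_pow_dvd_iff]
  constructor
  · intro h b hb
    have := h b hb
    rwa [Polynomial.coeff_sub, coeff_jetPoly, coeff_jetPoly, sub_eq_zero] at this
  · intro h b hb
    rw [Polynomial.coeff_sub]
    by_cases hbl : b < l
    · have h1 := coeff_jetPoly y j ⟨b, hbl⟩
      have h2 := coeff_jetPoly y' j ⟨b, hbl⟩
      simp only at h1 h2
      rw [h1, h2, h ⟨b, hbl⟩ hb, sub_self]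
    · rw [coeff_jetPoly_of_le _ _ (by omega), coeff_jetPoly_of_le _ _ (by omega), sub_self]

theorem coeff_X_mul_eval_congr (Ψ : Fin N → MvPolynomial (Fin N) R[X]) {y y' : Fin N × Fin l → R}
    {c : ℕ} (h : ∀ j, ∀ b : Fin l, (b : ℕ) < c → y (j, b) = y' (j, b)) (j : Fin N) {b : ℕ}
    (hb : b < c + 1) : (Polynomial.X * MvPolynomial.eval (jetPoly y) (Ψ j)).coeff b =
      (Polynomial.X * MvPolynomial.eval (jetPoly y') (Ψ j)).coeff b := by
  have h1 := dvd_eval_sub_eval (Polynomial.X ^ c) (Ψ j) (jetPoly y) (jetPoly y')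
    (fun j => (X_pow_dvd_jetPoly_sub_iff y y' c j).mpr (h j))
  have h2 := mul_dvd_mul_left (Polynomial.X : R[X]) h1
  rw [← pow_succ', Polynomial.X_pow_dvd_iff] at h2
  have h3 := h2 b hb
  rwa [mul_sub, Polynomial.coeff_sub, sub_eq_zero] at h3

/-- `t` is nilpotent modulo `t ^ l`, so `y ↦ y + t * Ψ y` is bijective: its values determine the
coefficients of `y` one after the other. -/
theorem perturb_bijective (Ψ : Fin N → MvPolynomial (Fin N) R[X]) :
    Function.Bijective (perturb (l := l) Ψ) := by
  constructor
  · intro y y' h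
    have key : ∀ c : ℕ, ∀ j, ∀ b : Fin l, (b : ℕ) < c → y (j, b) = y' (j, b) := by
      intro c
      induction c with
      | zero => intro j b hb; omega
      | succ c ih =>
        intro j b hb
        have h1 := congrFun h (j, b)
        rw [perturb, perturb, coeff_X_mul_eval_congr Ψ ih j hb] at h1
        exact add_right_cancel h1
    funext ⟨j, b⟩
    exact key l j b b.2
  · intro w
    have key : ∀ c : ℕ, ∃ y : Fin N × Fin l → R, ∀ j, ∀ b : Fin l, (b : ℕ) < c →
        perturb Ψ y (j, b) = w (j, b) := by
      intro c
      induction c with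
      | zero => exact ⟨0, fun j b hb => by omega⟩
      | succ c ih =>
        obtain ⟨y, hy⟩ := ih
        let y' : Fin N × Fin l → R := fun p => y p + (w p - perturb Ψ y p)
        have h1 : ∀ j, ∀ b : Fin l, (b : ℕ) < c → y' (j, b) = y (j, b) := fun j b hb => by
          simp [y', hy j b hb]
        refine ⟨y', fun j b hb => ?_⟩
        rw [perturb, coeff_X_mul_eval_congr Ψ h1 j hb]
        simp only [y', perturb]
        ring
    obtain ⟨y, hy⟩ := key l
    exact ⟨y, funext fun ⟨j, b⟩ => hy j b b.2⟩

theorem X_pow_dvd_jetPoly_perturb (Ψ : Fin N → MvPolynomial (Fin N) R[X]) (y : Fin N × Fin l → R)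
    (j : Fin N) : Polynomial.X ^ l ∣ jetPoly (perturb Ψ y) j -
      (jetPoly y j + Polynomial.X * MvPolynomial.eval (jetPoly y) (Ψ j)) := by
  rw [Polynomial.X_pow_dvd_iff]
  intro b hb
  have h1 := coeff_jetPoly y j ⟨b, hb⟩
  have h2 := coeff_jetPoly (perturb Ψ y) j ⟨b, hb⟩
  simp only at h1 h2
  rw [Polynomial.coeff_sub, Polynomial.coeff_add, h1, h2, perturb, sub_self]

variable {m : ℕ}

theorem sum_mul_add_add (T p r : Fin N → R) (W : Fin N → Fin m → R) (E : Fin m → R) (x z : R) :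
    ∑ j, T j * (p j + x * ∑ i, W j i * E i + z * r j) =
      ∑ j, T j * p j + x * ∑ i, (∑ j, T j * W j i) * E i + z * ∑ j, T j * r j := by
  have h1 : ∑ i, (∑ j, T j * W j i) * E i = ∑ j, T j * ∑ i, W j i * E i := by
    simp only [Finset.sum_mul, Finset.mul_sum, mul_assoc]
    exact Finset.sum_comm
  rw [h1, Finset.mul_sum, Finset.mul_sum, ← Finset.sum_add_distrib, ← Finset.sum_add_distrib]
  refine Finset.sum_congr rfl fun j _ => ?_
  ring

/-- If `T * W = t ^ e` modulo high powers of `t`, with `T` the linear part of the system, and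
`s = e + 1`, then `t ^ (2 * s) * Q y = t ^ s * T (t * W Q y)`, so that the substitution
`w = y + t * W Q y` linearizes the system. -/
theorem isJetSol_iff_linear {n s e : ℕ} (hs : s = e + 1) (hl : s + l = n + 1)
    (G Q : Fin m → MvPolynomial (Fin N) R[X]) (W : Fin N → Fin m → R[X])
    (hQ : ∀ (p : Fin N → R[X]) (i : Fin m),
      MvPolynomial.eval (fun j => Polynomial.X ^ s * p j) (G i) =
        constPart G i + Polynomial.X ^ s * ∑ j, linearPart G i j * p j +
          Polynomial.X ^ (2 * s) * MvPolynomial.eval p (Q i))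
    (hW : ∀ i i', Polynomial.X ^ (n + 1) ∣ Polynomial.X ^ (s + 1) *
      (∑ j, linearPart G i j * W j i' - if i = i' then Polynomial.X ^ e else 0))
    (y : Fin N × Fin l → R) :
    IsJetSol n s G y ↔ ∀ i, Polynomial.X ^ (n + 1) ∣ constPart G i + Polynomial.X ^ s * ∑ j,
      linearPart G i j * jetPoly (perturb (fun j => ∑ i', MvPolynomial.C (W j i') * Q i') y) j := by
  refine forall_congr' fun i => ?_
  rw [hQ]
  set Ψ : Fin N → MvPolynomial (Fin N) R[X] := fun j => ∑ i', MvPolynomial.C (W j i') * Q i'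
  refine (dvd_iff_dvd_of_dvd_sub ?_)
  choose r hr using X_pow_dvd_jetPoly_perturb Ψ y
  have h1 : ∀ j, jetPoly (perturb Ψ y) j = jetPoly y j + Polynomial.X * ∑ i', W j i' *
      MvPolynomial.eval (jetPoly y) (Q i') + Polynomial.X ^ l * r j := by
    intro j
    rw [← hr j]
    simp [Ψ]
  have h2 : Polynomial.X ^ (2 * s) * MvPolynomial.eval (jetPoly y) (Q i) =
      Polynomial.X ^ (s + 1) * ∑ i', (if i = i' then Polynomial.X ^ e else 0) *
        MvPolynomial.eval (jetPoly y) (Q i') := by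
    simp only [ite_mul, zero_mul, Finset.sum_ite_eq, Finset.mem_univ, if_true]
    rw [← mul_assoc, ← pow_add]
    congr 2
    omega
  have h3 : ∑ j, linearPart G i j * jetPoly (perturb Ψ y) j = ∑ j, linearPart G i j * jetPoly y j +
      Polynomial.X * ∑ i', (∑ j, linearPart G i j * W j i') * MvPolynomial.eval (jetPoly y) (Q i') +
      Polynomial.X ^ l * ∑ j, linearPart G i j * r j := by
    simp only [h1]
    exact sum_mul_add_add _ _ _ _ _ _ _
  have h4 : constPart G i + Polynomial.X ^ s * ∑ j, linearPart G i j * jetPoly y j +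
      Polynomial.X ^ (2 * s) * MvPolynomial.eval (jetPoly y) (Q i) - (constPart G i +
        Polynomial.X ^ s * ∑ j, linearPart G i j * jetPoly (perturb Ψ y) j) =
      - (∑ i', Polynomial.X ^ (s + 1) * (∑ j, linearPart G i j * W j i' -
        if i = i' then Polynomial.X ^ e else 0) * MvPolynomial.eval (jetPoly y) (Q i')) -
      Polynomial.X ^ (n + 1) * ∑ j, linearPart G i j * r j := by
    rw [h2, h3, ← hl]
    simp only [mul_sub, sub_mul, Finset.sum_sub_distrib, mul_assoc, ← Finset.mul_sum]
    ring
  rw [h4]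
  refine dvd_sub (dvd_neg.mpr (Finset.dvd_sum fun i' _ => (hW i i').mul_right _)) (dvd_mul_right _ _)

end Perturb

section LinearSystem

variable {A R : Type u} [CommRing A] [CommRing R] {m N l : ℕ}

/-- The coefficient matrix of the linear map `w ↦ T * w` on vectors of polynomials modulo `t ^ l`. It
is made square by adding `N - m` zero rows for each degree, as the normal form by rank is available
for square matrices. -/
noncomputable def toeplitz (T : Fin m → Fin N → A[X]) :
    Matrix (Fin N × Fin l) (Fin N × Fin l) A := fun p q =>
  if h : (p.1 : ℕ) < m then (Polynomial.X ^ (q.2 : ℕ) * T ⟨p.1, h⟩ q.1).coeff p.2 else 0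

/-- The coefficients of `c` in degrees `s, …, s + l - 1`, extended by zero. -/
noncomputable def shiftedCoeff (s : ℕ) (c : Fin m → A[X]) (p : Fin N × Fin l) : A :=
  if h : (p.1 : ℕ) < m then (c ⟨p.1, h⟩).coeff (s + p.2) else 0

open Matrix in
theorem toeplitz_mulVec (T : Fin m → Fin N → A[X]) (w : Fin N × Fin l → A) (p : Fin N × Fin l) :
    (toeplitz T *ᵥ w) p = if h : (p.1 : ℕ) < m then
      (∑ j, T ⟨p.1, h⟩ j * jetPoly w j).coeff p.2 else 0 := by
  rw [Matrix.mulVec, dotProduct]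
  split_ifs with h
  · rw [Fintype.sum_prod_type, Polynomial.finsetSum_coeff]
    refine Finset.sum_congr rfl fun j _ => ?_
    rw [jetPoly, Finset.mul_sum, Polynomial.finsetSum_coeff]
    refine Finset.sum_congr rfl fun b _ => ?_
    rw [toeplitz, dif_pos h, ← Polynomial.coeff_mul_C]
    congr 1
    ring
  · exact Finset.sum_eq_zero fun q _ => by rw [toeplitz, dif_neg h, zero_mul]

open Matrix in
/-- A linear congruence modulo `t ^ (s + l)` as a condition on the constants in degrees below `s` and
a linear system in degrees `s, …, s + l - 1`. The zero rows need `m ≤ N`. -/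
theorem linear_iff_toeplitz {n s : ℕ} (hl : s + l = n + 1) (hm : m ≤ N) (c : Fin m → A[X])
    (T : Fin m → Fin N → A[X]) (w : Fin N × Fin l → A) :
    (∀ i, Polynomial.X ^ (n + 1) ∣ c i + Polynomial.X ^ s * ∑ j, T i j * jetPoly w j) ↔
      (∀ i, ∀ b < s, (c i).coeff b = 0) ∧ toeplitz T *ᵥ w + shiftedCoeff s c = 0 := by
  simp only [Polynomial.X_pow_dvd_iff, Polynomial.coeff_add, Polynomial.coeff_X_pow_mul']
  constructor
  · intro h
    refine ⟨fun i b hb => ?_, ?_⟩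
    · have := h i b (by omega)
      rwa [if_neg (by omega), add_zero] at this
    · funext p
      rw [Pi.add_apply, toeplitz_mulVec, shiftedCoeff]
      split_ifs with hp
      · have := h ⟨p.1, hp⟩ (s + p.2) (by have := p.2.2; omega)
        rw [if_pos (by omega), Nat.add_sub_cancel_left] at this
        rw [add_comm]
        exact this
      · exact add_zero _
  · rintro ⟨h1, h2⟩ i b hb
    by_cases hbs : b < s
    · rw [h1 i b hbs, if_neg (by omega), add_zero]
    · have h3 := congrFun h2 (⟨i, by have := i.2; omega⟩, ⟨b - s, by omega⟩)
      rw [Pi.add_apply, toeplitz_mulVec, shiftedCoeff, dif_pos i.2, dif_pos i.2] at h3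
      rw [if_pos (by omega), add_comm]
      simpa [Nat.add_sub_cancel' (Nat.le_of_not_lt hbs)] using h3

theorem map_toeplitz (φ : A →+* R) (T : Fin m → Fin N → A[X]) :
    (toeplitz (l := l) T).map φ = toeplitz (fun i j => (T i j).map φ) := by
  ext p q
  simp only [Matrix.map_apply, toeplitz]
  split_ifs with h
  · rw [← Polynomial.coeff_map]; simp
  · exact map_zero φ

theorem map_shiftedCoeff (φ : A →+* R) (s : ℕ) (c : Fin m → A[X]) (p : Fin N × Fin l) :
    φ (shiftedCoeff s c p) = shiftedCoeff s (fun i => (c i).map φ) p := by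
  simp only [shiftedCoeff]
  split_ifs with h
  · rw [Polynomial.coeff_map]
  · exact map_zero φ

end LinearSystem

/-! ### Linear systems of constant rank -/

section MatrixArguments

open Matrix

section Represents

/-- The `A`-algebra `B` represents the functor `P` of families indexed by `σ`, with universal
family `b`. -/
structure Represents {A : Type u} [CommRing A] {σ : Type}
    (P : ∀ (R : Type u) [CommRing R] [Algebra A R], (σ → R) → Prop)
    (B : Type u) [CommRing B] [Algebra A B] (b : σ → B) : Prop where
  mem : P B b
  hom_ext : ∀ (R : Type u) [CommRing R] [Algebra A R] (f g : B →ₐ[A] R),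
    (∀ p, f (b p) = g (b p)) → f = g
  lift : ∀ (R : Type u) [CommRing R] [Algebra A R] (w : σ → R), P R w →
    ∃ f : B →ₐ[A] R, ∀ p, f (b p) = w p

theorem Represents.nonempty_algEquiv {A : Type u} [CommRing A] {σ : Type}
    {P : ∀ (R : Type u) [CommRing R] [Algebra A R], (σ → R) → Prop}
    {B C : Type u} [CommRing B] [Algebra A B] [CommRing C] [Algebra A C] {b : σ → B} {c : σ → C}
    (hB : Represents P B b) (hC : Represents P C c) : Nonempty (B ≃ₐ[A] C) := by
  obtain ⟨f, hf⟩ := hB.lift C c hC.mem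
  obtain ⟨g, hg⟩ := hC.lift B b hB.mem
  exact ⟨AlgEquiv.ofAlgHom f g (hC.hom_ext _ _ _ fun p => by simp [hf, hg])
    (hB.hom_ext _ _ _ fun p => by simp [hf, hg])⟩

variable {A : Type u} [CommRing A]

/-- If the substitution `w = y + t * Ψ y` turns a system into the equations `P`, then `SolAlg`
represents `P`. -/
theorem represents_perturb {m N l n s : ℕ} {G : Fin m → MvPolynomial (Fin N) A[X]}
    (P : ∀ (R : Type u) [CommRing R] [Algebra A R], (Fin N × Fin l → R) → Prop)
    (Ψ : Fin N → MvPolynomial (Fin N) A[X])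
    (hP : ∀ (R : Type u) [CommRing R] [Algebra A R] (y : Fin N × Fin l → R),
      IsJetSol n s (baseChange (algebraMap A R) G) y ↔
        P R (perturb (baseChange (algebraMap A R) Ψ) y)) :
    Represents P (SolAlg n s l G)
      (perturb (baseChange (algebraMap A _) Ψ) (solPoint n s l G)) where
  mem := (hP _ _).mp isJetSol_solPoint
  hom_ext R _ _ f g h := by
    apply solAlg_hom_ext
    have h1 : ∀ (f : SolAlg n s l G →ₐ[A] R) p,
        f (perturb (baseChange (algebraMap A _) Ψ) (solPoint n s l G) p) =
          perturb (baseChange (algebraMap A R) Ψ) (fun q => f (solPoint n s l G q)) p := by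
      intro f p
      have := map_perturb (f : SolAlg n s l G →+* R) (baseChange (algebraMap A _) Ψ)
        (solPoint n s l G) p
      rwa [baseChange_comp, f.comp_algebraMap] at this
    have h2 : perturb (baseChange (algebraMap A R) Ψ) (fun q => f (solPoint n s l G q)) =
        perturb (baseChange (algebraMap A R) Ψ) (fun q => g (solPoint n s l G q)) :=
      funext fun p => by rw [← h1, ← h1, h]
    exact congrFun ((perturb_bijective _).1 h2)
  lift R _ _ w hw := by
    obtain ⟨y, rfl⟩ := (perturb_bijective (baseChange (algebraMap A R) Ψ)).2 w
    have hy := (hP R y).mpr hw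
    refine ⟨solLift y hy, fun p => ?_⟩
    have := map_perturb (solLift y hy : SolAlg n s l G →+* R) (baseChange (algebraMap A _) Ψ)
      (solPoint n s l G) p
    rw [baseChange_comp, (solLift y hy).comp_algebraMap] at this
    refine this.trans ?_
    congr 1
    exact funext fun q => solLift_solPoint y hy q

end Represents

section NormalForm

variable {A R : Type u} [CommRing A] [CommRing R] {σ ι₁ ι₂ : Type} [Fintype σ]
  [Fintype ι₁] [DecidableEq ι₁] [Fintype ι₂]

theorem map_mulVec_algebraMap [Algebra A R] (M : Matrix σ σ A) (β : σ → A) (p : σ) :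
    (M.map (algebraMap A R) *ᵥ fun p => algebraMap A R (β p)) p = algebraMap A R ((M *ᵥ β) p) :=
  (RingHom.map_mulVec (algebraMap A R) M β p).symm

/-- A linear system together with conditions on the base: `a = 0` for `a ∈ s`. -/
def IsLinearSol (s : Set A) (M : Matrix σ σ A) (β : σ → A) (R : Type u) [CommRing R] [Algebra A R]
    (w : σ → R) : Prop :=
  (∀ a ∈ s, algebraMap A R a = 0) ∧
    M.map (algebraMap A R) *ᵥ w + (fun p => algebraMap A R (β p)) = 0

variable [DecidableEq σ]

/-- The solutions of a linear system whose matrix is equivalent to a diagonal projection. -/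
theorem mulVec_add_eq_zero_iff (e : σ ≃ ι₁ ⊕ ι₂) {M V V' U U' : Matrix σ σ R}
    (hV : V' * V = 1) (hU : U * U' = 1)
    (hM : V * M * U = (fromBlocks (1 : Matrix ι₁ ι₁ R) 0 0 (0 : Matrix ι₂ ι₂ R)).submatrix e e)
    (w β : σ → R) : M *ᵥ w + β = 0 ↔ (∀ i, (U' *ᵥ w) (e.symm (Sum.inl i)) =
      -(V *ᵥ β) (e.symm (Sum.inl i))) ∧ ∀ i, (V *ᵥ β) (e.symm (Sum.inr i)) = 0 := by
  have h1 : M *ᵥ w + β = 0 ↔ V *ᵥ (M *ᵥ w + β) = 0 := by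
    refine ⟨fun h => by rw [h, mulVec_zero], fun h => ?_⟩
    have := congrArg (fun v => V' *ᵥ v) h
    simpa only [mulVec_mulVec, hV, one_mulVec, mulVec_zero] using this
  have h2 : V *ᵥ (M *ᵥ w + β) = (V * M * U) *ᵥ (U' *ᵥ w) + V *ᵥ β := by
    rw [mulVec_add, mulVec_mulVec, mulVec_mulVec, mul_assoc (V * M), hU, mul_one]
  rw [h1, h2, hM, submatrix_mulVec_equiv, fromBlocks_mulVec, funext_iff, e.forall_congr_left,
    Sum.forall]
  simp [add_eq_zero_iff_eq_neg]

/-- A linear system of constant rank is represented by a polynomial ring over a quotient of the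
base. -/
theorem exists_represents_isLinearSol (s : Set A) (e : σ ≃ ι₁ ⊕ ι₂) {M V V' U U' : Matrix σ σ A}
    (hV : V' * V = 1) (hU : U * U' = 1)
    (hM : V * M * U = (fromBlocks (1 : Matrix ι₁ ι₁ A) 0 0 (0 : Matrix ι₂ ι₂ A)).submatrix e e)
    (β : σ → A) : ∃ (J : Ideal A) (b : σ → MvPolynomial ι₂ (A ⧸ J)),
      Represents (IsLinearSol s M β) (MvPolynomial ι₂ (A ⧸ J)) b := by
  let J : Ideal A := Ideal.span (s ∪ Set.range fun i => (V *ᵥ β) (e.symm (Sum.inr i)))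
  let B := MvPolynomial ι₂ (A ⧸ J)
  let x : σ → B := fun p => Sum.elim
    (fun i => -algebraMap A B ((V *ᵥ β) (e.symm (Sum.inl i)))) MvPolynomial.X (e p)
  have hU1 : U' * U = 1 := mul_eq_one_comm.mp hU
  have key : ∀ (R : Type u) [CommRing R] [Algebra A R] (w : σ → R), IsLinearSol s M β R w ↔
      (∀ a ∈ J, algebraMap A R a = 0) ∧ ∀ i, (U'.map (algebraMap A R) *ᵥ w) (e.symm (Sum.inl i)) =
        -algebraMap A R ((V *ᵥ β) (e.symm (Sum.inl i))) := by
    intro R _ _ w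
    have hVR : V'.map (algebraMap A R) * V.map (algebraMap A R) = 1 := by
      rw [← Matrix.map_mul, hV]; simp
    have hUR : U.map (algebraMap A R) * U'.map (algebraMap A R) = 1 := by
      rw [← Matrix.map_mul, hU]; simp
    have hMR : V.map (algebraMap A R) * M.map (algebraMap A R) * U.map (algebraMap A R) =
        (fromBlocks (1 : Matrix ι₁ ι₁ R) 0 0 (0 : Matrix ι₂ ι₂ R)).submatrix e e := by
      rw [← Matrix.map_mul, ← Matrix.map_mul, hM, ← Matrix.submatrix_map, fromBlocks_map]
      simp
    rw [IsLinearSol, mulVec_add_eq_zero_iff e hVR hUR hMR]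
    simp only [map_mulVec_algebraMap]
    have hJ : (∀ a ∈ J, algebraMap A R a = 0) ↔ (∀ a ∈ s, algebraMap A R a = 0) ∧
        ∀ i, algebraMap A R ((V *ᵥ β) (e.symm (Sum.inr i))) = 0 := by
      constructor
      · intro h
        exact ⟨fun a ha => h a (Ideal.subset_span (Or.inl ha)),
          fun i => h _ (Ideal.subset_span (Or.inr ⟨i, rfl⟩))⟩
      · rintro ⟨h1, h2⟩ a ha
        refine (Ideal.span_le (I := RingHom.ker (algebraMap A R)).mpr ?_) ha
        rintro _ (ha | ⟨i, rfl⟩)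
        · exact h1 _ ha
        · exact h2 i
    rw [hJ]
    tauto
  have hx : ∀ (R : Type u) [CommRing R] [Algebra A R] (f : B →ₐ[A] R) p,
      f ((U.map (algebraMap A B) *ᵥ x) p) = (U.map (algebraMap A R) *ᵥ fun q => f (x q)) p := by
    intro R _ _ f p
    refine (RingHom.map_mulVec (f : B →+* R) _ x p).trans ?_
    have : (U.map (algebraMap A B)).map (f : B →+* R) = U.map (algebraMap A R) := by
      ext; simp
    rw [this]
    rfl
  refine ⟨J, U.map (algebraMap A B) *ᵥ x, ⟨?_, ?_, ?_⟩⟩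
  · rw [key]
    refine ⟨fun a ha => ?_, fun i => ?_⟩
    · rw [IsScalarTower.algebraMap_apply A (A ⧸ J) B, Ideal.Quotient.algebraMap_eq,
        Ideal.Quotient.eq_zero_iff_mem.mpr ha, map_zero]
    · rw [mulVec_mulVec, ← Matrix.map_mul, hU1, Matrix.map_one _ (map_zero _) (map_one _),
        one_mulVec]
      simp only [x, Equiv.apply_symm_apply, Sum.elim_inl]
      rfl
  · intro R _ _ f g h
    have h1 : ∀ q, f (x q) = g (x q) := by
      have h2 : (U.map (algebraMap A R) *ᵥ fun q => f (x q)) =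
          U.map (algebraMap A R) *ᵥ fun q => g (x q) :=
        funext fun p => by rw [← hx, ← hx, h]
      have h3 := congrArg (fun v => U'.map (algebraMap A R) *ᵥ v) h2
      simp only [mulVec_mulVec, ← Matrix.map_mul, hU1] at h3
      simpa using congrFun (by simpa using h3)
    have h4 : (f : B →+* R) = (g : B →+* R) := by
      refine MvPolynomial.ringHom_ext' (Ideal.Quotient.ringHom_ext ?_) fun i => ?_
      · ext a
        exact (f.commutes a).trans (g.commutes a).symm
      · simpa [x] using h1 (e.symm (Sum.inr i))
    exact AlgHom.ext fun a => congrArg (fun t => t a) h4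
  · intro R _ _ w hw
    obtain ⟨h1, h2⟩ := (key R w).mp hw
    let θ : A ⧸ J →+* R := Ideal.Quotient.lift J (algebraMap A R) h1
    let f : B →ₐ[A] R :=
      { MvPolynomial.eval₂Hom θ fun i => (U'.map (algebraMap A R) *ᵥ w) (e.symm (Sum.inr i)) with
        commutes' := fun a => by
          change MvPolynomial.eval₂Hom θ _ (MvPolynomial.C (Ideal.Quotient.mk J a)) = _
          rw [MvPolynomial.eval₂Hom_C]
          rfl }
    refine ⟨f, fun p => ?_⟩
    rw [hx]
    have h3 : (fun q => f (x q)) = U'.map (algebraMap A R) *ᵥ w := by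
      funext q
      obtain ⟨q, rfl⟩ := e.symm.surjective q
      rcases q with i | i
      · simp only [x, Equiv.apply_symm_apply, Sum.elim_inl, map_neg, AlgHom.commutes, h2]
      · simp only [x, Equiv.apply_symm_apply, Sum.elim_inr]
        exact MvPolynomial.eval₂Hom_X' _ _ _
    rw [h3, mulVec_mulVec, ← Matrix.map_mul, hU]
    simp

end NormalForm

/-- A system which can be linearized, and whose linear part has constant rank, has a polynomial ring
as its solution algebra. -/
theorem lefschetzDvd_solAlg_of_linear {k : Type u} [Field k] [IsAlgClosed k] {A : Type u}
    [CommRing A] [Algebra k A] [Algebra.FiniteType k A] {m N l n s e d : ℕ} (hs : s = e + 1)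
    (hl : s + l = n + 1) (hm : m ≤ N) (G : Fin m → MvPolynomial (Fin N) A[X])
    (W : Fin N → Fin m → A[X])
    (hW : ∀ i i', Polynomial.X ^ (n + 1) ∣ Polynomial.X ^ (s + 1) *
      (∑ j, linearPart G i j * W j i' - if i = i' then Polynomial.X ^ e else 0))
    {ι₁ ι₂ : Type} [Fintype ι₁] [DecidableEq ι₁] [Fintype ι₂]
    (ε : Fin N × Fin l ≃ ι₁ ⊕ ι₂) {V V' U U' : Matrix (Fin N × Fin l) (Fin N × Fin l) A}
    (hV : V' * V = 1) (hU : U * U' = 1)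
    (hM : V * toeplitz (linearPart G) * U =
      (fromBlocks (1 : Matrix ι₁ ι₁ A) 0 0 (0 : Matrix ι₂ ι₂ A)).submatrix ε ε)
    (hd : d ≤ Fintype.card ι₂) : LefschetzDvd k d (SolAlg n s l G) := by
  obtain ⟨Q, hQ⟩ := exists_taylor s G
  let S : Set A := {a | ∃ i, ∃ b < s, a = (constPart G i).coeff b}
  obtain ⟨J, b, hb⟩ := exists_represents_isLinearSol S ε hV hU hM (shiftedCoeff s (constPart G))
  let Ψ : Fin N → MvPolynomial (Fin N) A[X] := fun j => ∑ i', MvPolynomial.C (W j i') * Q i'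
  have h1 := represents_perturb (n := n) (s := s) (G := G)
    (IsLinearSol S (toeplitz (linearPart G)) (shiftedCoeff s (constPart G))) Ψ (by
    intro R _ _ y
    have hWR : ∀ i i', Polynomial.X ^ (n + 1) ∣ Polynomial.X ^ (s + 1) *
        (∑ j, linearPart (baseChange (algebraMap A R) G) i j * (W j i').map (algebraMap A R) -
          if i = i' then Polynomial.X ^ e else 0) := by
      intro i i'
      have := map_dvd (Polynomial.mapRingHom (algebraMap A R)) (hW i i')
      simpa [linearPart_baseChange, apply_ite, Polynomial.map_sum] using this
    rw [isJetSol_iff_linear hs hl _ (baseChange (algebraMap A R) Q) _ (hQ R (algebraMap A R)) hWR,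
      linear_iff_toeplitz hl hm]
    have hΨ : (fun j => ∑ i', MvPolynomial.C ((W j i').map (algebraMap A R)) *
        baseChange (algebraMap A R) Q i') = baseChange (algebraMap A R) Ψ := by
      funext j
      simp [Ψ, baseChange]
    rw [hΨ, IsLinearSol, map_toeplitz]
    simp only [constPart_baseChange, Polynomial.coeff_map, map_shiftedCoeff]
    refine and_congr ?_ (Eq.congr (congrArg₂ _ (congrArg₂ _ (congrArg _ ?_) rfl)
      (congrArg _ ?_)) rfl)
    · constructor
      · rintro h _ ⟨i, b, hb, rfl⟩
        exact h i b hb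
      · intro h i b hb
        exact h _ ⟨i, b, hb, rfl⟩
    · funext i j
      exact linearPart_baseChange _ _ _ _
    · funext i
      exact constPart_baseChange _ _ _)
  obtain ⟨E⟩ := hb.nonempty_algEquiv h1
  exact (lefschetzDvd_mvPolynomial (A ⧸ J) ι₂ hd).of_algEquiv (E.restrictScalars k)

/-! ### Linear parts over a field, and spreading out -/

section Relation

variable {R S : Type u} [CommRing R] [CommRing S] {m N : ℕ}

/-- The rows of `T` satisfy a linear relation modulo `t ^ e`, one of whose coefficients has constant
term `1`. -/
def HasRelation (e : ℕ) (T : Fin m → Fin N → R[X]) : Prop :=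
  ∃ u : Fin m → R[X], (∀ j, Polynomial.X ^ e ∣ ∑ i, u i * T i j) ∧ ∃ i, (u i).coeff 0 = 1

theorem HasRelation.map {e : ℕ} {T : Fin m → Fin N → R[X]} (h : HasRelation e T) (φ : R →+* S) :
    HasRelation e (fun i j => (T i j).map φ) := by
  obtain ⟨u, hu, i, hi⟩ := h
  refine ⟨fun i => (u i).map φ, fun j => ?_, i, ?_⟩
  · have := map_dvd (Polynomial.mapRingHom φ) (hu j)
    simpa [Polynomial.map_sum] using this
  · rw [Polynomial.coeff_map, hi, map_one]

theorem HasRelation.congr {e : ℕ} {T T' : Fin m → Fin N → R[X]} (h : HasRelation e T)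
    (hT : ∀ i j, Polynomial.X ^ e ∣ T' i j - T i j) : HasRelation e T' := by
  obtain ⟨u, hu, hi⟩ := h
  refine ⟨u, fun j => ?_, hi⟩
  have : ∑ i, u i * T' i j = ∑ i, u i * T i j + ∑ i, u i * (T' i j - T i j) := by
    rw [← Finset.sum_add_distrib]
    exact Finset.sum_congr rfl fun i _ => by ring
  rw [this]
  exact dvd_add (hu j) (Finset.dvd_sum fun i _ => (hT i j).mul_left _)

theorem C_X_pow_dvd_shiftSystem_sub (s : ℕ) (G : Fin m → MvPolynomial (Fin N) R[X]) (i : Fin m) :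
    (MvPolynomial.C (Polynomial.X ^ s) : MvPolynomial (Fin N) (MvPolynomial (Fin N) R)[X]) ∣
      shiftSystem s G i - baseChange MvPolynomial.C G i := by
  rw [shiftSystem, baseChange]
  generalize G i = g
  induction g using MvPolynomial.induction_on with
  | C a => simp
  | add p q hp hq =>
    rw [MvPolynomial.eval₂_add, map_add]
    refine (dvd_add hp hq).trans (dvd_of_eq ?_)
    ring
  | mul_X p j hp =>
    rw [MvPolynomial.eval₂_mul, map_mul, MvPolynomial.eval₂_X, MvPolynomial.map_X]
    obtain ⟨r, hr⟩ := hp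
    rw [sub_eq_iff_eq_add] at hr
    rw [hr]
    refine ⟨r * (MvPolynomial.C (Polynomial.X ^ s) *
      MvPolynomial.C (Polynomial.C (MvPolynomial.X j)) + MvPolynomial.X j) +
        MvPolynomial.map (Polynomial.mapRingHom MvPolynomial.C) p *
          MvPolynomial.C (Polynomial.C (MvPolynomial.X j)), ?_⟩
    rw [MvPolynomial.C_mul]
    ring

/-- Modulo `t ^ s`, shifting the origin by a multiple of `t ^ s` does not change the linear part. -/
theorem X_pow_dvd_linearPart_shiftSystem_sub (s : ℕ) (G : Fin m → MvPolynomial (Fin N) R[X])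
    (i : Fin m) (j : Fin N) : Polynomial.X ^ s ∣
      linearPart (shiftSystem s G) i j - (linearPart G i j).map MvPolynomial.C := by
  have := (MvPolynomial.C_dvd_iff_dvd_coeff _ _).mp (C_X_pow_dvd_shiftSystem_sub s G i)
    (Finsupp.single j 1)
  rwa [MvPolynomial.coeff_sub, baseChange, MvPolynomial.coeff_map] at this

end Relation

section Field

variable {K : Type u} [Field K] {m N l : ℕ}

/-- Over a field, either `T * W = t ^ e` modulo `t ^ (e + 1)` is solvable, or the rows of `T` satisfy
a relation modulo `t ^ (e + 1)`: a functional on `K[t] ^ m` which vanishes on the image of `T` and on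
`t ^ (e + 1)` but not on some `t ^ e * e_i` consists of the coefficients of such a relation. -/
theorem exists_inverse_or_hasRelation (e : ℕ) (T : Fin m → Fin N → K[X]) :
    (∃ W : Fin N → Fin m → K[X], ∀ i i', Polynomial.X ^ (e + 1) ∣
      ∑ j, T i j * W j i' - if i = i' then Polynomial.X ^ e else 0) ∨ HasRelation (e + 1) T := by
  let U : Submodule K (Fin m → K[X]) :=
    { carrier := {v | ∃ p : Fin N → K[X], ∀ i, Polynomial.X ^ (e + 1) ∣ ∑ j, T i j * p j - v i}
      add_mem' := by
        rintro v w ⟨p, hp⟩ ⟨q, hq⟩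
        refine ⟨p + q, fun i => ?_⟩
        have := dvd_add (hp i) (hq i)
        rw [← add_sub_add_comm, ← Finset.sum_add_distrib] at this
        simpa only [Pi.add_apply, mul_add] using this
      zero_mem' := ⟨0, fun i => by simp⟩
      smul_mem' := by
        rintro c v ⟨p, hp⟩
        refine ⟨c • p, fun i => ?_⟩
        have := (hp i).mul_left (Polynomial.C c)
        rw [mul_sub, Finset.mul_sum] at this
        simp only [Pi.smul_apply, Polynomial.smul_eq_C_mul]
        convert this using 3
        ring }
  by_cases h : ∀ i', (Pi.single i' (Polynomial.X ^ e) : Fin m → K[X]) ∈ U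
  · left
    choose W hW using h
    refine ⟨fun j i' => W i' j, fun i i' => ?_⟩
    have := hW i' i
    rwa [Pi.single_apply] at this
  · right
    push Not at h
    obtain ⟨i₀, hi₀⟩ := h
    obtain ⟨φ₀, hφ₀, hU₀⟩ := Submodule.exists_le_ker_of_notMem hi₀
    let φ := (φ₀ (Pi.single i₀ (Polynomial.X ^ e)))⁻¹ • φ₀
    have hφ : φ (Pi.single i₀ (Polynomial.X ^ e)) = 1 := inv_mul_cancel₀ hφ₀
    have hU : ∀ v ∈ U, φ v = 0 := fun v hv => by
      have : φ₀ v = 0 := hU₀ hv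
      simp [φ, this]
    have hhigh : ∀ v : Fin m → K[X], (∀ i, Polynomial.X ^ (e + 1) ∣ v i) → φ v = 0 := fun v hv =>
      hU v ⟨0, fun i => by simpa using hv i⟩
    let u : Fin m → K[X] := fun i => ∑ a ∈ Finset.range (e + 1),
      Polynomial.C (φ (Pi.single i (Polynomial.X ^ (e - a)))) * Polynomial.X ^ a
    have hu : ∀ i, ∀ a < e + 1, (u i).coeff a = φ (Pi.single i (Polynomial.X ^ (e - a))) := by
      intro i a ha
      simp only [u, Polynomial.finsetSum_coeff, Polynomial.coeff_C_mul, Polynomial.coeff_X_pow]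
      simp [ha]
    -- The coefficient of `t ^ c` in `p * u i` is the value of `φ` at `t ^ (e - c) * p * e_i`.
    have key : ∀ (p : K[X]) (i : Fin m) (c : ℕ), c < e + 1 →
        (p * u i).coeff c = φ (Pi.single i (p * Polynomial.X ^ (e - c))) := by
      intro p i c hc
      induction p using Polynomial.induction_on' with
      | add p q hp hq => rw [add_mul, Polynomial.coeff_add, hp, hq, add_mul, Pi.single_add, map_add]
      | monomial b x =>
        rw [← Polynomial.C_mul_X_pow_eq_monomial, mul_assoc, mul_assoc, ← pow_add,
          Polynomial.coeff_C_mul, ← Polynomial.smul_eq_C_mul, Pi.single_smul, map_smul,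
          smul_eq_mul, Polynomial.coeff_X_pow_mul']
        congr 1
        split_ifs with hb
        · rw [hu _ _ (by omega)]
          congr 3
          omega
        · refine (hhigh _ fun i' => ?_).symm
          rw [Pi.single_apply]
          split_ifs
          · exact pow_dvd_pow _ (by omega)
          · exact dvd_zero _
    refine ⟨u, fun j => ?_, i₀, ?_⟩
    · rw [Polynomial.X_pow_dvd_iff]
      intro c hc
      rw [Polynomial.finsetSum_coeff]
      simp only [mul_comm (u _), key _ _ c hc]
      rw [← map_sum, Finset.univ_sum_single]
      refine hU _ ⟨Pi.single j (Polynomial.X ^ (e - c)), fun i => ?_⟩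
      simp [Pi.single_apply]
    · rw [hu _ _ (by omega), Nat.sub_zero, hφ]

/-- A Nakayama argument improves an inverse up to `t ^ e` modulo `t ^ (e + 1)` to any order. -/
theorem exists_inverse_of_le {R : Type u} [CommRing R] {e : ℕ} {T : Fin m → Fin N → R[X]}
    {W : Fin N → Fin m → R[X]} (hW : ∀ i i', Polynomial.X ^ (e + 1) ∣
      ∑ j, T i j * W j i' - if i = i' then Polynomial.X ^ e else 0) (n : ℕ) :
    ∃ W' : Fin N → Fin m → R[X], ∀ i i', Polynomial.X ^ n ∣
      ∑ j, T i j * W' j i' - if i = i' then Polynomial.X ^ e else 0 := by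
  choose Y hY using hW
  let T₁ : Matrix (Fin m) (Fin N) R[X] := Matrix.of T
  let W₁ : Matrix (Fin N) (Fin m) R[X] := Matrix.of W
  let Y₁ : Matrix (Fin m) (Fin m) R[X] := -((Polynomial.X : R[X]) • Matrix.of Y)
  have h1 : T₁ * W₁ = (Polynomial.X : R[X]) ^ e • (1 - Y₁) := by
    ext1 i i'
    have := hY i i'
    rw [sub_eq_iff_eq_add] at this
    simp only [T₁, W₁, Y₁, mul_apply, of_apply, this, Matrix.smul_apply, Matrix.sub_apply,
      Matrix.neg_apply, one_apply,
      smul_eq_mul, mul_sub, mul_ite, mul_one, mul_zero]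
    ring
  let Z := ∑ a ∈ Finset.range n, Y₁ ^ a
  have h2 : T₁ * (W₁ * Z) = (Polynomial.X : R[X]) ^ e • (1 - Y₁ ^ n) := by
    rw [← Matrix.mul_assoc, h1, Matrix.smul_mul, mul_neg_geom_sum]
  refine ⟨fun j i => (W₁ * Z) j i, fun i i' => ?_⟩
  have h3 := congrFun (congrFun h2 i) i'
  have h4 : Y₁ ^ n = (Polynomial.X : R[X]) ^ n • (-Matrix.of Y) ^ n := by
    rw [← smul_pow, smul_neg]
  have h5 : ∑ j, T i j * (W₁ * Z) j i' = (T₁ * (W₁ * Z)) i i' := by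
    rw [mul_apply]; rfl
  rw [h5, h3, h4]
  refine ⟨-(Polynomial.X ^ e * ((-Matrix.of Y) ^ n) i i'), ?_⟩
  simp only [Matrix.smul_apply, Matrix.sub_apply, one_apply, smul_eq_mul, mul_sub, mul_ite, mul_one,
    mul_zero]
  ring

/-- If the coordinates `g p` separate the vectors in the image of `M`, they bound its rank. -/
theorem rank_le_of_injOn {σ τ : Type} [Fintype σ] [DecidableEq σ] [Fintype τ] (M : Matrix σ σ K)
    (g : τ → σ) (h : ∀ w : σ → K, (∀ p, (M *ᵥ w) (g p) = 0) → M *ᵥ w = 0) :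
    M.rank ≤ Fintype.card τ := by
  rw [Matrix.rank, ← Module.finrank_fintype_fun_eq_card (η := τ) K]
  refine LinearMap.finrank_le_finrank_of_injective
    (f := (LinearMap.funLeft K K g).comp M.mulVecLin.range.subtype) ?_
  rw [← LinearMap.ker_eq_bot, LinearMap.ker_eq_bot']
  rintro ⟨_, w, rfl⟩ hw
  exact Subtype.ext (h w fun p => congrFun hw p)

theorem rank_toeplitz_le (hm : m ≤ N) (T : Fin m → Fin N → K[X]) :
    (toeplitz (l := l) T).rank ≤ m * l := by
  have := rank_le_of_injOn (toeplitz (l := l) T)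
    (fun p : Fin m × Fin l => (Fin.castLE hm p.1, p.2)) fun w hw => by
      funext p
      by_cases hp : (p.1 : ℕ) < m
      · exact hw (⟨p.1, hp⟩, p.2)
      · rw [toeplitz_mulVec, dif_neg hp]
        rfl
  simpa using this

/-- A relation modulo `t ^ e` between the rows of `T` makes `e` of the equations redundant. -/
theorem rank_toeplitz_add_le (hm : m ≤ N) {e : ℕ} (he : e ≤ l) {T : Fin m → Fin N → K[X]}
    (h : HasRelation e T) : (toeplitz (l := l) T).rank + e ≤ m * l := by
  obtain ⟨u, hu, i₀, hi₀⟩ := h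
  have h1 := rank_le_of_injOn (toeplitz (l := l) T)
    (fun p : {p : Fin m × Fin l // ¬ (p.1 = i₀ ∧ (p.2 : ℕ) < e)} =>
      (Fin.castLE hm p.1.1, p.1.2)) fun w hw => by
      have hv : ∀ p : Fin m × Fin l, ¬ (p.1 = i₀ ∧ (p.2 : ℕ) < e) →
          (∑ j, T p.1 j * jetPoly w j).coeff p.2 = 0 := by
        intro p hp
        have := hw ⟨p, hp⟩
        rw [toeplitz_mulVec, dif_pos (show ((Fin.castLE hm p.1 : Fin N) : ℕ) < m from p.1.2)] at this
        exact this
      have h2 : Polynomial.X ^ e ∣ ∑ i, u i * ∑ j, T i j * jetPoly w j := by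
        have : ∑ i, u i * ∑ j, T i j * jetPoly w j =
            ∑ j, (∑ i, u i * T i j) * jetPoly w j := by
          simp only [Finset.mul_sum, Finset.sum_mul, mul_assoc]
          exact Finset.sum_comm
        rw [this]
        exact Finset.dvd_sum fun j _ => (hu j).mul_right _
      -- All terms but the one of index `i₀` vanish, and `u i₀` is prime to `t`.
      rw [← Finset.add_sum_erase _ _ (Finset.mem_univ i₀), dvd_add_left] at h2
      · have h3 : Polynomial.X ^ e ∣ ∑ j, T i₀ j * jetPoly w j := by
          refine IsCoprime.dvd_of_dvd_mul_left ?_ h2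
          refine IsCoprime.pow_left ?_
          obtain ⟨r, hr⟩ := Polynomial.X_dvd_sub_C (p := u i₀)
          rw [hi₀, map_one] at hr
          exact ⟨-r, 1, by linear_combination hr⟩
        funext p
        rw [toeplitz_mulVec]
        split_ifs with hp
        · by_cases hp' : (⟨p.1, hp⟩ : Fin m) = i₀ ∧ (p.2 : ℕ) < e
          · rw [hp'.1]
            exact Polynomial.X_pow_dvd_iff.mp h3 _ hp'.2
          · exact hv (⟨p.1, hp⟩, p.2) hp'
        · rfl
      · refine Finset.dvd_sum fun i hi => Dvd.dvd.mul_left ?_ _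
        rw [Polynomial.X_pow_dvd_iff]
        intro b hb
        exact hv (i, ⟨b, by omega⟩) fun h => (Finset.ne_of_mem_erase hi) h.1
  have h2 : Fintype.card {p : Fin m × Fin l // p.1 = i₀ ∧ (p.2 : ℕ) < e} = e := by
    refine (Fintype.card_congr (β := Fin e)
      { toFun := fun p => ⟨p.1.2, p.2.2⟩
        invFun := fun b => ⟨(i₀, ⟨b, by omega⟩), rfl, b.2⟩
        left_inv := fun ⟨⟨i, b⟩, hi, hb⟩ => by subst hi; rfl
        right_inv := fun b => rfl }).trans (Fintype.card_fin e)
  rw [Fintype.card_subtype_compl, h2, Fintype.card_prod, Fintype.card_fin, Fintype.card_fin] at h1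
  have h3 : e ≤ m * l := by
    have := i₀.2
    calc e ≤ l := he
      _ ≤ m * l := Nat.le_mul_of_pos_left _ (by omega)
  omega

end Field

section Spreading

variable {A : Type u} [CommRing A] [IsDomain A]

/-- Finitely many elements of the fraction field of `A` lie in a localization `A_h`, `h ≠ 0`. -/
theorem exists_away_forall_mem_range (s : Finset (FractionRing A)) :
    ∃ (h : A) (_ : h ≠ 0) (φ : Localization.Away h →+* FractionRing A), Function.Injective φ ∧
      φ.comp (algebraMap A _) = algebraMap A (FractionRing A) ∧ ∀ x ∈ s, x ∈ φ.range := by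
  obtain ⟨⟨h, hh⟩, hs⟩ := IsLocalization.exist_integer_multiples_of_finset (nonZeroDivisors A) s
  have hh0 : h ≠ 0 := nonZeroDivisors.ne_zero hh
  have hu : IsUnit (algebraMap A (FractionRing A) h) :=
    IsLocalization.map_units (FractionRing A) (⟨h, hh⟩ : nonZeroDivisors A)
  let φ : Localization.Away h →+* FractionRing A :=
    IsLocalization.Away.lift h (g := algebraMap A (FractionRing A)) hu
  have hφ : φ.comp (algebraMap A _) = algebraMap A (FractionRing A) :=
    IsLocalization.Away.lift_comp h hu
  refine ⟨h, hh0, φ, ?_, hφ, fun x hx => ?_⟩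
  · have hle : Submonoid.powers h ≤ nonZeroDivisors A := powers_le_nonZeroDivisors_of_noZeroDivisors hh0
    refine (IsLocalization.lift_injective_iff _).mpr fun x y => ?_
    rw [(IsLocalization.injective (Localization.Away h) hle).eq_iff,
      (IsFractionRing.injective A (FractionRing A)).eq_iff]
  · obtain ⟨a, ha⟩ := hs x hx
    refine ⟨algebraMap A _ a * IsLocalization.Away.invSelf h, ?_⟩
    have h1 : φ (algebraMap A _ a) = algebraMap A (FractionRing A) a := congrArg (fun t => t a) hφ
    have h2 : φ (algebraMap A _ h) = algebraMap A (FractionRing A) h := congrArg (fun t => t h) hφ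
    have h3 : φ (algebraMap A _ h) * φ (IsLocalization.Away.invSelf h) = 1 := by
      rw [← map_mul, IsLocalization.Away.mul_invSelf, map_one]
    rw [map_mul, h1, ha]
    change h • x * _ = x
    rw [Algebra.smul_def, ← h2]
    linear_combination x * h3

end Spreading

/-! ### The main induction -/

section Generic

theorem X_pow_dvd_of_map {R S : Type u} [CommRing R] [CommRing S] {φ : R →+* S}
    (hφ : Function.Injective φ) {n : ℕ} {p : R[X]} (h : Polynomial.X ^ n ∣ p.map φ) :
    Polynomial.X ^ n ∣ p := by
  rw [Polynomial.X_pow_dvd_iff] at h ⊢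
  intro b hb
  have := h b hb
  rwa [Polynomial.coeff_map, map_eq_zero_iff φ hφ] at this

theorem exists_matrix_lift {R S : Type u} [CommRing R] [CommRing S] (φ : R →+* S) {σ τ : Type}
    (M : Matrix σ τ S) (h : ∀ p q, M p q ∈ φ.range) : ∃ M' : Matrix σ τ R, M'.map φ = M := by
  choose M' hM' using h
  exact ⟨M', by ext; exact hM' _ _⟩

theorem exists_polynomial_lift {R S : Type u} [CommRing R] [CommRing S] (φ : R →+* S) (p : S[X])
    (h : ∀ a ∈ p.coeffs, a ∈ φ.range) : ∃ q : R[X], q.map φ = p := by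
  rw [← Polynomial.mem_lifts, Polynomial.lifts_iff_coeff_lifts]
  intro b
  by_cases hb : p.coeff b = 0
  · exact ⟨0, by rw [hb, map_zero]⟩
  · exact h _ (Polynomial.coeff_mem_coeffs hb)

variable {k : Type u} [Field k] [IsAlgClosed k] {A : Type u} [CommRing A] [IsDomain A] [Algebra k A]
  [Algebra.FiniteType k A] {m N : ℕ}

/-- If a system over a domain can be linearized over the fraction field, its solution algebra is
generically a polynomial ring. -/
theorem exists_away_of_linear {l n s e d : ℕ} (hs : s = e + 1) (hl : s + l = n + 1) (hm : m ≤ N)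
    (G : Fin m → MvPolynomial (Fin N) A[X]) (W : Fin N → Fin m → (FractionRing A)[X])
    (hW : ∀ i i', Polynomial.X ^ (n + 1) ∣ Polynomial.X ^ (s + 1) *
      (∑ j, (linearPart G i j).map (algebraMap A (FractionRing A)) * W j i' -
        if i = i' then Polynomial.X ^ e else 0))
    (hd : d + (toeplitz (l := l) fun i j =>
      (linearPart G i j).map (algebraMap A (FractionRing A))).rank ≤ N * l) :
    ∃ h : A, h ≠ 0 ∧
      LefschetzDvd k d (SolAlg n s l (baseChange (algebraMap A (Localization.Away h)) G)) := by
  classical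
  set T : Fin m → Fin N → (FractionRing A)[X] := fun i j =>
    (linearPart G i j).map (algebraMap A (FractionRing A)) with hT
  obtain ⟨V, U, ε, hV, hU, hM⟩ := Matrix.exists_rank_normal_form (toeplitz (l := l) T)
  obtain ⟨V', hV'⟩ := hV.exists_left_inv
  obtain ⟨U', hU'⟩ := hU.exists_right_inv
  let entries : Matrix (Fin N × Fin l) (Fin N × Fin l) (FractionRing A) → Finset (FractionRing A) :=
    fun M => Finset.univ.image fun p : (Fin N × Fin l) × (Fin N × Fin l) => M p.1 p.2
  have hentries : ∀ M p q, M p q ∈ entries M := fun M p q =>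
    Finset.mem_image_of_mem _ (Finset.mem_univ (p, q))
  obtain ⟨h, hh, φ, hφ, hφA, hr⟩ := exists_away_forall_mem_range (entries V ∪ entries V' ∪
    entries U ∪ entries U' ∪ Finset.univ.biUnion fun p : Fin N × Fin m => (W p.1 p.2).coeffs)
  simp only [Finset.mem_union, Finset.mem_biUnion, Finset.mem_univ, true_and] at hr
  obtain ⟨V₁, rfl⟩ := exists_matrix_lift φ V fun p q => hr _ (by simp [hentries])
  obtain ⟨V₂, rfl⟩ := exists_matrix_lift φ V' fun p q => hr _ (by simp [hentries])
  obtain ⟨U₁, rfl⟩ := exists_matrix_lift φ U fun p q => hr _ (by simp [hentries])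
  obtain ⟨U₂, rfl⟩ := exists_matrix_lift φ U' fun p q => hr _ (by simp [hentries])
  choose W₁ hW₁ using fun j i => exists_polynomial_lift φ (W j i) fun a ha =>
    hr a (Or.inr ⟨(j, i), ha⟩)
  have hinj : Function.Injective fun M : Matrix (Fin N × Fin l) (Fin N × Fin l)
      (Localization.Away h) => M.map φ := Matrix.map_injective hφ
  let G₁ := baseChange (algebraMap A (Localization.Away h)) G
  have hT₁ : ∀ i j, (linearPart G₁ i j).map φ = T i j := fun i j => by
    rw [linearPart_baseChange, Polynomial.map_map, hφA]
  refine ⟨h, hh, lefschetzDvd_solAlg_of_linear (e := e) hs hl hm G₁ W₁ (fun i i' => ?_) ε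
    (V := V₁) (V' := V₂) (U := U₁) (U' := U₂) (hinj ?_) (hinj ?_) (hinj ?_) ?_⟩
  · refine X_pow_dvd_of_map hφ ?_
    have := hW i i'
    simp only [Polynomial.map_mul, Polynomial.map_sub, Polynomial.map_sum, Polynomial.map_pow,
      Polynomial.map_X, hT₁, hW₁, apply_ite (Polynomial.map φ), Polynomial.map_zero]
    exact this
  · dsimp only
    rw [Matrix.map_mul, hV', Matrix.map_one _ (map_zero φ) (map_one φ)]
  · dsimp only
    rw [Matrix.map_mul, hU', Matrix.map_one _ (map_zero φ) (map_one φ)]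
  · dsimp only
    rw [Matrix.map_mul, Matrix.map_mul, map_toeplitz]
    simp only [hT₁]
    rw [hM, ← Matrix.submatrix_map, fromBlocks_map, Matrix.map_one _ (map_zero φ) (map_one φ)]
    simp
  · have := Fintype.card_congr ε
    simp only [Fintype.card_sum, Fintype.card_prod, Fintype.card_fin] at this ⊢
    omega

/-- A relation over the fraction field spreads out. -/
theorem exists_away_hasRelation {e : ℕ} {T : Fin m → Fin N → A[X]}
    (hT : HasRelation e fun i j => (T i j).map (algebraMap A (FractionRing A))) :
    ∃ h : A, h ≠ 0 ∧
      HasRelation e fun i j => (T i j).map (algebraMap A (Localization.Away h)) := by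
  classical
  obtain ⟨u, hu, i, hi⟩ := hT
  obtain ⟨h, hh, φ, hφ, hφA, hr⟩ :=
    exists_away_forall_mem_range (Finset.univ.biUnion fun i => (u i).coeffs)
  choose v hv using fun i => exists_polynomial_lift φ (u i) fun a ha =>
    hr a (Finset.mem_biUnion.mpr ⟨i, Finset.mem_univ _, ha⟩)
  refine ⟨h, hh, v, fun j => X_pow_dvd_of_map hφ ?_, i, hφ ?_⟩
  · have := hu j
    simpa only [Polynomial.map_sum, Polynomial.map_mul, hv, Polynomial.map_map, hφA] using this
  · rw [← Polynomial.coeff_map, hv, hi, map_one]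

theorem X_pow_dvd_mul_zero_sub {R : Type u} [CommRing R] {n e : ℕ} (h : n ≤ 2 * e + 1)
    (T : Fin m → Fin N → R[X]) (i i' : Fin m) : Polynomial.X ^ (n + 1) ∣ Polynomial.X ^ (e + 1 + 1) *
      (∑ j, T i j * (0 : Fin N → Fin m → R[X]) j i' - if i = i' then Polynomial.X ^ e else 0) := by
  simp only [Pi.zero_apply, mul_zero, Finset.sum_const_zero, zero_sub]
  split_ifs
  · rw [mul_neg, ← pow_add, dvd_neg]
    exact pow_dvd_pow _ (by omega)
  · simp

/-- A system over a domain whose linear part satisfies a relation modulo `t ^ e`: generically either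
the system can be linearized and has few equations, or there is a relation modulo `t ^ (e + 1)`, and
splitting off one coefficient of the unknowns reduces to the latter situation. -/
theorem exists_away_lefschetzDvd {n e l d : ℕ} (hm : m ≤ N) (hl : e + l = n) (hel : e ≤ l)
    (hd : d + m * l ≤ N * l + e) (G : Fin m → MvPolynomial (Fin N) A[X])
    (hG : e = 0 ∨ HasRelation e (linearPart G))
    (ih : ∀ l', l = l' + 1 → e + 1 ≤ l' → ∀ (A : Type u) [CommRing A] [Algebra k A]
      [Algebra.FiniteType k A] (G : Fin m → MvPolynomial (Fin N) A[X]),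
      HasRelation (e + 1) (linearPart G) → LefschetzDvd k d (SolAlg n (e + 1 + 1) l' G)) :
    ∃ h : A, h ≠ 0 ∧ LefschetzDvd k d
      (SolAlg n (e + 1) l (baseChange (algebraMap A (Localization.Away h)) G)) := by
  set T : Fin m → Fin N → (FractionRing A)[X] := fun i j =>
    (linearPart G i j).map (algebraMap A (FractionRing A))
  have hrank : d + (toeplitz (l := l) T).rank ≤ N * l := by
    rcases hG with rfl | hG
    · have := rank_toeplitz_le (l := l) hm T
      omega
    · have : (toeplitz (l := l) T).rank + e ≤ m * l :=
        rank_toeplitz_add_le hm hel (hG.map (algebraMap A (FractionRing A)))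
      omega
  have hlin : ∀ W : Fin N → Fin m → (FractionRing A)[X], (∀ i i', Polynomial.X ^ (n + 1) ∣
      Polynomial.X ^ (e + 1 + 1) * (∑ j, T i j * W j i' - if i = i' then Polynomial.X ^ e else 0)) →
      ∃ h : A, h ≠ 0 ∧ LefschetzDvd k d
        (SolAlg n (e + 1) l (baseChange (algebraMap A (Localization.Away h)) G)) := fun W hW =>
    exists_away_of_linear rfl (by omega) hm G W hW hrank
  by_cases hle : l ≤ e + 1
  · -- The nonlinear terms vanish modulo `t ^ (n + 1)`.
    exact hlin 0 (X_pow_dvd_mul_zero_sub (by omega) T)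
  obtain ⟨l, rfl⟩ : ∃ l', l = l' + 1 := ⟨l - 1, by omega⟩
  rcases exists_inverse_or_hasRelation e T with ⟨W, hW⟩ | hrel
  · obtain ⟨W', hW'⟩ := exists_inverse_of_le hW (n + 1)
    exact hlin W' fun i i' => (hW' i i').mul_left _
  · obtain ⟨h, hh, hrel⟩ := exists_away_hasRelation hrel
    have : Algebra.FiniteType k (Localization.Away h) :=
      Algebra.FiniteType.trans (S := A) inferInstance inferInstance
    refine ⟨h, hh, ?_⟩
    set G₁ := baseChange (algebraMap A (Localization.Away h)) G
    have hG₁ : HasRelation (e + 1) (linearPart (shiftSystem (e + 1) G₁)) := by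
      have h1 : HasRelation (e + 1) (linearPart G₁) := by
        refine hrel.congr fun i j => ?_
        rw [linearPart_baseChange, sub_self]
        exact dvd_zero _
      exact (h1.map MvPolynomial.C).congr fun i j =>
        X_pow_dvd_linearPart_shiftSystem_sub (e + 1) G₁ i j
    obtain ⟨E⟩ := nonempty_solAlg_shiftSystem_equiv n (e + 1) l G₁
    have : Algebra.FiniteType k (MvPolynomial (Fin N) (Localization.Away h)) :=
      Algebra.FiniteType.trans (S := Localization.Away h) inferInstance inferInstance
    exact (ih l rfl (by omega) _ _ hG₁).of_algEquiv (E.restrictScalars k)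

end Generic

/-- Solutions `t ^ (e + 1) * y` of a system whose linear part satisfies a
relation modulo `t ^ e` form a family whose class is divisible by `𝕃 ^ d`. -/
theorem lefschetzDvd_solAlg {k : Type u} [Field k] [IsAlgClosed k] {m N n d : ℕ} (hm : m ≤ N)
    (hd : ∀ e l, e + l = n → e ≤ l → d + m * l ≤ N * l + e) (l : ℕ) :
    ∀ (e : ℕ), e + l = n → e ≤ l → ∀ (A : Type u) [CommRing A] [Algebra k A]
      [Algebra.FiniteType k A] (G : Fin m → MvPolynomial (Fin N) A[X]),
      (e = 0 ∨ HasRelation e (linearPart G)) → LefschetzDvd k d (SolAlg n (e + 1) l G) := by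
  induction l using Nat.strong_induction_on with
  | _ l ih =>
    intro e hl hel A _ _ _ G hG
    refine LefschetzDvd.of_generic (A₀ := A) fun A' _ _ _ _ _ _ => ?_
    let G' := baseChange (algebraMap A A') G
    have hG' : e = 0 ∨ HasRelation e (linearPart G') := by
      refine hG.imp id fun hG => (hG.map (algebraMap A A')).congr fun i j => ?_
      rw [linearPart_baseChange, sub_self]
      exact dvd_zero _
    obtain ⟨h, hh, H⟩ := exists_away_lefschetzDvd (k := k) hm hl hel (hd e l hl hel) G' hG'
      fun l' hl' hel' B _ _ _ G₂ hG₂ =>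
        ih l' (by omega) (e + 1) (by omega) hel' B G₂ (Or.inr hG₂)
    refine ⟨h, hh, ?_⟩
    obtain ⟨E⟩ := nonempty_tensor_solAlg_equiv n (e + 1) l G (R := Localization.Away h)
    have h1 : baseChange (algebraMap A' (Localization.Away h)) G' =
        baseChange (algebraMap A (Localization.Away h)) G := by
      rw [baseChange_comp, ← IsScalarTower.algebraMap_eq]
    rw [h1] at H
    exact H.of_algEquiv (E.restrictScalars k).symm

/-- The main induction applies to all solutions once the constant terms of the unknowns are moved to
the base. -/
theorem lefschetzDvd_solAlg_zero {k : Type u} [Field k] [IsAlgClosed k] {m N n d : ℕ} (hm : m ≤ N)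
    (hd : ∀ e l, e + l = n → e ≤ l → d + m * l ≤ N * l + e) (A : Type u) [CommRing A] [Algebra k A]
    [Algebra.FiniteType k A] (G : Fin m → MvPolynomial (Fin N) A[X]) :
    LefschetzDvd k d (SolAlg n 0 (n + 1) G) := by
  obtain ⟨E⟩ := nonempty_solAlg_shiftSystem_equiv n 0 n G
  have : Algebra.FiniteType k (MvPolynomial (Fin N) A) :=
    Algebra.FiniteType.trans (S := A) inferInstance inferInstance
  exact (lefschetzDvd_solAlg hm hd n 0 (by omega) (by omega) _ _ (Or.inl rfl)).of_algEquiv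
    (E.restrictScalars k)

/-- The number of free parameters at stage `e` is at least the required exponent. -/
theorem add_mul_le_of_ceil {N m : ℕ} (hm : m < N) {n e l : ℕ} (hl : e + l = n) (hel : e ≤ l) :
    ⌈((N : ℚ) - m + 1) * (n / 2)⌉₊ + m * l ≤ N * l + e := by
  obtain ⟨c, rfl⟩ : ∃ c, N = m + 1 + c := ⟨N - m - 1, by omega⟩
  have h : ⌈(((m + 1 + c : ℕ) : ℚ) - m + 1) * (n / 2)⌉₊ ≤ (c + 1) * l + e := by
    rw [Nat.ceil_le]
    subst hl
    push_cast
    have : (e : ℚ) ≤ l := by exact_mod_cast hel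
    have hc : (0 : ℚ) ≤ c := Nat.cast_nonneg c
    nlinarith [mul_nonneg hc (sub_nonneg.mpr this)]
  calc _ ≤ (c + 1) * l + e + m * l := Nat.add_le_add_right h _
    _ = _ := by ring

end MatrixArguments

/-! ### Jets as solutions of a system -/

section TruncatedPolynomials

variable {k D R S : Type u} [CommRing k] [CommRing D] [Algebra k D] [CommRing R] [Algebra k R]
  [CommRing S] [Algebra k S] {n : ℕ} {t : D}

/-- Evaluation of polynomials at `1 ⊗ t`. -/
noncomputable def evalTmul (k : Type u) {D : Type u} [CommRing k] [CommRing D] [Algebra k D]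
    (R : Type u) [CommRing R] [Algebra k R] (t : D) : R[X] →ₐ[R] R ⊗[k] D :=
  Polynomial.aeval ((1 : R) ⊗ₜ[k] t)

theorem map_evalTmul (g : R →ₐ[k] S) (p : R[X]) :
    Algebra.TensorProduct.map g (AlgHom.id k D) (evalTmul k R t p) =
      evalTmul k S t (p.map (g : R →+* S)) := by
  induction p using Polynomial.induction_on' with
  | add p q hp hq => rw [map_add, map_add, hp, hq, Polynomial.map_add, map_add]
  | monomial b x => simp [evalTmul, Polynomial.aeval_monomial]

/-- If `1, t, …, t ^ n` is a basis of `D`, every element of `R ⊗ D` is uniquely of the form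
`∑ i, c i * t ^ i`. -/
theorem bijective_sum_smul_tmul_pow (b : Module.Basis (Fin (n + 1)) k D)
    (hb : ∀ i, b i = t ^ (i : ℕ)) :
    Function.Bijective fun c : Fin (n + 1) → R => ∑ i, c i • ((1 : R) ⊗ₜ[k] t) ^ (i : ℕ) := by
  have h := (b.baseChange R).equivFun.symm.bijective
  have h1 : ⇑(b.baseChange R).equivFun.symm =
      fun c : Fin (n + 1) → R => ∑ i, c i • ((1 : R) ⊗ₜ[k] t) ^ (i : ℕ) := by
    funext c
    rw [Module.Basis.equivFun_symm_apply]
    refine Finset.sum_congr rfl fun i _ => ?_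
    rw [Module.Basis.baseChange_apply, hb, Algebra.TensorProduct.tmul_pow, one_pow]
  rwa [h1] at h

theorem evalTmul_eq_sum (ht : t ^ (n + 1) = 0) (p : R[X]) :
    evalTmul k R t p = ∑ i : Fin (n + 1), p.coeff i • ((1 : R) ⊗ₜ[k] t) ^ (i : ℕ) := by
  have h : Polynomial.X ^ (n + 1) ∣
      p - ∑ i : Fin (n + 1), Polynomial.C (p.coeff i) * Polynomial.X ^ (i : ℕ) := by
    rw [Polynomial.X_pow_dvd_iff]
    intro b hb
    rw [Polynomial.coeff_sub, Polynomial.finsetSum_coeff, Finset.sum_eq_single ⟨b, hb⟩]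
    · simp
    · intro c _ hc
      rw [Polynomial.coeff_C_mul, Polynomial.coeff_X_pow, if_neg, mul_zero]
      exact fun h => hc (Fin.ext h.symm)
    · simp
  obtain ⟨q, hq⟩ := h
  rw [sub_eq_iff_eq_add] at hq
  conv_lhs => rw [hq]
  simp [evalTmul, Algebra.TensorProduct.tmul_pow, ht, TensorProduct.smul_tmul']

theorem evalTmul_eq_zero_iff (b : Module.Basis (Fin (n + 1)) k D) (hb : ∀ i, b i = t ^ (i : ℕ))
    (ht : t ^ (n + 1) = 0) (p : R[X]) : evalTmul k R t p = 0 ↔ Polynomial.X ^ (n + 1) ∣ p := by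
  rw [evalTmul_eq_sum ht, Polynomial.X_pow_dvd_iff]
  constructor
  · intro h c hc
    have h1 := (bijective_sum_smul_tmul_pow (R := R) b hb).1
      (a₁ := fun i => p.coeff i) (a₂ := 0) (by simpa using h)
    exact congrFun h1 ⟨c, hc⟩
  · intro h
    exact Finset.sum_eq_zero fun i _ => by rw [h i i.2, zero_smul]

end TruncatedPolynomials

section JetPoints

/-- The algebra `k[t]/(t^(n+1))`. -/
abbrev Trunc (k : Type u) [Field k] (n : ℕ) : Type u :=
  k[X] ⧸ Ideal.span {(Polynomial.X : k[X]) ^ (n + 1)}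

/-- The class of `t` in `k[t]/(t^(n+1))`. -/
noncomputable def truncVar (k : Type u) [Field k] (n : ℕ) : Trunc k n :=
  Ideal.Quotient.mk _ Polynomial.X

theorem truncVar_pow (k : Type u) [Field k] (n : ℕ) : truncVar k n ^ (n + 1) = 0 :=
  Ideal.Quotient.eq_zero_iff_mem.mpr (Ideal.mem_span_singleton_self _)

theorem exists_truncBasis (k : Type u) [Field k] (n : ℕ) :
    ∃ b : Module.Basis (Fin (n + 1)) k (Trunc k n), ∀ i, b i = truncVar k n ^ (i : ℕ) := by
  let pb : PowerBasis k (Trunc k n) := AdjoinRoot.powerBasis' (Polynomial.monic_X_pow (n + 1))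
  have h : pb.dim = n + 1 := Polynomial.natDegree_X_pow (n + 1)
  refine ⟨pb.basis.reindex (finCongr h), fun i => ?_⟩
  rw [Module.Basis.reindex_apply, pb.basis_eq_pow]
  rfl

theorem evalTmul_truncVar_eq_zero_iff {k : Type u} [Field k] {n : ℕ} {R : Type u} [CommRing R]
    [Algebra k R] (p : R[X]) : evalTmul k R (truncVar k n) p = 0 ↔ Polynomial.X ^ (n + 1) ∣ p := by
  obtain ⟨b, hb⟩ := exists_truncBasis k n
  exact evalTmul_eq_zero_iff b hb (truncVar_pow k n) p

variable {k : Type u} [Field k] {n : ℕ} {R : Type u} [CommRing R] [Algebra k R] {N m : ℕ}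

/-- A system with constant coefficients, as a system with coefficients in `k[t]`. -/
noncomputable def constSystem (f : Fin m → MvPolynomial (Fin N) k) :
    Fin m → MvPolynomial (Fin N) k[X] :=
  fun i => MvPolynomial.map Polynomial.C (f i)

theorem aeval_evalTmul_jetPoly (f : Fin m → MvPolynomial (Fin N) k) (y : Fin N × Fin (n + 1) → R)
    (i : Fin m) : MvPolynomial.aeval (fun j => evalTmul k R (truncVar k n) (jetPoly y j)) (f i) =
      evalTmul k R (truncVar k n) (MvPolynomial.eval (fun j => Polynomial.X ^ 0 * jetPoly y j)
        (baseChange (algebraMap k R) (constSystem f) i)) := by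
  simp only [baseChange, constSystem, MvPolynomial.eval_map, MvPolynomial.map_map, pow_zero, one_mul]
  generalize f i = g
  induction g using MvPolynomial.induction_on with
  | C a =>
    simp only [MvPolynomial.aeval_C, MvPolynomial.eval₂_C, RingHom.comp_apply,
      Polynomial.coe_mapRingHom, Polynomial.map_C, evalTmul, Polynomial.aeval_C]
    rfl
  | add p q hp hq => simp only [MvPolynomial.eval₂_add, map_add, hp, hq]
  | mul_X p j hp => simp only [MvPolynomial.eval₂_mul, MvPolynomial.eval₂_X, map_mul, hp,
      MvPolynomial.aeval_X]

theorem aeval_evalTmul_truncVar_eq_zero_iff (f : Fin m → MvPolynomial (Fin N) k)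
    (y : Fin N × Fin (n + 1) → R) :
    IsJetSol n 0 (baseChange (algebraMap k R) (constSystem f)) y ↔
      ∀ i, MvPolynomial.aeval (fun j => evalTmul k R (truncVar k n) (jetPoly y j)) (f i) = 0 := by
  simp only [aeval_evalTmul_jetPoly, evalTmul_truncVar_eq_zero_iff]
  rfl

/-- The point of `V(f)` with values in `R ⊗ k[t]/(t^(n+1))` whose coordinates have the coefficients
given by a point of `SolAlg`. -/
noncomputable def jetPointsHom (f : Fin m → MvPolynomial (Fin N) k)
    (φ : SolAlg n 0 (n + 1) (constSystem f) →ₐ[k] R) :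
    (MvPolynomial (Fin N) k ⧸ Ideal.span (Set.range f)) →ₐ[k] R ⊗[k] Trunc k n :=
  Ideal.Quotient.liftₐ _ (MvPolynomial.aeval fun j =>
    evalTmul k R (truncVar k n) (jetPoly (fun p => φ (solPoint n 0 (n + 1) (constSystem f) p)) j)) (by
      intro a ha
      refine (Ideal.span_le.mpr ?_ : Ideal.span (Set.range f) ≤ RingHom.ker (MvPolynomial.aeval fun j =>
        evalTmul k R (truncVar k n) (jetPoly
          (fun p => φ (solPoint n 0 (n + 1) (constSystem f) p)) j))) ha
      rintro _ ⟨i, rfl⟩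
      exact (aeval_evalTmul_truncVar_eq_zero_iff f _).mp (isJetSol_hom φ) i)

theorem jetPointsHom_mk_X (f : Fin m → MvPolynomial (Fin N) k)
    (φ : SolAlg n 0 (n + 1) (constSystem f) →ₐ[k] R) (j : Fin N) :
    jetPointsHom f φ (Ideal.Quotient.mk _ (MvPolynomial.X j)) =
      evalTmul k R (truncVar k n) (jetPoly (fun p => φ (solPoint n 0 (n + 1) (constSystem f) p)) j) :=
  MvPolynomial.aeval_X (R := k) _ j

theorem quotient_algHom_ext {I : Ideal (MvPolynomial (Fin N) k)} {B : Type u} [Semiring B]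
    [Algebra k B] {f g : (MvPolynomial (Fin N) k ⧸ I) →ₐ[k] B}
    (h : ∀ j, f (Ideal.Quotient.mk _ (MvPolynomial.X j)) =
      g (Ideal.Quotient.mk _ (MvPolynomial.X j))) : f = g :=
  Ideal.Quotient.algHom_ext k (MvPolynomial.algHom_ext h)

theorem jetPointsHom_bijective (f : Fin m → MvPolynomial (Fin N) k) :
    Function.Bijective (jetPointsHom (n := n) (R := R) f) := by
  constructor
  · intro φ ψ h
    apply solAlg_hom_ext
    rintro ⟨j, b⟩
    have h1 := congrArg (fun t => t (Ideal.Quotient.mk _ (MvPolynomial.X j))) h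
    simp only [jetPointsHom_mk_X] at h1
    rw [← sub_eq_zero, ← map_sub, evalTmul_truncVar_eq_zero_iff, X_pow_dvd_jetPoly_sub_iff] at h1
    exact h1 b b.2
  · intro ψ
    obtain ⟨b, hb⟩ := exists_truncBasis k n
    choose c hc using fun j => (bijective_sum_smul_tmul_pow (R := R) b hb).2
      (ψ (Ideal.Quotient.mk _ (MvPolynomial.X j)))
    let y : Fin N × Fin (n + 1) → R := fun p => c p.1 p.2
    have hy : ∀ j, evalTmul k R (truncVar k n) (jetPoly y j) =
        ψ (Ideal.Quotient.mk _ (MvPolynomial.X j)) := by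
      intro j
      rw [evalTmul_eq_sum (truncVar_pow k n), ← hc]
      simp only [coeff_jetPoly, y]
    have h1 : MvPolynomial.aeval (fun j => evalTmul k R (truncVar k n) (jetPoly y j)) =
        ψ.comp (Ideal.Quotient.mkₐ k _) := by
      apply MvPolynomial.algHom_ext
      intro j
      rw [MvPolynomial.aeval_X, hy]
      rfl
    have h2 : IsJetSol n 0 (baseChange (algebraMap k R) (constSystem f)) y := by
      rw [aeval_evalTmul_truncVar_eq_zero_iff, h1]
      intro i
      have : Ideal.Quotient.mk (Ideal.span (Set.range f)) (f i) = 0 :=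
        Ideal.Quotient.eq_zero_iff_mem.mpr (Ideal.subset_span ⟨i, rfl⟩)
      exact (congrArg ψ this).trans (map_zero ψ)
    refine ⟨solLift y h2, ?_⟩
    apply quotient_algHom_ext
    intro j
    rw [jetPointsHom_mk_X, ← hy]
    congr 2
    exact funext fun p => solLift_solPoint y h2 p

theorem jetPointsHom_comp (f : Fin m → MvPolynomial (Fin N) k) {S : Type u} [CommRing S]
    [Algebra k S] (g : R →ₐ[k] S) (φ : SolAlg n 0 (n + 1) (constSystem f) →ₐ[k] R) :
    jetPointsHom f (g.comp φ) =
      (Algebra.TensorProduct.map g (AlgHom.id k (Trunc k n))).comp (jetPointsHom f φ) := by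
  apply quotient_algHom_ext
  intro j
  rw [AlgHom.comp_apply, jetPointsHom_mk_X, jetPointsHom_mk_X, map_evalTmul, map_jetPoly]
  rfl

end JetPoints

/-- The class of the jet scheme of a closed subscheme of affine space is the class of the spectrum of
the algebra of solutions. -/
theorem cls_jetScheme_eq_specClass_solAlg {k : Type u} [Field k] [IsAlgClosed k] {N m : ℕ}
    (X : ClosedSubscheme k N) (f : Fin m → MvPolynomial (Fin N) k)
    (hf : X.definingIdeal = Ideal.span (Set.range f)) (n : ℕ) :
    cls k (reducedVariety k (jetScheme k n X.toOver)) =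
      specClass k (SolAlg n 0 (n + 1) (constSystem f)) := by
  let ι : (MvPolynomial (Fin N) k ⧸ X.definingIdeal) ≃ₐ[k]
      MvPolynomial (Fin N) k ⧸ Ideal.span (Set.range f) := Ideal.quotientEquivAlgOfEq k hf
  refine cls_jetScheme X n _ (fun R _ _ => (Equiv.ofBijective _ (jetPointsHom_bijective f)).trans
    (AlgEquiv.arrowCongr ι.symm AlgEquiv.refl)) fun R S _ _ _ _ g φ => ?_
  ext1 a
  exact congrArg (fun t => t (ι a)) (jetPointsHom_comp f g φ)

end JetClass

theorem theorem4 (k : Type u) [Field k] [IsAlgClosed k] (N m : ℕ) (hm : m < N)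
    (X : JetClass.ClosedSubscheme k N) (f : Fin m → MvPolynomial (Fin N) k)
    (hf : X.definingIdeal = Ideal.span (Set.range f)) (n : ℕ) :
    JetClass.lefschetz k ^ ⌈((N : ℚ) - m + 1) * (n / 2)⌉₊ ∣
      JetClass.cls k (JetClass.reducedVariety k (JetClass.jetScheme k n
        (JetClass.ClosedSubscheme.toOver X))) := by
  obtain ⟨_, h⟩ := JetClass.lefschetzDvd_solAlg_zero (k := k) hm.le
    (fun e l hl hel => JetClass.add_mul_le_of_ceil hm hl hel) k (JetClass.constSystem f) (n := n)
  rwa [JetClass.cls_jetScheme_eq_specClass_solAlg X f hf n]
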